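/- Let $(M,\omega,\mathbb T)$ be a compact connected symplectic toric manifold of real dimension $2m$: the torus $\mathbb T=U(1)^m$ acts smoothly and effectively on $(M,\omega)$ with smooth $\mathbb T$-invariant moment map $\mu:M\to\mathfrak t^*$. Fix a basis $(\xi_j)$ of $\mathfrak t$, let $K_j$ be the infinitesimal action of $\xi_j$ and $\mu^j=\langle\mu,\xi_j\rangle$, with the sign convention $\omega(K_j,\cdot)=-d\mu^j$. Let $\mathcal K$ be the distribution spanned by the $K_j$ and let $\mathring M\subset M$ be the dense open set on which $\mathbb T$ acts freely. For an almost complex structure $J$ let $J^{*_\omega}$ be its symplectic adjoint, $\omega(J\cdot,\cdot)=\omega(\cdot,J^{*_\omega}\cdot)$. Write $K_\omega^{\mathbb T}(M)$ for the set of $\mathbb T$-invariant integrable complex structures $J$ that are $\omega$-compatible (so $\omega(\cdot,J\cdot)$ is positive definite and $J^{*_\omega}=-J$), and $DGK_\omega^{\mathbb T}(M)$ for the set of $\mathbb T$-invariant integrable complex structures $J$ such that $\omega(\cdot,J\cdot)$ is positive definite, $J^{*_\omega}$ is integrable and $J^{*_\omega}\mathcal K=J\mathcal K$ on $\mathring M$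 (these are generalized Kähler structures of symplectic type, with $J_+=J$ and $J_-=J^{*_\omega}$). Let $J_0\in K_\omega^{\mathbb T}(M)$ and let $C$ be a constant real antisymmetric $m\times m$ matrix. On $\mathring M$ let $(\mu^j,t^j)$ be the momentum-angle coordinates determined by $J_0$, i.e. $\partial/\partial t^j=K_j$, $\partial/\partial\mu^j\in J_0\mathcal K$ and $d\mu^i(\partial/\partial\mu^j)=\delta_{ij}$; in them $$J_0=\sum_{i,j}S_{ij}\frac{\partial}{\partial t^i}\otimes d\mu^j-\sum_{i,j}(S^{-1})_{ij}\frac{\partial}{\partial\mu^i}\otimes dt^j$$ with $S$ symmetric positive definite. Consider smooth families $J_t\in DGK_\omega^{\mathbb T}(M)$, $|t|<\varepsilon$, that start at $J_0$ and satisfy on $\mathring M$ $$J_t=\sum_{i,j}\Psi_{ij}(t)\frac{\partial}{\partial t^i}\otimes d\mu^j-\sum_{i,j}(\Psi(t)^{-1})_{ij}\frac{\partial}{\partial\mu^i}\otimes dt^j,\qquad \Psi(t)=S+tC .$$ Here the Kodaira–Spencer class in $H^{0,1}(M,T^{1,0})$ (the Dolbeault group of $(M,J_0)$) of a smooth family of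 complex structures starting at $J_0$ is normalized to be the class of the $T^{1,0}$-valued $(0,1)$-form $Y\mapsto\bigl(\tfrac{d}{dt}\big|_{t=0}J_tY\bigr)^{1,0}$, $Y\in T^{0,1}$. For a bivector $\sigma=\sum\sigma^{k\ell}\frac{\partial}{\partial z^k}\otimes\frac{\partial}{\partial z^\ell}$ of type $(2,0)$ let $\sigma\omega$ be the $T^{1,0}$-valued $(0,1)$-form $\sum\omega_{\ell\bar j}\sigma^{\ell k}\,d\bar z^j\otimes\frac{\partial}{\partial z^k}$, where $\omega_{\ell\bar j}=\omega(\partial/\partial z^\ell,\partial/\partial\bar z^j)$. Then: 1. With $K_j^{1,0}=\frac12(K_j-iJ_0K_j)$, $$\sigma=2\sum_{j,k=1}^m C_{jk}\,K_j^{1,0}\otimes K_k^{1,0}$$ is a holomorphic Poisson structure on $(M,J_0)$. 2. For some $\varepsilon>0$ such a family $(J_t)_{|t|<\varepsilon}$ exists. 3. $\sigma\omega$ is $\bar\partial$-closed, and for every such family $(J_t)_{|t|<\varepsilon}$, with any $\varepsilon>0$, the form representing the Kodaira–Spencer class is $\bar\partial$-closed and the Kodaira–Spencer class is $[\sigma\omega]$.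 The first variation of $J_-(t)=J_t^{*_\omega}$ yields the opposite class: the family $-J_t^{*_\omega}$, which also starts at $J_0$, has Kodaira–Spencer class $-[\sigma\omega]$. If $C\neq0$, then $\sigma\neq0$ and $J_t\notin K_\omega^{\mathbb T}(M)$ for all $0<|t|<\varepsilon$. -/

import Mathlib

open scoped Manifold ContDiff TensorProduct Bundle

noncomputable section

namespace ToricGK

section Geometry

variable {n : ℕ} {M : Type*} [TopologicalSpace M] [ChartedSpace (EuclideanSpace ℝ (Fin n)) M]

/-! ### Real tensor fields on an `n`-dimensional manifold -/

variable (n M) in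
/-- Real vector fields. -/
abbrev RField := (x : M) → TangentSpace (𝓡 n) x

variable (n M) in
/-- Fields of endomorphisms of the tangent bundle. -/
abbrev EndField := (x : M) → (TangentSpace (𝓡 n) x →L[ℝ] TangentSpace (𝓡 n) x)

variable (n M) in
/-- Covariant 2-tensors; `Ω x v w` is the value of `Ω` on `(v, w)`. -/
abbrev TwoTensor :=
  (x : M) → (TangentSpace (𝓡 n) x →L[ℝ] TangentSpace (𝓡 n) x →L[ℝ] ℝ)

/-- The vector field `A X`. -/
def EndField.app (A : EndField n M) (X : RField n M) : RField n M := fun x => A x (X x)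

/-- The Lie bracket of vector fields. -/
abbrev bracket (X Y : RField n M) : RField n M := VectorField.mlieBracket (𝓡 n) X Y

/-! ### The complexified tangent bundle -/

/-- The complexified tangent space `T_x M ⊗ ℂ`. -/
abbrev CT (n : ℕ) {M : Type*} [TopologicalSpace M] [ChartedSpace (EuclideanSpace ℝ (Fin n)) M]
    (x : M) : Type := ℂ ⊗[ℝ] TangentSpace (𝓡 n) x

variable (n M) in
/-- Complex vector fields, i.e. sections of `TM ⊗ ℂ`. -/
abbrev CField := (x : M) → CT n x

variable (n M) in
/-- Fields of complex linear endomorphisms of `TM ⊗ ℂ`. -/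
abbrev CEndField := (x : M) → (CT n x →ₗ[ℂ] CT n x)

/-- The real part `v` of `v + i w`. -/
def rePart {V : Type*} [AddCommGroup V] [Module ℝ V] : ℂ ⊗[ℝ] V →ₗ[ℝ] V :=
  (TensorProduct.lid ℝ V).toLinearMap ∘ₗ LinearMap.rTensor V Complex.reLm

/-- The imaginary part `w` of `v + i w`. -/
def imPart {V : Type*} [AddCommGroup V] [Module ℝ V] : ℂ ⊗[ℝ] V →ₗ[ℝ] V :=
  (TensorProduct.lid ℝ V).toLinearMap ∘ₗ LinearMap.rTensor V Complex.imLm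

/-- The real part of a complex vector field. -/
def CField.re (Z : CField n M) : RField n M := fun x => rePart (Z x)

/-- The imaginary part of a complex vector field. -/
def CField.im (Z : CField n M) : RField n M := fun x => imPart (Z x)

/-- The complex bilinear extension of the Lie bracket. -/
def cbracket (Z W : CField n M) : CField n M := fun x =>
  (1 : ℂ) ⊗ₜ[ℝ] (bracket Z.re W.re x - bracket Z.im W.im x)
    + Complex.I ⊗ₜ[ℝ] (bracket Z.re W.im x + bracket Z.im W.re x)

/-- The complex linear extension of an endomorphism field. -/
def EndField.complexify (A : EndField n M) : CEndField n M :=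
  fun x => (A x).toLinearMap.baseChange ℂ

/-- The projection `½(1 - iJ)` onto `T^{1,0}`. -/
def proj10 (J : EndField n M) : CEndField n M :=
  fun x => (1 / 2 : ℂ) • (LinearMap.id - Complex.I • J.complexify x)

/-- The projection `½(1 + iJ)` onto `T^{0,1}`. -/
def proj01 (J : EndField n M) : CEndField n M :=
  fun x => (1 / 2 : ℂ) • (LinearMap.id + Complex.I • J.complexify x)

theorem rePart_smul {V : Type*} [AddCommGroup V] [Module ℝ V] (c : ℂ) (z : ℂ ⊗[ℝ] V) :
    rePart (c • z) = c.re • rePart z - c.im • imPart z := by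
  induction z using TensorProduct.induction_on with
  | zero => simp
  | tmul a v => simp [rePart, imPart, TensorProduct.smul_tmul', sub_smul, mul_smul]
  | add a b ha hb => simp only [smul_add, map_add, ha, hb]; abel

theorem imPart_smul {V : Type*} [AddCommGroup V] [Module ℝ V] (c : ℂ) (z : ℂ ⊗[ℝ] V) :
    imPart (c • z) = c.re • imPart z + c.im • rePart z := by
  induction z using TensorProduct.induction_on with
  | zero => simp
  | tmul a v => simp [rePart, imPart, TensorProduct.smul_tmul', add_smul, mul_smul]
  | add a b ha hb => simp only [smul_add, map_add, ha, hb]; abel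

theorem CField.re_add (Z W : CField n M) : (Z + W).re = Z.re + W.re := by
  funext x; simp [CField.re]

theorem CField.im_add (Z W : CField n M) : (Z + W).im = Z.im + W.im := by
  funext x; simp [CField.im]

theorem CField.re_smul (c : ℂ) (Z : CField n M) :
    (c • Z).re = c.re • Z.re + (-c.im) • Z.im := by
  funext x; simp [CField.re, CField.im, rePart_smul, sub_eq_add_neg]

theorem CField.im_smul (c : ℂ) (Z : CField n M) :
    (c • Z).im = c.re • Z.im + c.im • Z.re := by
  funext x; simp [CField.re, CField.im, imPart_smul]

theorem cbracket_zero_right (Y : CField n M) (x : M) : cbracket Y 0 x = 0 := by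
  have h1 : (0 : CField n M).re = 0 := by funext x; simp [CField.re]
  have h2 : (0 : CField n M).im = 0 := by funext x; simp [CField.im]
  simp [cbracket, h1, h2]

/-! ### Smooth fields, symplectic forms, complex structures -/

variable [IsManifold (𝓡 n) ∞ M]

/-- Smooth vector fields. -/
def SmoothField (X : RField n M) : Prop :=
  ContMDiff (𝓡 n) ((𝓡 n).prod 𝓘(ℝ, EuclideanSpace ℝ (Fin n))) ∞
    (fun x => (Bundle.TotalSpace.mk' (EuclideanSpace ℝ (Fin n)) x (X x) : TangentBundle (𝓡 n) M))

/-- Smooth sections of `End(TM)`. -/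
def SmoothEnd (A : EndField n M) : Prop :=
  ContMDiff (𝓡 n)
    ((𝓡 n).prod 𝓘(ℝ, EuclideanSpace ℝ (Fin n) →L[ℝ] EuclideanSpace ℝ (Fin n))) ∞
    (fun x => Bundle.TotalSpace.mk'
      (EuclideanSpace ℝ (Fin n) →L[ℝ] EuclideanSpace ℝ (Fin n))
      (E := fun y : M => TangentSpace (𝓡 n) y →L[ℝ] TangentSpace (𝓡 n) y) x (A x))

/-- Families `A t`, `t ∈ T`, of sections of `End(TM)` that depend smoothly on `(t, x)`. -/
def SmoothEndFamilyOn (A : ℝ → EndField n M) (T : Set ℝ) : Prop :=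
  ContMDiffOn (𝓘(ℝ, ℝ).prod (𝓡 n))
    ((𝓡 n).prod 𝓘(ℝ, EuclideanSpace ℝ (Fin n) →L[ℝ] EuclideanSpace ℝ (Fin n))) ∞
    (fun p : ℝ × M => Bundle.TotalSpace.mk'
      (EuclideanSpace ℝ (Fin n) →L[ℝ] EuclideanSpace ℝ (Fin n))
      (E := fun y : M => TangentSpace (𝓡 n) y →L[ℝ] TangentSpace (𝓡 n) y) p.2 (A p.1 p.2))
    (T ×ˢ Set.univ)

/-- Smooth covariant 2-tensors. -/
def SmoothTwoTensor (Ω : TwoTensor n M) : Prop :=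
  ContMDiff (𝓡 n)
    ((𝓡 n).prod 𝓘(ℝ, EuclideanSpace ℝ (Fin n) →L[ℝ] EuclideanSpace ℝ (Fin n) →L[ℝ] ℝ)) ∞
    (fun x => Bundle.TotalSpace.mk'
      (EuclideanSpace ℝ (Fin n) →L[ℝ] EuclideanSpace ℝ (Fin n) →L[ℝ] ℝ)
      (E := fun y : M => TangentSpace (𝓡 n) y →L[ℝ] TangentSpace (𝓡 n) y →L[ℝ] ℝ) x (Ω x))

/-- `dΩ = 0`, by the invariant formula for the exterior derivative. -/
def IsClosedForm (Ω : TwoTensor n M) : Prop :=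
  ∀ X Y Z : RField n M, SmoothField X → SmoothField Y → SmoothField Z → ∀ x : M,
    mvfderiv (𝓡 n) (fun y => Ω y (Y y) (Z y)) x (X x)
      + mvfderiv (𝓡 n) (fun y => Ω y (Z y) (X y)) x (Y x)
      + mvfderiv (𝓡 n) (fun y => Ω y (X y) (Y y)) x (Z x)
      - Ω x (bracket X Y x) (Z x) - Ω x (bracket Y Z x) (X x) - Ω x (bracket Z X x) (Y x) = 0

/-- Symplectic forms: smooth closed non-degenerate 2-forms. -/
structure IsSymplecticForm (Ω : TwoTensor n M) : Prop where
  smooth : SmoothTwoTensor Ω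
  alt : ∀ x v, Ω x v v = 0
  nondegenerate : ∀ x v, (∀ w, Ω x v w = 0) → v = 0
  closed : IsClosedForm Ω

/-- Integrable (smooth) almost complex structures: `J² = -1` and the Nijenhuis tensor vanishes. -/
structure IsComplexStructure (J : EndField n M) : Prop where
  smooth : SmoothEnd J
  sq : ∀ x v, J x (J x v) = -v
  nijenhuis : ∀ X Y : RField n M, SmoothField X → SmoothField Y → ∀ x : M,
    bracket (J.app X) (J.app Y) x - J x (bracket (J.app X) Y x) - J x (bracket X (J.app Y) x)
      - bracket X Y x = 0

/-- `J` is `Ω`-tamed: `Ω(·, J·)` is positive definite. -/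
def IsTamed (Ω : TwoTensor n M) (J : EndField n M) : Prop :=
  ∀ x v, v ≠ 0 → 0 < Ω x v (J x v)

/-- `J'` is the symplectic adjoint of `J`: `Ω(J·, ·) = Ω(·, J'·)`. -/
def IsSymplecticAdjoint (Ω : TwoTensor n M) (J J' : EndField n M) : Prop :=
  ∀ x v w, Ω x (J x v) w = Ω x v (J' x w)

/-! ### The Dolbeault group `H^{0,1}(M, T^{1,0})` -/

/-- Smooth complex vector fields. -/
def SmoothCField (Z : CField n M) : Prop := SmoothField Z.re ∧ SmoothField Z.im

/-- Smooth sections of `T^{1,0}`, the `i`-eigenbundle of `J`. -/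
def IsSection10 (J : EndField n M) (Z : CField n M) : Prop :=
  SmoothCField Z ∧ ∀ x, J.complexify x (Z x) = Complex.I • Z x

/-- Smooth sections of `T^{0,1}`, the `(-i)`-eigenbundle of `J`. -/
def IsSection01 (J : EndField n M) (Y : CField n M) : Prop :=
  SmoothCField Y ∧ ∀ x, J.complexify x (Y x) = -(Complex.I • Y x)

section Lemmas

theorem SmoothField.zero : SmoothField (0 : RField n M) :=
  Bundle.contMDiff_zeroSection ℝ (TangentSpace (𝓡 n) : M → Type _)

theorem SmoothField.add {X Y : RField n M} (hX : SmoothField X) (hY : SmoothField Y) :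
    SmoothField (X + Y) := by
  unfold SmoothField at *
  exact ContMDiff.add_section hX hY

theorem SmoothField.smul {X : RField n M} (c : ℝ) (hX : SmoothField X) :
    SmoothField (c • X) := by
  unfold SmoothField at *
  exact ContMDiff.const_smul_section hX

theorem SmoothCField.zero : SmoothCField (0 : CField n M) := by
  have h1 : (0 : CField n M).re = 0 := by funext x; simp [CField.re]
  have h2 : (0 : CField n M).im = 0 := by funext x; simp [CField.im]
  exact ⟨h1 ▸ SmoothField.zero, h2 ▸ SmoothField.zero⟩

theorem SmoothCField.add {Z W : CField n M} (hZ : SmoothCField Z) (hW : SmoothCField W) :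
    SmoothCField (Z + W) :=
  ⟨CField.re_add Z W ▸ hZ.1.add hW.1, CField.im_add Z W ▸ hZ.2.add hW.2⟩

theorem SmoothCField.smul {Z : CField n M} (c : ℂ) (hZ : SmoothCField Z) :
    SmoothCField (c • Z) :=
  ⟨CField.re_smul c Z ▸ (hZ.1.smul _).add (hZ.2.smul _),
    CField.im_smul c Z ▸ (hZ.2.smul _).add (hZ.1.smul _)⟩

theorem SmoothField.mdiffAt {X : RField n M} (hX : SmoothField X) (x : M) :
    MDifferentiableAt (𝓡 n) ((𝓡 n).prod 𝓘(ℝ, EuclideanSpace ℝ (Fin n)))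
      (fun x => (Bundle.TotalSpace.mk' (EuclideanSpace ℝ (Fin n)) x (X x) :
        TangentBundle (𝓡 n) M)) x := by
  unfold SmoothField at hX
  exact hX.mdifferentiableAt (by simp)

theorem bracket_add_right {X Y Z : RField n M} (hY : SmoothField Y) (hZ : SmoothField Z) (x : M) :
    bracket X (Y + Z) x = bracket X Y x + bracket X Z x :=
  VectorField.mlieBracket_add_right (hY.mdiffAt x) (hZ.mdiffAt x)

theorem bracket_smul_right {X Y : RField n M} (c : ℝ) (hY : SmoothField Y) (x : M) :
    bracket X (c • Y) x = c • bracket X Y x :=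
  VectorField.mlieBracket_const_smul_right (hY.mdiffAt x)

theorem cbracket_add_right {Y Z W : CField n M} (hZ : SmoothCField Z) (hW : SmoothCField W)
    (x : M) : cbracket Y (Z + W) x = cbracket Y Z x + cbracket Y W x := by
  simp only [cbracket, CField.re_add, CField.im_add, bracket_add_right hZ.1 hW.1,
    bracket_add_right hZ.2 hW.2, TensorProduct.tmul_add, TensorProduct.tmul_sub]
  abel

theorem cbracket_smul_right {Y Z : CField n M} (c : ℂ) (hZ : SmoothCField Z) (x : M) :
    cbracket Y (c • Z) x = c • cbracket Y Z x := by
  have h1 : ∀ v : TangentSpace (𝓡 n) x, c ⊗ₜ[ℝ] v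
      = (1 : ℂ) ⊗ₜ[ℝ] (c.re • v) + Complex.I ⊗ₜ[ℝ] (c.im • v) := fun v => by
    rw [← TensorProduct.smul_tmul, ← TensorProduct.smul_tmul, ← TensorProduct.add_tmul]
    congr 1
    apply Complex.ext <;> simp
  have h2 : ∀ v : TangentSpace (𝓡 n) x, (c * Complex.I) ⊗ₜ[ℝ] v
      = Complex.I ⊗ₜ[ℝ] (c.re • v) - (1 : ℂ) ⊗ₜ[ℝ] (c.im • v) := fun v => by
    rw [← TensorProduct.smul_tmul, ← TensorProduct.smul_tmul, ← TensorProduct.sub_tmul]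
    congr 1
    apply Complex.ext <;> simp
  have e1 : ∀ X : RField n M, bracket X (c.re • Z.re + (-c.im) • Z.im) x
      = c.re • bracket X Z.re x + (-c.im) • bracket X Z.im x := fun X => by
    rw [bracket_add_right (hZ.1.smul _) (hZ.2.smul _), bracket_smul_right _ hZ.1,
      bracket_smul_right _ hZ.2]
  have e2 : ∀ X : RField n M, bracket X (c.re • Z.im + c.im • Z.re) x
      = c.re • bracket X Z.im x + c.im • bracket X Z.re x := fun X => by
    rw [bracket_add_right (hZ.2.smul _) (hZ.1.smul _), bracket_smul_right _ hZ.1,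
      bracket_smul_right _ hZ.2]
  simp only [cbracket, CField.re_smul, CField.im_smul, e1, e2, smul_add,
    TensorProduct.smul_tmul', smul_eq_mul, mul_one, h1, h2, TensorProduct.tmul_add,
    TensorProduct.tmul_sub, smul_sub]
  simp only [neg_smul, TensorProduct.tmul_neg]
  abel

end Lemmas

/-- `Ω^{0,1}(M, T^{1,0})`: smooth complex linear bundle maps `T^{0,1} → T^{1,0}`, extended by `0`
to `T^{1,0}`; i.e. fields `α` of complex endomorphisms of `TM ⊗ ℂ` with `α ∘ J = -iα` and
`J ∘ α = iα`, mapping smooth complex vector fields to smooth ones. -/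
def forms01 (J : EndField n M) : Submodule ℂ (CEndField n M) where
  carrier := {α | (∀ x v, α x (J.complexify x v) = -(Complex.I • α x v)) ∧
    (∀ x v, J.complexify x (α x v) = Complex.I • α x v) ∧
    ∀ Z : CField n M, SmoothCField Z → SmoothCField (fun x => α x (Z x))}
  zero_mem' := ⟨by simp, by simp, fun _ _ => SmoothCField.zero⟩
  add_mem' := by
    rintro α β ⟨h1, h2, h3⟩ ⟨k1, k2, k3⟩
    refine ⟨fun x v => ?_, fun x v => ?_, fun Z hZ => (h3 Z hZ).add (k3 Z hZ)⟩
    · simp [h1, k1]; abel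
    · simp [h2, k2]
  smul_mem' := by
    rintro c α ⟨h1, h2, h3⟩
    refine ⟨fun x v => ?_, fun x v => ?_, fun Z hZ => (h3 Z hZ).smul c⟩
    · simp [h1, smul_comm c]
    · simp [h2, smul_comm c]

/-- `∂̄`-closed elements of `Ω^{0,1}(M, T^{1,0})`:
`(∂̄α)(Y₁, Y₂) = [Y₁, αY₂]^{1,0} - [Y₂, αY₁]^{1,0} - α[Y₁, Y₂] = 0` for all sections of `T^{0,1}`. -/
def closed01 (J : EndField n M) : Submodule ℂ (CEndField n M) where
  carrier := {α | α ∈ forms01 J ∧ ∀ Y₁ Y₂ : CField n M, IsSection01 J Y₁ → IsSection01 J Y₂ → ∀ x,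
    proj10 J x (cbracket Y₁ (fun y => α y (Y₂ y)) x)
      - proj10 J x (cbracket Y₂ (fun y => α y (Y₁ y)) x) - α x (cbracket Y₁ Y₂ x) = 0}
  zero_mem' := ⟨zero_mem _, fun Y₁ Y₂ _ _ x => by
    have h : ∀ Y : CField n M, cbracket Y (fun y => (0 : CEndField n M) y (Y₁ y)) x = 0 :=
      fun Y => cbracket_zero_right Y x
    have h' : ∀ Y : CField n M, cbracket Y (fun y => (0 : CEndField n M) y (Y₂ y)) x = 0 :=
      fun Y => cbracket_zero_right Y x
    rw [h, h']
    simp⟩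
  add_mem' := by
    rintro α β ⟨hα, h⟩ ⟨hβ, k⟩
    refine ⟨add_mem hα hβ, fun Y₁ Y₂ hY₁ hY₂ x => ?_⟩
    have e : ∀ Y Y' : CField n M, IsSection01 J Y' →
        cbracket Y (fun y => (α + β) y (Y' y)) x
          = cbracket Y (fun y => α y (Y' y)) x + cbracket Y (fun y => β y (Y' y)) x :=
      fun Y Y' hY' => cbracket_add_right (hα.2.2 Y' hY'.1) (hβ.2.2 Y' hY'.1) x
    have h' := h Y₁ Y₂ hY₁ hY₂ x
    have k' := k Y₁ Y₂ hY₁ hY₂ x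
    rw [e _ _ hY₂, e _ _ hY₁, map_add, map_add, Pi.add_apply, LinearMap.add_apply]
    rw [← add_zero (0 : CT n x)]
    nth_rewrite 1 [← h']
    rw [← k']
    abel
  smul_mem' := by
    rintro c α ⟨hα, h⟩
    refine ⟨Submodule.smul_mem _ c hα, fun Y₁ Y₂ hY₁ hY₂ x => ?_⟩
    have e : ∀ Y Y' : CField n M, IsSection01 J Y' →
        cbracket Y (fun y => (c • α) y (Y' y)) x = c • cbracket Y (fun y => α y (Y' y)) x :=
      fun Y Y' hY' => cbracket_smul_right c (hα.2.2 Y' hY'.1) x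
    rw [e _ _ hY₂, e _ _ hY₁, map_smul, map_smul, Pi.smul_apply, LinearMap.smul_apply,
      ← smul_sub, ← smul_sub, h Y₁ Y₂ hY₁ hY₂ x, smul_zero]

/-- `∂̄`-exact elements of `Ω^{0,1}(M, T^{1,0})`: `α = ∂̄Z`, i.e. `αY = [Y, Z]^{1,0}` for all sections
`Y` of `T^{0,1}`, for some smooth section `Z` of `T^{1,0}`. -/
def exact01 (J : EndField n M) : Submodule ℂ (CEndField n M) where
  carrier := {α | α ∈ forms01 J ∧ ∃ Z : CField n M, IsSection10 J Z ∧
    ∀ Y : CField n M, IsSection01 J Y → ∀ x, α x (Y x) = proj10 J x (cbracket Y Z x)}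
  zero_mem' := ⟨zero_mem _, 0, ⟨SmoothCField.zero, by simp⟩, fun Y _ x => by
    simp [cbracket_zero_right]⟩
  add_mem' := by
    rintro α β ⟨hα, Z, hZ, h⟩ ⟨hβ, W, hW, k⟩
    refine ⟨add_mem hα hβ, Z + W, ⟨hZ.1.add hW.1, fun x => ?_⟩, fun Y hY x => ?_⟩
    · simp [hZ.2 x, hW.2 x]
    · simp [cbracket_add_right hZ.1 hW.1, h Y hY x, k Y hY x]
  smul_mem' := by
    rintro c α ⟨hα, Z, hZ, h⟩
    refine ⟨Submodule.smul_mem _ c hα, c • Z, ⟨hZ.1.smul c, fun x => ?_⟩, fun Y hY x => ?_⟩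
    · simp [hZ.2 x, smul_comm c]
    · simp [cbracket_smul_right c hZ.1, h Y hY x]

instance (J : EndField n M) : AddCommGroup (closed01 J) := (closed01 J).addCommGroup

/-- The Dolbeault cohomology group `H^{0,1}(M, T^{1,0})` of `(M, J)`. -/
abbrev H01 (J : EndField n M) : Type _ :=
  closed01 J ⧸ (exact01 J).comap (closed01 J).subtype

/-- `α` is a `∂̄`-closed element of `Ω^{0,1}(M, T^{1,0})` and `c` is its Dolbeault class. -/
def HasClass (J : EndField n M) (α : CEndField n M) (c : H01 J) : Prop :=
  ∃ h : α ∈ closed01 J, Submodule.Quotient.mk ⟨α, h⟩ = c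

/-- The tensor that represents the Kodaira–Spencer class of a family `J t` of complex structures
with `J 0 = J₀`: the `(1,0)`-part of the restriction to `T^{0,1}` of `dJ/dt` at `t = 0`. -/
def kodairaSpencerForm (J₀ : EndField n M) (J : ℝ → EndField n M) : CEndField n M := fun x =>
  proj10 J₀ x ∘ₗ (EndField.complexify (fun y => deriv (fun t => J t y) 0) x) ∘ₗ proj01 J₀ x

/-! ### Complex bivectors -/

variable (n M) in
/-- Sections of `(TM ⊗ ℂ) ⊗ (TM ⊗ ℂ)`. -/
abbrev CBivector := (x : M) → CT n x ⊗[ℂ] CT n x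

/-- The contraction `ξ ↦ (ξ ⊗ id) s`. -/
def sharp {V : Type*} [AddCommGroup V] [Module ℂ V] (s : V ⊗[ℂ] V) : Module.Dual ℂ V →ₗ[ℂ] V where
  toFun ξ := TensorProduct.lid ℂ V (LinearMap.rTensor V ξ s)
  map_add' ξ η := by simp [LinearMap.rTensor_add]
  map_smul' c ξ := by simp [LinearMap.rTensor_smul]

/-- The composition `σ ∘ Ω : Y ↦ (Ω(·, Y) ⊗ id) σ` of `Ω : T^{0,1} → Λ^{1,0}` and
`σ : Λ^{1,0} → T^{1,0}`. In coordinates it is `∑ Ω_{l j̄} σ^{lk} dz̄^j ⊗ ∂/∂z^k`. -/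
def compForm (σ : CBivector n M) (Ω : TwoTensor n M) : CEndField n M := fun x =>
  sharp (σ x) ∘ₗ
    (LinearMap.BilinForm.baseChange ℂ
      ((ContinuousLinearMap.coeLM ℝ).comp (Ω x).toLinearMap :
        LinearMap.BilinForm ℝ (TangentSpace (𝓡 n) x))).flip

/-- The complex linear extension of the differential of a complex valued function. -/
def cdiff (f : M → ℂ) (x : M) : CT n x →ₗ[ℂ] ℂ :=
  LinearMap.liftBaseChange ℂ (mvfderiv (𝓡 n) f x).toLinearMap

/-- `{f, g} = σ(df, dg)`. -/
def poissonBracket (σ : CBivector n M) (f g : M → ℂ) : M → ℂ := fun x =>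
  cdiff (n := n) g x (sharp (σ x) (cdiff (n := n) f x))

/-- `J`-holomorphic functions on the open set `U`. -/
def IsHolomorphicOn (J : EndField n M) (f : M → ℂ) (U : Set M) : Prop :=
  ContMDiffOn (𝓡 n) 𝓘(ℝ, ℂ) ∞ f U ∧
    ∀ x ∈ U, ∀ v, mvfderiv (𝓡 n) f x (J x v) = Complex.I * mvfderiv (𝓡 n) f x v

/-- `σ` is a holomorphic Poisson structure on the complex manifold `(M, J)`: a section of
`Λ²T^{1,0}` for which `{f, g} = σ(df, dg)` is a Poisson bracket on the sheaf of holomorphic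
functions. -/
structure IsHolomorphicPoisson (J : EndField n M) (σ : CBivector n M) : Prop where
  type_left : ∀ x, TensorProduct.map (J.complexify x) LinearMap.id (σ x) = Complex.I • σ x
  type_right : ∀ x, TensorProduct.map LinearMap.id (J.complexify x) (σ x) = Complex.I • σ x
  skew : ∀ x, TensorProduct.comm ℂ _ _ (σ x) = -σ x
  holomorphic : ∀ (U : Set M) (f g : M → ℂ), IsOpen U → IsHolomorphicOn J f U →
    IsHolomorphicOn J g U → IsHolomorphicOn J (poissonBracket σ f g) U
  jacobi : ∀ (U : Set M) (f g h : M → ℂ), IsOpen U → IsHolomorphicOn J f U →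
    IsHolomorphicOn J g U → IsHolomorphicOn J h U → ∀ x ∈ U,
    poissonBracket σ f (poissonBracket σ g h) x + poissonBracket σ g (poissonBracket σ h f) x
      + poissonBracket σ h (poissonBracket σ f g) x = 0

end Geometry

/-! ### Symplectic toric manifolds -/

section Toric

variable {m : ℕ} {M : Type*} [TopologicalSpace M]
  [ChartedSpace (EuclideanSpace ℝ (Fin (2 * m))) M] [MulAction (Fin m → Circle) M]

/-- The exponential map of the torus `𝕋 = U(1)^m`, with Lie algebra `𝔱 = ℝ^m`. -/
def torusExp (a : Fin m → ℝ) : Fin m → Circle := fun j => Circle.exp (a j)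

variable (M) in
/-- The infinitesimal action of `a ∈ 𝔱`: the velocity at `s = 0` of `s ↦ exp(s a) • x`, a curve
which is at `x` for `s = 0`. -/
def infAction (a : Fin m → ℝ) : RField (2 * m) M := fun x =>
  mfderiv 𝓘(ℝ, ℝ) (𝓡 (2 * m)) (fun s : ℝ => torusExp (s • a) • x) 0 (1 : ℝ)

/-- The component `μ^a = ⟨μ, a⟩` of `μ : M → 𝔱* = ℝ^m`. -/
def momentComp (μ : M → Fin m → ℝ) (a : Fin m → ℝ) : M → ℝ := fun x => ∑ j, μ x j * a j

variable (m M) in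
/-- The set `M°` of points where the torus acts freely. -/
def freeLocus : Set M := {x | ∀ g : Fin m → Circle, g • x = x → g = 1}

/-- The tangent space at `x` of the torus orbit. -/
def orbitSpan (x : M) : Submodule ℝ (TangentSpace (𝓡 (2 * m)) x) :=
  Submodule.span ℝ (Set.range fun a : Fin m → ℝ => infAction M a x)

/-- `A` is invariant under the torus. -/
def IsInvariant (A : EndField (2 * m) M) : Prop :=
  ∀ (g : Fin m → Circle) (x : M) (v : TangentSpace (𝓡 (2 * m)) x),
    mfderiv (𝓡 (2 * m)) (𝓡 (2 * m)) (fun y : M => g • y) x (A x v)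
      = A (g • x) (mfderiv (𝓡 (2 * m)) (𝓡 (2 * m)) (fun y : M => g • y) x v)

variable [IsManifold (𝓡 (2 * m)) ∞ M]

/-- `(M, Ω, 𝕋)` is a symplectic toric manifold with moment map `μ`: the torus acts smoothly and
effectively, `μ` is smooth and invariant, and `Ω(X_a, ·) = -dμ^a` where `X_a` is the infinitesimal
action of `a`. (Compactness and connectedness of `M` are separate.) -/
structure IsSymplecticToric (Ω : TwoTensor (2 * m) M) (μ : M → Fin m → ℝ) : Prop where
  symplectic : IsSymplecticForm Ω
  smooth_action : ContMDiff (𝓘(ℝ, Fin m → ℝ).prod (𝓡 (2 * m))) (𝓡 (2 * m)) ∞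
    (fun p : (Fin m → ℝ) × M => torusExp p.1 • p.2)
  effective : ∀ g : Fin m → Circle, (∀ x : M, g • x = x) → g = 1
  smooth_moment : ContMDiff (𝓡 (2 * m)) 𝓘(ℝ, Fin m → ℝ) ∞ μ
  invariant : ∀ (g : Fin m → Circle) (x : M), μ (g • x) = μ x
  hamiltonian : ∀ (a : Fin m → ℝ) (x : M) (v : TangentSpace (𝓡 (2 * m)) x),
    Ω x (infAction M a x) v = -mvfderiv (𝓡 (2 * m)) (momentComp μ a) x v

/-- `K_Ω^𝕋(M)`: invariant complex structures `J` that are `Ω`-compatible. -/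
structure IsToricKahler (Ω : TwoTensor (2 * m) M) (J : EndField (2 * m) M) : Prop where
  complex : IsComplexStructure J
  invariant : IsInvariant J
  tamed : IsTamed Ω J
  compatible : ∀ x v w, Ω x (J x v) (J x w) = Ω x v w

/-- `DGK_Ω^𝕋(M)`: invariant `Ω`-tamed complex structures `J` whose symplectic adjoint `J'` is
integrable and satisfies `J' 𝒦 = J 𝒦` on `M°`, for the distribution `𝒦` tangent to the orbits. -/
structure IsToricDGK (Ω : TwoTensor (2 * m) M) (J : EndField (2 * m) M) : Prop where
  complex : IsComplexStructure J
  invariant : IsInvariant J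
  tamed : IsTamed Ω J
  adjoint : ∃ J' : EndField (2 * m) M, IsSymplecticAdjoint Ω J J' ∧ IsComplexStructure J' ∧
    ∀ x ∈ freeLocus m M, (orbitSpan x).map (J' x).toLinearMap = (orbitSpan x).map (J x).toLinearMap

/-- For a basis `ξ` of `𝔱`, the vectors `D j = ∂/∂μ^j` at `x` of the coordinates `(μ^j, t^j)`
determined by `J`, where `∂/∂t^j = K_j` is the infinitesimal action of `ξ j`: the `D j` lie in `J 𝒦`
and `dμ^i(D j) = δ_ij`. -/
def IsMomentFrame (μ : M → Fin m → ℝ) (ξ : Module.Basis (Fin m) ℝ (Fin m → ℝ))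
    (J : EndField (2 * m) M) (x : M) (D : Fin m → TangentSpace (𝓡 (2 * m)) x) : Prop :=
  (∀ j, D j ∈ (orbitSpan x).map (J x).toLinearMap) ∧
    ∀ i j, mvfderiv (𝓡 (2 * m)) (momentComp μ (ξ i)) x (D j) = if i = j then 1 else 0

/-- The endomorphism `A` of `T_x M` equals
`∑ Ψ_ij ∂/∂t^i ⊗ dμ^j - ∑ (Ψ⁻¹)_ij ∂/∂μ^i ⊗ dt^j`, where `∂/∂μ^j = D j`, `∂/∂t^j = K_j`. -/
def IsAntiDiagonal (ξ : Module.Basis (Fin m) ℝ (Fin m → ℝ)) (x : M)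
    (D : Fin m → TangentSpace (𝓡 (2 * m)) x) (Ψ : Matrix (Fin m) (Fin m) ℝ)
    (A : TangentSpace (𝓡 (2 * m)) x →L[ℝ] TangentSpace (𝓡 (2 * m)) x) : Prop :=
  (∀ j, A (D j) = ∑ i, Ψ i j • infAction M (ξ i) x) ∧
    ∀ j, A (infAction M (ξ j) x) = -∑ i, Ψ⁻¹ i j • D i

/-- The family `J t`, `|t| < ε`, is a smooth family in `DGK_Ω^𝕋(M)` starting at `J₀` which on `M°`
has the form `∑ Ψ_ij(t) ∂/∂t^i ⊗ dμ^j - ∑ Ψ^ij(t) ∂/∂μ^i ⊗ dt^j` with `Ψ(t) = S + t C`, in the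
coordinates `(μ^j, t^j)` determined by `J₀`, where `S` is the matrix of `J₀`. -/
structure IsToricDeformation (Ω : TwoTensor (2 * m) M) (μ : M → Fin m → ℝ)
    (ξ : Module.Basis (Fin m) ℝ (Fin m → ℝ)) (J₀ : EndField (2 * m) M)
    (C : Matrix (Fin m) (Fin m) ℝ) (ε : ℝ) (J : ℝ → EndField (2 * m) M) : Prop where
  smooth : SmoothEndFamilyOn J (Set.Ioo (-ε) ε)
  zero : J 0 = J₀
  mem : ∀ t ∈ Set.Ioo (-ε) ε, IsToricDGK Ω (J t)
  form : ∀ x ∈ freeLocus m M, ∃ (D : Fin m → TangentSpace (𝓡 (2 * m)) x)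
    (S : Matrix (Fin m) (Fin m) ℝ), IsMomentFrame μ ξ J₀ x D ∧ S.PosDef ∧
      IsAntiDiagonal ξ x D S (J₀ x) ∧
      ∀ t ∈ Set.Ioo (-ε) ε, IsAntiDiagonal ξ x D (S + t • C) (J t x)

/-- The bivector `σ = 2 ∑ C_jk K_j^{1,0} ⊗ K_k^{1,0}`, with `K_j` the infinitesimal action of
`ξ j`. -/
def toricBivector (ξ : Module.Basis (Fin m) ℝ (Fin m → ℝ)) (J : EndField (2 * m) M)
    (C : Matrix (Fin m) (Fin m) ℝ) : CBivector (2 * m) M := fun x =>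
  (2 : ℂ) • ∑ j, ∑ k, (C j k : ℂ) •
    (proj10 J x ((1 : ℂ) ⊗ₜ[ℝ] infAction M (ξ j) x) ⊗ₜ[ℂ]
      proj10 J x ((1 : ℂ) ⊗ₜ[ℝ] infAction M (ξ k) x))

end Toric

end ToricGK

end

open ToricGK

/-! Everything comes from one endomorphism field and one conjugation. Put B = ∑ C_ij K_i ⊗ dμ^j
(`momentEnd`), which is smooth on all of M. Since μ is constant on orbits, dμ(K) = 0 and hence B² =
0. Since ω(K_i, ·) = -dμ^i and C is antisymmetric, ω(Bv, v) = 0, so B is its own symplectic adjoint.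
For a compatible J = J₀ these two facts (`IsTwistData`) suffice for pure linear algebra at each
point. For every real t the map 1 - tJB is invertible, and J_t = (1 - tJB)⁻¹ J (1 - tJB)
(`toricTwist`) is a tamed almost complex structure with symplectic adjoint -J_{-t}. It satisfies J_t
𝒦 = J 𝒦, and in momentum-angle coordinates it has matrix S + tC.

Integrability is checked on the free locus. There K_i, JK_i is a commuting frame, because J is
invariant and integrable, so its dual coframe is closed (`exists_closed_coframe`). Pulling that
coframe back by 1 - tJB only adds multiples of the closed forms ∑ C_ij dμ^j. The new coframe is thus
closed and adapted to J_t, which kills the Nijenhuis tensor (`nijenhuis_eq_zero_of_closed`). The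
same applies to -J_{-t}.

Both this and uniqueness of the family rest on density of the free locus (`dense_freeLocus`). A
nontrivial stabilizer contains a nontrivial element of finite order. There are countably many such
elements, and by effectiveness each has a closed fixed set with empty interior, so Baire applies. A
family of the prescribed coordinate form therefore equals `toricTwist` for all |t| < ε.

From J_t = J + t(B + JBJ_t) the first variation is B + JBJ. A direct computation with ω(K_j^{1,0},
·) shows that the (0,1)-form it defines is literally σω (`compForm_toricBivector`), so equality of
classes needs no cohomological argument. It is ∂̄-closed because the frame commutes and the
coefficients ∑ C_ij dμ^j are closed. As -J_t^{*_ω} = J_{-t}, the adjoint family gives the opposite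
sign.

For holomorphic f the function K_j f is again holomorphic, because the torus acts by holomorphic
maps, and {f, g} = 2 ∑ C_jk (K_j f)(K_k g). The Jacobi identity is that of a constant bivector in
commuting directions. Finally, σ = 0 would force B + JBJ = 0 and hence C = 0, and compatibility of
J_t would force S + tC to be symmetric. -/

noncomputable section

open scoped Manifold ContDiff TensorProduct Bundle Topology
open ToricGK Filter Set

namespace ToricGK

/-! ### Derivatives of functions and brackets of vector fields, read in a chart -/

section Calculus

variable {n : ℕ} {M : Type*} [TopologicalSpace M] [ChartedSpace (EuclideanSpace ℝ (Fin n)) M]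
  [IsManifold (𝓡 n) ∞ M]
  {F : Type*} [NormedAddCommGroup F] [NormedSpace ℝ F]

/-- Differentiability of a vector field at a point. -/
abbrev MDiffField (X : RField n M) (x : M) : Prop :=
  MDifferentiableAt (𝓡 n) ((𝓡 n).prod 𝓘(ℝ, EuclideanSpace ℝ (Fin n)))
      (fun x => (Bundle.TotalSpace.mk' (EuclideanSpace ℝ (Fin n)) x (X x) :
        TangentBundle (𝓡 n) M)) x

/-- The vector field `X` read in the chart at `x`. -/
def chartField (x : M) (X : RField n M) : EuclideanSpace ℝ (Fin n) → EuclideanSpace ℝ (Fin n) :=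
  VectorField.mpullbackWithin 𝓘(ℝ, EuclideanSpace ℝ (Fin n)) (𝓡 n) (extChartAt (𝓡 n) x).symm X
    (range (𝓡 n))

theorem MDiffField.differentiableAt_chartField {X : RField n M} {x : M} (hX : MDiffField X x) :
    DifferentiableAt ℝ (chartField x X) (extChartAt (𝓡 n) x x) := by
  have : IsManifold (𝓡 n) 2 M := IsManifold.of_le (m := 2) (n := ∞) (by norm_cast)
  have h := (mdifferentiableWithinAt_univ.2 hX).differentiableWithinAt_mpullbackWithin_vectorField
  rw [preimage_univ, univ_inter] at h
  exact DifferentiableWithinAt.differentiableAt h (by simp)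

theorem chartField_apply {x : M} (X : RField n M) :
    chartField x X (extChartAt (𝓡 n) x x) = X x := by
  unfold chartField
  rw [VectorField.mpullbackWithin_apply]
  erw [mfderivWithin_extChartAt_symm_inverse_apply]
  rw [extChartAt_to_inv]

theorem mfderiv_chartField {x y : M} (X : RField n M) (hy : y ∈ (extChartAt (𝓡 n) x).source) :
    mfderivWithin 𝓘(ℝ, EuclideanSpace ℝ (Fin n)) (𝓡 n) (extChartAt (𝓡 n) x).symm (range (𝓡 n))
        (extChartAt (𝓡 n) x y)
        (chartField x X (extChartAt (𝓡 n) x y)) = X ((extChartAt (𝓡 n) x).symm (extChartAt (𝓡 n) x y)) := by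
  unfold chartField
  rw [VectorField.mpullbackWithin_apply]
  exact (isInvertible_mfderivWithin_extChartAt_symm
    ((extChartAt (𝓡 n) x).map_source hy)).self_apply_inverse _

theorem eventually_mvfderiv_eq_chartField {x : M} {f : M → F}
    (hf : ∀ᶠ y in 𝓝 x, MDifferentiableAt (𝓡 n) 𝓘(ℝ, F) f y) (X : RField n M) :
    ∀ᶠ y in 𝓝 x, mvfderiv (𝓡 n) f y (X y) =
      fderiv ℝ (f ∘ (extChartAt (𝓡 n) x).symm) (extChartAt (𝓡 n) x y)
        (chartField x X (extChartAt (𝓡 n) x y)) := by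
  filter_upwards [hf, extChartAt_source_mem_nhds (I := 𝓡 n) x] with y hy hys
  have ht := (extChartAt (𝓡 n) x).map_source hys
  have hinv := (extChartAt (𝓡 n) x).left_inv hys
  have hs := mdifferentiableWithinAt_extChartAt_symm ht
  have hc := mfderiv_chartField X hys
  rw [ModelWithCorners.range_eq_univ] at hs hc
  rw [mdifferentiableWithinAt_univ] at hs
  rw [mfderivWithin_univ] at hc
  rw [← hinv] at hy
  have h := mfderiv_comp_apply (extChartAt (𝓡 n) x y) hy hs (chartField x X (extChartAt (𝓡 n) x y))
  rw [hc, mfderiv_eq_fderiv] at h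
  rw [hinv] at h
  exact h.symm

theorem bracket_eq_lieBracket_chartField {x : M} (X Y : RField n M) :
    bracket X Y x =
      VectorField.lieBracket ℝ (chartField x X) (chartField x Y) (extChartAt (𝓡 n) x x) := by
  unfold bracket VectorField.mlieBracket
  rw [VectorField.mlieBracketWithin_apply, mfderiv_extChartAt_self]
  rw [preimage_univ, univ_inter]
  erw [ContinuousLinearMap.inverse_id]
  unfold chartField
  rw [ModelWithCorners.range_eq_univ]
  exact congrFun (VectorField.lieBracketWithin_univ (𝕜 := ℝ) (E := EuclideanSpace ℝ (Fin n))) _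

theorem eventually_mdifferentiableAt {f : M → F} {x : M}
    (hf : ContMDiffAt (𝓡 n) 𝓘(ℝ, F) 2 f x) :
    ∀ᶠ y in 𝓝 x, MDifferentiableAt (𝓡 n) 𝓘(ℝ, F) f y :=
  by
  have : IsManifold (𝓡 n) 2 M := IsManifold.of_le (m := 2) (n := ∞) (by norm_cast)
  exact ((contMDiffAt_iff_contMDiffAt_nhds (by decide)).1 hf).mono fun _ h => h.mdifferentiableAt (by decide)

theorem contDiffAt_comp_extChartAt_symm {k : ℕ∞} {f : M → F} {x : M}
    (hf : ContMDiffAt (𝓡 n) 𝓘(ℝ, F) k f x) :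
    ContDiffAt ℝ k (f ∘ (extChartAt (𝓡 n) x).symm) (extChartAt (𝓡 n) x x) := by
  rw [contMDiffAt_iff] at hf
  simpa using! hf.2

theorem mvfderiv_comp_extChartAt {x : M} {g : EuclideanSpace ℝ (Fin n) → F}
    (hg : DifferentiableAt ℝ g (extChartAt (𝓡 n) x x)) (v : TangentSpace (𝓡 n) x) :
    mvfderiv (𝓡 n) (fun y => g (extChartAt (𝓡 n) x y)) x v = fderiv ℝ g (extChartAt (𝓡 n) x x) v := by
  have h := mfderiv_comp_apply (I := 𝓡 n) (I' := 𝓘(ℝ, EuclideanSpace ℝ (Fin n))) (I'' := 𝓘(ℝ, F)) x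
    hg.mdifferentiableAt
    (mdifferentiableAt_extChartAt (I := 𝓡 n) (mem_chart_source _ x)) v
  rw [mfderiv_extChartAt_self, mfderiv_eq_fderiv] at h
  exact h

theorem mdifferentiableAt_comp_extChartAt {x : M} {g : EuclideanSpace ℝ (Fin n) → F}
    (hg : DifferentiableAt ℝ g (extChartAt (𝓡 n) x x)) :
    MDifferentiableAt (𝓡 n) 𝓘(ℝ, F) (fun y => g (extChartAt (𝓡 n) x y)) x :=
  hg.mdifferentiableAt.comp x (mdifferentiableAt_extChartAt (I := 𝓡 n) (mem_chart_source _ x))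

theorem differentiableAt_fderiv_chartField {x : M} {f : M → F}
    (hf : ContMDiffAt (𝓡 n) 𝓘(ℝ, F) 2 f x) {Y : RField n M} (hY : MDiffField Y x) :
    DifferentiableAt ℝ (fun z => fderiv ℝ (f ∘ (extChartAt (𝓡 n) x).symm) z (chartField x Y z))
      (extChartAt (𝓡 n) x x) := by
  have h2 := (contDiffAt_comp_extChartAt_symm (k := 2) hf).fderiv_right (m := 1) (by norm_num)
  exact (h2.differentiableAt (by norm_num)).clm_apply hY.differentiableAt_chartField

theorem mdifferentiableAt_mvfderiv {x : M} {f : M → F}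
    (hf : ContMDiffAt (𝓡 n) 𝓘(ℝ, F) 2 f x) {Y : RField n M} (hY : MDiffField Y x) :
    MDifferentiableAt (𝓡 n) 𝓘(ℝ, F) (fun y => mvfderiv (𝓡 n) f y (Y y)) x :=
  (mdifferentiableAt_comp_extChartAt (differentiableAt_fderiv_chartField hf hY)).congr_of_eventuallyEq
    (eventually_mvfderiv_eq_chartField (eventually_mdifferentiableAt hf) Y)

/-- The bracket of vector fields is the commutator of derivations. -/
theorem mvfderiv_bracket {x : M} {f : M → F}
    (hf : ContMDiffAt (𝓡 n) 𝓘(ℝ, F) 2 f x) {X Y : RField n M} (hX : MDiffField X x)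
    (hY : MDiffField Y x) :
    mvfderiv (𝓡 n) f x (bracket X Y x) =
      mvfderiv (𝓡 n) (fun y => mvfderiv (𝓡 n) f y (Y y)) x (X x)
        - mvfderiv (𝓡 n) (fun y => mvfderiv (𝓡 n) f y (X y)) x (Y x) := by
  have key : ∀ {Y : RField n M}, MDiffField Y x → ∀ v : TangentSpace (𝓡 n) x,
      mvfderiv (𝓡 n) (fun y => mvfderiv (𝓡 n) f y (Y y)) x v =
        fderiv ℝ (fderiv ℝ (f ∘ (extChartAt (𝓡 n) x).symm)) (extChartAt (𝓡 n) x x) v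
            (chartField x Y (extChartAt (𝓡 n) x x))
          + fderiv ℝ (f ∘ (extChartAt (𝓡 n) x).symm) (extChartAt (𝓡 n) x x)
            (fderiv ℝ (chartField x Y) (extChartAt (𝓡 n) x x) v) := by
    intro Y hY v
    have h1 : mvfderiv (𝓡 n) (fun y => mvfderiv (𝓡 n) f y (Y y)) x = _ :=
      Filter.EventuallyEq.mfderiv_eq
        (eventually_mvfderiv_eq_chartField (eventually_mdifferentiableAt hf) Y)
    have h2 := (contDiffAt_comp_extChartAt_symm (k := 2) hf).fderiv_right (m := 1) (by norm_num)
    rw [h1]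
    have h3 := mvfderiv_comp_extChartAt (differentiableAt_fderiv_chartField hf hY) v
    refine h3.trans ?_
    rw [fderiv_clm_apply (h2.differentiableAt (by norm_num)) hY.differentiableAt_chartField]
    exact add_comm _ _
  rw [key hX, key hY]
  have h0 := (eventually_mvfderiv_eq_chartField (eventually_mdifferentiableAt hf)
    (bracket X Y)).self_of_nhds
  rw [chartField_apply] at h0
  -- Symmetry of the Hessian cancels the second-order terms; what remains is df applied to the Lie
  -- bracket in the chart.
  have hsymm : IsSymmSndFDerivAt ℝ (f ∘ (extChartAt (𝓡 n) x).symm) (extChartAt (𝓡 n) x x) :=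
    (contDiffAt_comp_extChartAt_symm (k := 2) hf).isSymmSndFDerivAt (by simp)
  have hs := hsymm.eq (X x) (Y x)
  rw [h0, bracket_eq_lieBracket_chartField, VectorField.lieBracket, map_sub,
    chartField_apply, chartField_apply]
  rw [hs]
  abel

theorem contDiffAt_prod_comp_extChartAt_symm {x : M} {H : ℝ → M → F} {s₀ : ℝ}
    (hH : ContMDiffAt (𝓘(ℝ, ℝ).prod (𝓡 n)) 𝓘(ℝ, F) 2 (fun p : ℝ × M => H p.1 p.2) (s₀, x)) :
    ContDiffAt ℝ 2 (fun p : ℝ × EuclideanSpace ℝ (Fin n) =>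
      H p.1 ((extChartAt (𝓡 n) x).symm p.2)) (s₀, extChartAt (𝓡 n) x x) := by
  rw [contMDiffAt_iff] at hH
  simpa [Function.comp_def] using! hH.2

theorem mvfderiv_eq_fderiv_comp_extChartAt_symm {f : M → F} {x : M}
    (hf : MDifferentiableAt (𝓡 n) 𝓘(ℝ, F) f x) :
    mvfderiv (𝓡 n) f x = fderiv ℝ (f ∘ (extChartAt (𝓡 n) x).symm) (extChartAt (𝓡 n) x x) := by
  rw [hf.mvfderiv]
  simp only [writtenInExtChartAt, ModelWithCorners.range_eq_univ, fderivWithin_univ]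
  rfl

/-- Mixed derivatives of a function on `ℝ × M` commute. -/
theorem hasDerivAt_mvfderiv {x : M} {H : ℝ → M → F}
    (hH : ContMDiffAt (𝓘(ℝ, ℝ).prod (𝓡 n)) 𝓘(ℝ, F) 2 (fun p : ℝ × M => H p.1 p.2) (0, x)) :
    HasDerivAt (F := EuclideanSpace ℝ (Fin n) →L[ℝ] F) (fun s => mvfderiv (𝓡 n) (H s) x)
      (mvfderiv (𝓡 n) (fun y => deriv (fun s => H s y) 0) x) 0 := by
  set φ := extChartAt (𝓡 n) x with hφ
  set G : ℝ × EuclideanSpace ℝ (Fin n) → F := fun p => H p.1 (φ.symm p.2) with hG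
  have hG2 : ContDiffAt ℝ 2 G (0, φ x) := contDiffAt_prod_comp_extChartAt_symm hH
  have hG1 : DifferentiableAt ℝ (fderiv ℝ G) (0, φ x) :=
    (hG2.fderiv_right (m := 1) (by norm_num)).differentiableAt (by norm_num)
  have hGe : ∀ᶠ p in 𝓝 ((0 : ℝ), φ x), DifferentiableAt ℝ G p :=
    (hG2.eventually (by simp)).mono fun p hp => hp.differentiableAt (by norm_num)
  have hsymm : IsSymmSndFDerivAt ℝ G (0, φ x) := hG2.isSymmSndFDerivAt (by simp)
  have c1 : ContinuousAt (fun s : ℝ => (s, φ x)) 0 := by fun_prop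
  have hMe : ∀ᶠ s in 𝓝 (0 : ℝ), MDifferentiableAt (𝓡 n) 𝓘(ℝ, F) (H s) x := by
    have c2 : ContinuousAt (fun s : ℝ => (s, x)) 0 := by fun_prop
    have : IsManifold (𝓡 n) 2 M := IsManifold.of_le (m := 2) (n := ∞) (by norm_cast)
    have h := (contMDiffAt_iff_contMDiffAt_nhds (by decide)).1 hH
    filter_upwards [c2.eventually h] with s hs
    have h' := hs.comp x (contMDiffAt_const.prodMk contMDiffAt_id)
    exact h'.mdifferentiableAt (by decide)
  have e1 : (fun s => mvfderiv (𝓡 n) (H s) x : ℝ → EuclideanSpace ℝ (Fin n) →L[ℝ] F) =ᶠ[𝓝 0]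
      fun s => (fderiv ℝ G (s, φ x)).comp (ContinuousLinearMap.inr ℝ ℝ _) := by
    filter_upwards [hMe, c1.eventually hGe] with s hs hs'
    rw [mvfderiv_eq_fderiv_comp_extChartAt_symm hs]
    have h := hs'.hasFDerivAt.comp (φ x) ((hasFDerivAt_const s (φ x)).prodMk (hasFDerivAt_id (φ x)))
    exact h.fderiv
  have e2 : (fun y => deriv (fun s => H s y) 0) =ᶠ[𝓝 x]
      fun y => fderiv ℝ G (0, φ y) (1, 0) := by
    have c3 : ContinuousAt (fun y => ((0 : ℝ), φ y)) x :=
      continuousAt_const.prodMk (continuousAt_extChartAt x)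
    filter_upwards [c3.eventually hGe, extChartAt_source_mem_nhds (I := 𝓡 n) x] with y hy hys
    have h := (hy.hasFDerivAt.comp_hasDerivAt_of_eq (0 : ℝ)
      ((hasDerivAt_id (0 : ℝ)).prodMk (hasDerivAt_const (0 : ℝ) (φ y))) rfl).deriv
    rw [← h]
    simp only [hG, Function.comp_def, id]
    rw [φ.left_inv hys]
  have d2 : DifferentiableAt ℝ (fun z => fderiv ℝ G (0, z) (1, 0)) (φ x) := by
    have : DifferentiableAt ℝ (fun z => ((0 : ℝ), z)) (φ x) := by fun_prop
    exact (DifferentiableAt.comp (φ x) (g := fderiv ℝ G) hG1 this).clm_apply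
      (differentiableAt_const _)
  have e3 : mvfderiv (𝓡 n) (fun y => deriv (fun s => H s y) 0) x = _ :=
    Filter.EventuallyEq.mfderiv_eq e2
  rw [e3]
  have h4 := hG1.hasFDerivAt.comp_hasDerivAt_of_eq (0 : ℝ)
      ((hasDerivAt_id (0 : ℝ)).prodMk (hasDerivAt_const (0 : ℝ) (φ x))) rfl
  have h5 := (h4.clm_comp (hasDerivAt_const (0 : ℝ)
    (ContinuousLinearMap.inr ℝ ℝ (EuclideanSpace ℝ (Fin n))))).congr_of_eventuallyEq e1
  refine h5.congr_deriv ?_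
  ext v
  have h6 := mvfderiv_comp_extChartAt d2 v
  refine Eq.trans ?_ h6.symm
  have h7 := ((hG1.hasFDerivAt.comp (φ x)
    ((hasFDerivAt_const (0 : ℝ) (φ x)).prodMk (hasFDerivAt_id (φ x)))).clm_apply
      (hasFDerivAt_const ((1 : ℝ), (0 : EuclideanSpace ℝ (Fin n))) (φ x))).fderiv
  -- The exchange of the parameter direction with the direction v.
  have h8 := hsymm.eq (1, 0) (0, v)
  have h9 : fderiv ℝ (fun z => fderiv ℝ G (0, z) (1, 0)) (φ x) = _ := h7
  rw [h9]
  simpa using h8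

end Calculus

/-! ### Lie derivatives along a one-parameter family of maps -/

section Flow

variable {n : ℕ} {M : Type*} [TopologicalSpace M] [ChartedSpace (EuclideanSpace ℝ (Fin n)) M]
  [IsManifold (𝓡 n) ∞ M]
  {F : Type*} [NormedAddCommGroup F] [NormedSpace ℝ F]

variable (n) in
/-- `g` is a smooth family of self-maps of `M`, starting at the identity with velocity `K`. -/
structure IsVelocity (g : ℝ → M → M) (K : RField n M) : Prop where
  smooth : ContMDiff (𝓘(ℝ, ℝ).prod (𝓡 n)) (𝓡 n) ∞ (fun p : ℝ × M => g p.1 p.2)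
  zero : ∀ y, g 0 y = y
  velocity : ∀ y, K y =
    (mfderiv 𝓘(ℝ, ℝ) (𝓡 n) (fun s : ℝ => g s y) 0 (1 : ℝ) : EuclideanSpace ℝ (Fin n))

variable {g : ℝ → M → M} {K : RField n M}

theorem IsVelocity.smooth_orbit (hg : IsVelocity n g K) (y : M) :
    ContMDiff 𝓘(ℝ, ℝ) (𝓡 n) ∞ (fun s : ℝ => g s y) :=
  hg.smooth.comp (contMDiff_id.prodMk contMDiff_const)

theorem IsVelocity.smooth_map (hg : IsVelocity n g K) (s : ℝ) :
    ContMDiff (𝓡 n) (𝓡 n) ∞ (g s) :=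
  hg.smooth.comp (contMDiff_const.prodMk contMDiff_id)

theorem IsVelocity.hasDerivAt (hg : IsVelocity n g K) {h : M → F} {x : M}
    (hh : MDifferentiableAt (𝓡 n) 𝓘(ℝ, F) h x) :
    HasDerivAt (fun s => h (g s x)) (mvfderiv (𝓡 n) h x (K x)) 0 := by
  have ho := (hg.smooth_orbit x).mdifferentiable (by simp) 0
  have hx : g 0 x = x := hg.zero x
  have h1 : MDifferentiableAt (𝓡 n) 𝓘(ℝ, F) h (g 0 x) := by rw [hx]; exact hh
  let L : ℝ →L[ℝ] F := (mfderiv (𝓡 n) 𝓘(ℝ, F) h (g 0 x)).comp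
    (mfderiv 𝓘(ℝ, ℝ) (𝓡 n) (fun s : ℝ => g s x) 0)
  have h2 : HasFDerivAt (fun s => h (g s x)) L (0 : ℝ) :=
    hasMFDerivAt_iff_hasFDerivAt.1 (h1.hasMFDerivAt.comp (0 : ℝ) ho.hasMFDerivAt)
  refine h2.hasDerivAt.congr_deriv ?_
  have key : ∀ y : M, g 0 x = y → (mfderiv (𝓡 n) 𝓘(ℝ, F) h (g 0 x) : EuclideanSpace ℝ (Fin n) →L[ℝ] F)
      = mfderiv (𝓡 n) 𝓘(ℝ, F) h y := by
    rintro y rfl; rfl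
  have h3 := congrArg (fun L : EuclideanSpace ℝ (Fin n) →L[ℝ] F => L (K x)) (key x hx)
  refine Eq.trans ?_ h3
  rw [hg.velocity]
  rfl

/-- Mixed partials commute and the s-derivative of f ∘ g_s at 0 is Kf, so d(f ∘ g_s) has derivative
d(Kf). This one formula gives both the bracket identities and the holomorphy of Kf. -/
theorem IsVelocity.hasDerivAt_mvfderiv (hg : IsVelocity n g K) {f : M → F} {x : M}
    (hf : ContMDiffAt (𝓡 n) 𝓘(ℝ, F) 2 f x) :
    HasDerivAt (F := EuclideanSpace ℝ (Fin n) →L[ℝ] F)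
      (fun s => mvfderiv (𝓡 n) (fun y => f (g s y)) x)
      (mvfderiv (𝓡 n) (fun y => mvfderiv (𝓡 n) f y (K y)) x) 0 := by
  have h1 : ContMDiffAt (𝓘(ℝ, ℝ).prod (𝓡 n)) 𝓘(ℝ, F) 2 (fun p : ℝ × M => f (g p.1 p.2)) (0, x) := by
    refine ContMDiffAt.comp (I' := 𝓡 n) (g := f) _ ?_ ((hg.smooth _).of_le (by norm_cast))
    simpa [hg.zero] using hf
  have h2 := ToricGK.hasDerivAt_mvfderiv (H := fun s y => f (g s y)) h1
  refine h2.congr_deriv ?_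
  refine Filter.EventuallyEq.mfderiv_eq ?_
  filter_upwards [eventually_mdifferentiableAt hf] with y hy
  exact (hg.hasDerivAt hy).deriv

theorem contMDiffAt_extChartAt_self (x : M) :
    ContMDiffAt (𝓡 n) 𝓘(ℝ, EuclideanSpace ℝ (Fin n)) 2 (extChartAt (𝓡 n) x) x := by
  have : IsManifold (𝓡 n) 2 M := IsManifold.of_le (m := 2) (n := ∞) (by norm_cast)
  exact contMDiffAt_extChartAt

theorem mvfderiv_extChartAt (x : M) (v : TangentSpace (𝓡 n) x) :
    mvfderiv (𝓡 n) (extChartAt (𝓡 n) x) x v = v := by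
  have h : (mfderiv (𝓡 n) 𝓘(ℝ, EuclideanSpace ℝ (Fin n)) (extChartAt (𝓡 n) x) x) v = v := by
    rw [mfderiv_extChartAt_self]; rfl
  exact h

/-- The derivative of `g s` at `x`, composed with the chart at `x`. -/
theorem IsVelocity.eventually_mvfderiv_comp (hg : IsVelocity n g K) (x : M) :
    ∀ᶠ s in 𝓝 (0 : ℝ), (g s x ∈ (extChartAt (𝓡 n) x).source) ∧
      ∀ v : TangentSpace (𝓡 n) x, mvfderiv (𝓡 n) (fun y => extChartAt (𝓡 n) x (g s y)) x v =
        mvfderiv (𝓡 n) (extChartAt (𝓡 n) x) (g s x) (mfderiv (𝓡 n) (𝓡 n) (g s) x v) := by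
  have hc : ContinuousAt (fun s => g s x) 0 := (hg.smooth_orbit x).continuous.continuousAt
  have : ∀ᶠ s in 𝓝 (0 : ℝ), g s x ∈ (extChartAt (𝓡 n) x).source := by
    apply hc.eventually_mem
    rw [hg.zero]
    exact extChartAt_source_mem_nhds x
  filter_upwards [this] with s hs
  refine ⟨hs, fun v => ?_⟩
  rw [extChartAt_source] at hs
  exact mfderiv_comp_apply x (mdifferentiableAt_extChartAt hs)
    ((hg.smooth_map s).mdifferentiable (by simp) x) v

theorem mvfderiv_extChartAt_injective {x y : M} (hy : y ∈ (extChartAt (𝓡 n) x).source) :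
    Function.Injective (mvfderiv (𝓡 n) (extChartAt (𝓡 n) x) y) :=
  (isInvertible_mfderiv_extChartAt hy).injective

/-- `[K, JX] = J[K, X]` for a tensor `J` that is invariant along `g`. -/
theorem IsVelocity.bracket_app (hg : IsVelocity n g K) {J : EndField n M} {x : M}
    (hJ : ∀ s v, mfderiv (𝓡 n) (𝓡 n) (g s) x (J x v) = J (g s x) (mfderiv (𝓡 n) (𝓡 n) (g s) x v))
    (hK : MDiffField K x) {X : RField n M} (hX : MDiffField X x) (hJX : MDiffField (J.app X) x) :
    bracket K (J.app X) x = J x (bracket K X x) := by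
  set φ := extChartAt (𝓡 n) x with hφ
  have hφ2 := contMDiffAt_extChartAt_self (n := n) x
  let E := EuclideanSpace ℝ (Fin n)
  let A : ℝ → E →L[ℝ] E := fun s => mvfderiv (𝓡 n) (fun y => φ (g s y)) x
  let A' : E →L[ℝ] E := mvfderiv (𝓡 n) (fun y => mvfderiv (𝓡 n) φ y (K y)) x
  have hA : HasDerivAt A A' 0 := hg.hasDerivAt_mvfderiv hφ2
  have hA0 : A 0 = 1 := by
    have : (fun y => φ (g 0 y)) = φ := by funext y; rw [hg.zero]
    ext1 v
    change mvfderiv (𝓡 n) (fun y => φ (g 0 y)) x v = v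
    rw [this]
    exact mvfderiv_extChartAt x v
  let a : ℝ → E := fun s => mvfderiv (𝓡 n) φ (g s x) (X (g s x))
  let b : ℝ → E := fun s => mvfderiv (𝓡 n) φ (g s x) (J.app X (g s x))
  have ha := hg.hasDerivAt (mdifferentiableAt_mvfderiv hφ2 hX)
  have hb := hg.hasDerivAt (mdifferentiableAt_mvfderiv hφ2 hJX)
  -- This is the pullback of X by g_s at x, whose derivative at 0 is [K, X]. `Ring.inverse` is zero
  -- off units, which is harmless because A s is a unit near s = 0. Invariance of J says that the
  -- pullback of JX is J applied to w s.
  let w : ℝ → E := fun s => Ring.inverse (A s) (a s)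
  have hinv : DifferentiableAt ℝ (fun s => Ring.inverse (A s)) 0 := by
    have h1 : DifferentiableAt ℝ (Ring.inverse : (E →L[ℝ] E) → _) (A 0) := by
      rw [hA0]; exact differentiableAt_inverse isUnit_one
    exact DifferentiableAt.comp (0 : ℝ) (g := Ring.inverse) (f := A) h1 hA.differentiableAt
  have hw : DifferentiableAt ℝ w 0 := hinv.clm_apply ha.differentiableAt
  have hunit : ∀ᶠ s in 𝓝 (0 : ℝ), IsUnit (A s) := by
    have : {L : E →L[ℝ] E | IsUnit L} ∈ 𝓝 (A 0) := by
      rw [hA0]; exact Units.isOpen.mem_nhds isUnit_one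
    exact hA.continuousAt.eventually_mem this
  let Jx : E →L[ℝ] E := J x
  have hw0 : w 0 = X x := by
    change Ring.inverse (A 0) (mvfderiv (𝓡 n) φ (g 0 x) (X (g 0 x))) = X x
    rw [hA0, Ring.inverse_one, hg.zero]
    exact mvfderiv_extChartAt x (X x)
  have ew : ∀ᶠ s in 𝓝 (0 : ℝ), a s = A s (w s) ∧ b s = A s (Jx (w s)) := by
    filter_upwards [hunit, hg.eventually_mvfderiv_comp x] with s hs ⟨hs1, hs2⟩
    have h1 : A s (w s) = a s := by
      change (A s * Ring.inverse (A s)) (a s) = a s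
      rw [Ring.mul_inverse_cancel _ hs]; rfl
    refine ⟨h1.symm, ?_⟩
    have h2 := hs2 (w s)
    have h3 : mfderiv (𝓡 n) (𝓡 n) (g s) x (w s) = X (g s x) :=
      mvfderiv_extChartAt_injective hs1 (h2.symm.trans h1)
    have h4 := hs2 (Jx (w s))
    refine Eq.trans ?_ h4.symm
    have h5 := hJ s (w s)
    rw [h3] at h5
    change _ = mvfderiv (𝓡 n) φ (g s x) ((mfderiv (𝓡 n) (𝓡 n) (g s) x) (J x (w s)))
    rw [h5]
    rfl
  have ha' := ha.unique ((hA.clm_apply hw.hasDerivAt).congr_of_eventuallyEq (ew.mono fun s h => h.1))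
  have hb' := hb.unique ((hA.clm_apply ((hasDerivAt_const (0 : ℝ) Jx).clm_apply
    hw.hasDerivAt)).congr_of_eventuallyEq (ew.mono fun s h => h.2))
  -- The chart itself is the test function: its derivative at x is the identity, so the derivation
  -- formula computes the bracket vector.
  have k1 := mvfderiv_bracket hφ2 hK hX
  have k2 := mvfderiv_bracket hφ2 hK hJX
  rw [mvfderiv_extChartAt, ha'] at k1
  rw [mvfderiv_extChartAt, hb'] at k2
  rw [hA0, hw0] at ha' hb' k1 k2
  have k1' : bracket K X x = deriv w 0 := by
    rw [k1]; exact add_sub_cancel_left (A' (X x)) (deriv w 0)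
  have k2' : bracket K (J.app X) x = Jx (deriv w 0) := by
    rw [k2]
    refine Eq.trans ?_ (add_sub_cancel_left (A' (Jx (X x))) (Jx (deriv w 0)))
    refine congrArg₂ (fun p q : E => p - q) (congrArg (fun p : E => A' (Jx (X x)) + p) ?_) rfl
    exact zero_add _
  rw [k1', k2']
  rfl

/-- `[K, X] = 0` for a vector field `X` that is invariant along `g`. -/
theorem IsVelocity.bracket_eq_zero (hg : IsVelocity n g K) {X : RField n M} {x : M}
    (hX : ∀ s, mfderiv (𝓡 n) (𝓡 n) (g s) x (X x) = X (g s x))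
    (hK : MDiffField K x) (hXd : MDiffField X x) :
    bracket K X x = 0 := by
  set φ := extChartAt (𝓡 n) x with hφ
  have hφ2 := contMDiffAt_extChartAt_self (n := n) x
  have hA := hg.hasDerivAt_mvfderiv hφ2
  have ha := hg.hasDerivAt (mdifferentiableAt_mvfderiv hφ2 hXd)
  have hA' := hA.clm_apply
    (hasDerivAt_const (F := EuclideanSpace ℝ (Fin n)) (0 : ℝ) (X x))
  have e : ∀ᶠ s in 𝓝 (0 : ℝ), mvfderiv (𝓡 n) φ (g s x) (X (g s x)) =
      mvfderiv (𝓡 n) (fun y => φ (g s y)) x (X x) := by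
    filter_upwards [hg.eventually_mvfderiv_comp x] with s ⟨hs1, hs2⟩
    rw [hs2, hX]
  have h := ha.unique (hA'.congr_of_eventuallyEq e)
  have k := mvfderiv_bracket hφ2 hK hXd
  rw [mvfderiv_extChartAt, h] at k
  rw [k]
  refine Eq.trans ?_
    (add_sub_cancel_left (mvfderiv (𝓡 n) (fun y => mvfderiv (𝓡 n) φ y (K y)) x (X x)) 0)
  exact congrArg (fun p : EuclideanSpace ℝ (Fin n) => _ + p - _) (map_zero _)

end Flow

/-! ### Smoothness of vector fields tested through the derivative of a chart -/

section Smooth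

variable {n : ℕ} {M : Type*} [TopologicalSpace M] [ChartedSpace (EuclideanSpace ℝ (Fin n)) M]
  [IsManifold (𝓡 n) ∞ M]
  {F : Type*} [NormedAddCommGroup F] [NormedSpace ℝ F]

/-- Smoothness of a vector field at a point. -/
abbrev SmoothFieldAt (X : RField n M) (x : M) : Prop :=
  ContMDiffAt (𝓡 n) ((𝓡 n).prod 𝓘(ℝ, EuclideanSpace ℝ (Fin n))) ∞
      (fun x => (Bundle.TotalSpace.mk' (EuclideanSpace ℝ (Fin n)) x (X x) :
        TangentBundle (𝓡 n) M)) x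

theorem SmoothField.smoothFieldAt {X : RField n M} (hX : SmoothField X) (x : M) :
    SmoothFieldAt X x := by
  unfold SmoothField at hX
  exact hX x

theorem SmoothFieldAt.mdiffField {X : RField n M} {x : M} (hX : SmoothFieldAt X x) :
    MDiffField X x := hX.mdifferentiableAt (by simp)

/-- The trivialization of TM at x is the derivative of the chart at x. Sections can then be handled
as vector valued functions obtained by differentiating the chart. -/
theorem trivializationAt_snd_eq_mvfderiv {x y : M} (hy : y ∈ (extChartAt (𝓡 n) x).source)
    (v : TangentSpace (𝓡 n) y) :
    (trivializationAt (EuclideanSpace ℝ (Fin n)) (TangentSpace (𝓡 n)) x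
      (Bundle.TotalSpace.mk' (EuclideanSpace ℝ (Fin n)) y v)).2 =
      mvfderiv (𝓡 n) (extChartAt (𝓡 n) x) y v := by
  rw [extChartAt_source] at hy
  have h := TangentBundle.continuousLinearMapAt_trivializationAt (I := 𝓡 n) hy
  have h2 := congrArg (fun L : EuclideanSpace ℝ (Fin n) →L[ℝ] EuclideanSpace ℝ (Fin n) => L v) h
  refine Eq.trans ?_ h2
  have hb : y ∈ (trivializationAt (EuclideanSpace ℝ (Fin n)) (TangentSpace (𝓡 n)) x).baseSet := by
    simpa using hy
  exact (Bundle.Trivialization.continuousLinearMapAt_apply_of_mem ℝ _ hb v).symm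

theorem smoothFieldAt_iff {X : RField n M} {x : M} :
    SmoothFieldAt X x ↔ ContMDiffAt (𝓡 n) 𝓘(ℝ, EuclideanSpace ℝ (Fin n)) ∞
      (fun y => mvfderiv (𝓡 n) (extChartAt (𝓡 n) x) y (X y)) x := by
  unfold SmoothFieldAt
  rw [Bundle.contMDiffAt_section]
  refine Filter.EventuallyEq.contMDiffAt_iff ?_
  filter_upwards [extChartAt_source_mem_nhds (I := 𝓡 n) x] with y hy
  exact trivializationAt_snd_eq_mvfderiv hy (X y)

/-- The chain rule in the chart at `x`. -/
theorem mvfderiv_eq_fderiv_mvfderiv {f : M → F} {x y : M}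
    (hy : y ∈ (extChartAt (𝓡 n) x).source) (hf : MDifferentiableAt (𝓡 n) 𝓘(ℝ, F) f y)
    (v : TangentSpace (𝓡 n) y) :
    mvfderiv (𝓡 n) f y v = fderiv ℝ (f ∘ (extChartAt (𝓡 n) x).symm) (extChartAt (𝓡 n) x y)
      (mvfderiv (𝓡 n) (extChartAt (𝓡 n) x) y v) := by
  have ht := (extChartAt (𝓡 n) x).map_source hy
  have hinv := (extChartAt (𝓡 n) x).left_inv hy
  have hs := mdifferentiableWithinAt_extChartAt_symm ht
  rw [ModelWithCorners.range_eq_univ, mdifferentiableWithinAt_univ] at hs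
  have hf' : MDifferentiableAt (𝓡 n) 𝓘(ℝ, F) f ((extChartAt (𝓡 n) x).symm (extChartAt (𝓡 n) x y)) := by
    rwa [hinv]
  have h := hf'.comp (extChartAt (𝓡 n) x y) hs
  have hd : MDifferentiableAt (𝓡 n) 𝓘(ℝ, EuclideanSpace ℝ (Fin n)) (extChartAt (𝓡 n) x) y :=
    mdifferentiableAt_extChartAt (by rwa [extChartAt_source] at hy)
  have h3 := mfderiv_comp_apply y h hd v
  rw [mfderiv_eq_fderiv] at h3
  refine Eq.trans ?_ h3
  have e : f =ᶠ[𝓝 y] (f ∘ (extChartAt (𝓡 n) x).symm) ∘ (extChartAt (𝓡 n) x) := by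
    filter_upwards [extChartAt_source_mem_nhds' hy] with z hz
    simp only [Function.comp_apply]
    rw [(extChartAt (𝓡 n) x).left_inv hz]
  exact congrArg (fun L : EuclideanSpace ℝ (Fin n) →L[ℝ] F => L v) e.mfderiv_eq

theorem contDiffAt_comp_extChartAt_symm_top {f : M → F} {x : M}
    (hf : ContMDiffAt (𝓡 n) 𝓘(ℝ, F) ∞ f x) :
    ContDiffAt ℝ ∞ (f ∘ (extChartAt (𝓡 n) x).symm) (extChartAt (𝓡 n) x x) := by
  rw [contMDiffAt_iff] at hf
  simpa using! hf.2

theorem eventually_mdifferentiableAt_of_top {f : M → F} {x : M}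
    (hf : ContMDiffAt (𝓡 n) 𝓘(ℝ, F) ∞ f x) :
    ∀ᶠ y in 𝓝 x, MDifferentiableAt (𝓡 n) 𝓘(ℝ, F) f y :=
  eventually_mdifferentiableAt (hf.of_le (by norm_cast))

/-- The derivative of a smooth function along a smooth vector field is smooth. -/
theorem SmoothFieldAt.contMDiffAt_mvfderiv {X : RField n M} {x : M} (hX : SmoothFieldAt X x)
    {f : M → F} (hf : ContMDiffAt (𝓡 n) 𝓘(ℝ, F) ∞ f x) :
    ContMDiffAt (𝓡 n) 𝓘(ℝ, F) ∞ (fun y => mvfderiv (𝓡 n) f y (X y)) x := by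
  have h1 := (contDiffAt_comp_extChartAt_symm_top hf).fderiv_right (m := ∞) (by simp)
  have h2 : ContMDiffAt (𝓡 n) 𝓘(ℝ, EuclideanSpace ℝ (Fin n) →L[ℝ] F) ∞
      (fun y => fderiv ℝ (f ∘ (extChartAt (𝓡 n) x).symm) (extChartAt (𝓡 n) x y)) x :=
    h1.contMDiffAt.comp x contMDiffAt_extChartAt
  refine (h2.clm_apply (smoothFieldAt_iff.1 hX)).congr_of_eventuallyEq ?_
  filter_upwards [extChartAt_source_mem_nhds (I := 𝓡 n) x, eventually_mdifferentiableAt_of_top hf]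
    with y hy hfy
  exact mvfderiv_eq_fderiv_mvfderiv hy hfy _

theorem SmoothField.contMDiff_mvfderiv {X : RField n M} (hX : SmoothField X)
    {f : M → F} (hf : ContMDiff (𝓡 n) 𝓘(ℝ, F) ∞ f) :
    ContMDiff (𝓡 n) 𝓘(ℝ, F) ∞ (fun y => mvfderiv (𝓡 n) f y (X y)) :=
  fun x => (hX.smoothFieldAt x).contMDiffAt_mvfderiv (hf x)

theorem contMDiffAt_deriv {x : M} {H : ℝ → M → F}
    (hH : ContMDiffAt (𝓘(ℝ, ℝ).prod (𝓡 n)) 𝓘(ℝ, F) ∞ (fun p : ℝ × M => H p.1 p.2) (0, x)) :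
    ContMDiffAt (𝓡 n) 𝓘(ℝ, F) ∞ (fun y => deriv (fun s => H s y) 0) x := by
  set φ := extChartAt (𝓡 n) x with hφ
  set G : ℝ × EuclideanSpace ℝ (Fin n) → F := fun p => H p.1 (φ.symm p.2) with hG
  have hG2 : ContDiffAt ℝ ∞ G (0, φ x) := by
    rw [contMDiffAt_iff] at hH
    simpa [Function.comp_def] using! hH.2
  have hGe : ∀ᶠ p in 𝓝 ((0 : ℝ), φ x), DifferentiableAt ℝ G p :=
    ((hG2.of_le (m := 1) (by norm_cast)).eventually (by simp)).mono
      fun p hp => hp.differentiableAt (by norm_num)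
  have c3 : ContMDiffAt (𝓡 n) 𝓘(ℝ, ℝ × EuclideanSpace ℝ (Fin n)) ∞ (fun y => ((0 : ℝ), φ y)) x :=
    contMDiffAt_const.prodMk_space contMDiffAt_extChartAt
  have e2 : (fun y => deriv (fun s => H s y) 0) =ᶠ[𝓝 x]
      fun y => fderiv ℝ G (0, φ y) (1, 0) := by
    filter_upwards [c3.continuousAt.eventually hGe, extChartAt_source_mem_nhds (I := 𝓡 n) x]
      with y hy hys
    have h := (hy.hasFDerivAt.comp_hasDerivAt_of_eq (0 : ℝ)
      ((hasDerivAt_id (0 : ℝ)).prodMk (hasDerivAt_const (0 : ℝ) (φ y))) rfl).deriv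
    rw [← h]
    simp only [hG, Function.comp_def, id]
    rw [φ.left_inv hys]
  have h1 := (hG2.fderiv_right (m := ∞) (by simp)).contMDiffAt.comp x c3
  exact (h1.clm_apply contMDiffAt_const).congr_of_eventuallyEq e2

/-- In the chart φ, K is the partial derivative at s = 0 of the jointly smooth function φ(g_s y). -/
theorem IsVelocity.smoothField {g : ℝ → M → M} {K : RField n M} (hg : IsVelocity n g K) :
    SmoothField K := by
  unfold SmoothField
  intro x
  rw [show ContMDiffAt _ _ _ _ x ↔ _ from smoothFieldAt_iff (X := K) (x := x)]
  have h1 : ContMDiffAt (𝓘(ℝ, ℝ).prod (𝓡 n)) 𝓘(ℝ, EuclideanSpace ℝ (Fin n)) ∞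
      (fun p : ℝ × M => extChartAt (𝓡 n) x (g p.1 p.2)) (0, x) := by
    refine ContMDiffAt.comp (I' := 𝓡 n) (g := extChartAt (𝓡 n) x) _ ?_ (hg.smooth _)
    simpa [hg.zero] using! (contMDiffAt_extChartAt (n := ∞) (I := 𝓡 n) (x := x))
  refine (contMDiffAt_deriv (H := fun s y => extChartAt (𝓡 n) x (g s y)) h1).congr_of_eventuallyEq ?_
  filter_upwards [extChartAt_source_mem_nhds (I := 𝓡 n) x] with y hy
  have hd : MDifferentiableAt (𝓡 n) 𝓘(ℝ, EuclideanSpace ℝ (Fin n)) (extChartAt (𝓡 n) x) y :=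
    mdifferentiableAt_extChartAt (by rwa [extChartAt_source] at hy)
  exact (hg.hasDerivAt hd).deriv.symm

theorem SmoothField.app {A : EndField n M} (hA : SmoothEnd A) {X : RField n M}
    (hX : SmoothField X) : SmoothField (A.app X) := by
  unfold SmoothField SmoothEnd at *
  exact ContMDiff.clm_bundle_apply hA hX

theorem SmoothField.sub {X Y : RField n M} (hX : SmoothField X) (hY : SmoothField Y) :
    SmoothField (X - Y) := by
  unfold SmoothField at *
  exact hX.sub_section hY

theorem SmoothField.bracket {X Y : RField n M} (hX : SmoothField X) (hY : SmoothField Y) :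
    SmoothField (bracket X Y) := by
  unfold SmoothField at *
  have : IsManifold (𝓡 n) ((⊤ : ℕ∞) + 1) M := by simpa using (inferInstance : IsManifold (𝓡 n) ∞ M)
  have : IsManifold (𝓡 n) (minSmoothness ℝ 2) M := by
    rw [minSmoothness_of_isRCLikeNormedField]
    exact IsManifold.of_le (n := ∞) (by norm_cast)
  intro x
  exact (hX x).mlieBracket_vectorField (m := ⊤) (hY x) (by simp)

end Smooth

/-! ### The infinitesimal torus action, the moment map and isotropy -/

section TorusAction

theorem torusExp_add {m : ℕ} (a b : Fin m → ℝ) : torusExp (a + b) = torusExp a * torusExp b := by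
  funext j; simp [torusExp, Circle.exp_add]

theorem torusExp_zero {m : ℕ} : torusExp (0 : Fin m → ℝ) = 1 := by
  funext j; simp [torusExp]

theorem torusExp_surjective {m : ℕ} : Function.Surjective (torusExp (m := m)) := fun g =>
  ⟨fun j => (g j : ℂ).arg, funext fun j => Circle.exp_arg (g j)⟩

variable {m : ℕ} {M : Type*} [TopologicalSpace M]
  [ChartedSpace (EuclideanSpace ℝ (Fin (2 * m))) M] [MulAction (Fin m → Circle) M]
  [IsManifold (𝓡 (2 * m)) ∞ M] {Ω : TwoTensor (2 * m) M} {μ : M → Fin m → ℝ}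

theorem IsSymplecticToric.isVelocity (hM : IsSymplecticToric Ω μ) (a : Fin m → ℝ) :
    IsVelocity (2 * m) (fun s y => torusExp (s • a) • y) (infAction M a) where
  smooth := hM.smooth_action.comp
    ((contMDiff_fst.smul contMDiff_const).prodMk contMDiff_snd)
  zero y := by simp [torusExp_zero]
  velocity y := rfl

theorem IsSymplecticToric.smoothField (hM : IsSymplecticToric Ω μ) (a : Fin m → ℝ) :
    SmoothField (infAction M a) := (hM.isVelocity a).smoothField

theorem IsSymplecticToric.smooth_smul (hM : IsSymplecticToric Ω μ) (g : Fin m → Circle) :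
    ContMDiff (𝓡 (2 * m)) (𝓡 (2 * m)) ∞ (fun y : M => g • y) := by
  obtain ⟨b, rfl⟩ := torusExp_surjective g
  exact hM.smooth_action.comp (contMDiff_const.prodMk contMDiff_id)

theorem IsSymplecticToric.continuous_orbit (hM : IsSymplecticToric Ω μ) (x : M) :
    Continuous (fun b : Fin m → ℝ => torusExp b • x) :=
  (hM.smooth_action.comp (contMDiff_id.prodMk contMDiff_const)).continuous

/-- The derivative at `0` of the orbit map. -/
def orbitDeriv (x : M) : (Fin m → ℝ) →L[ℝ] EuclideanSpace ℝ (Fin (2 * m)) :=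
  mfderiv 𝓘(ℝ, Fin m → ℝ) (𝓡 (2 * m)) (fun b : Fin m → ℝ => torusExp b • x) 0

/-- The chain rule along the line s ↦ s a; its purpose is linearity of the infinitesimal action in
a. -/
theorem IsSymplecticToric.infAction_eq (hM : IsSymplecticToric Ω μ) (a : Fin m → ℝ) (x : M) :
    infAction M a x = orbitDeriv x a := by
  have h1 : ContMDiff 𝓘(ℝ, Fin m → ℝ) (𝓡 (2 * m)) ∞ (fun b : Fin m → ℝ => torusExp b • x) :=
    hM.smooth_action.comp (contMDiff_id.prodMk contMDiff_const)
  have h2 : HasFDerivAt (fun s : ℝ => s • a) (ContinuousLinearMap.toSpanSingleton ℝ a) 0 :=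
    (hasFDerivAt_id (0 : ℝ)).smul_const a
  have h3 := mfderiv_comp_of_eq (I := 𝓘(ℝ, ℝ)) (I' := 𝓘(ℝ, Fin m → ℝ)) (I'' := 𝓡 (2 * m))
    (g := fun b : Fin m → ℝ => torusExp b • x) (f := fun s : ℝ => s • a) (x := (0 : ℝ))
    (y := (0 : Fin m → ℝ)) (h1.mdifferentiable (by simp) 0) h2.hasMFDerivAt.mdifferentiableAt
    (by simp)
  have h4 := congrArg (fun L : ℝ →L[ℝ] EuclideanSpace ℝ (Fin (2 * m)) => L 1) h3
  refine Eq.trans h4 ?_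
  rw [mfderiv_eq_fderiv, h2.fderiv]
  have h5 : ∀ b : Fin m → ℝ, b = 0 → (mfderiv 𝓘(ℝ, Fin m → ℝ) (𝓡 (2 * m))
    (fun b : Fin m → ℝ => torusExp b • x) b : (Fin m → ℝ) →L[ℝ] EuclideanSpace ℝ (Fin (2 * m)))
      ((1 : ℝ) • a) = orbitDeriv x a := by
    rintro b rfl
    rw [one_smul]; rfl
  exact h5 _ (zero_smul ℝ a)

theorem IsSymplecticToric.infAction_sum (hM : IsSymplecticToric Ω μ) {ι : Type*} [Fintype ι]
    (c : ι → ℝ) (a : ι → Fin m → ℝ) (x : M) :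
    infAction M (∑ i, c i • a i) x = ∑ i, c i • infAction M (a i) x := by
  simp only [hM.infAction_eq]
  rw [map_sum]
  simp only [map_smul]
  rfl

theorem mem_orbitSpan_iff (hM : IsSymplecticToric Ω μ) (ξ : Module.Basis (Fin m) ℝ (Fin m → ℝ))
    {x : M} {v : TangentSpace (𝓡 (2 * m)) x} :
    v ∈ orbitSpan x ↔ ∃ c : Fin m → ℝ, v = ∑ i, c i • infAction M (ξ i) x := by
  constructor
  · intro hv
    unfold orbitSpan at hv
    induction hv using Submodule.span_induction with
    | mem w hw =>
      obtain ⟨a, rfl⟩ := hw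
      refine ⟨fun i => ξ.repr a i, ?_⟩
      rw [← hM.infAction_sum, ξ.sum_repr]
    | zero => exact ⟨0, by simp⟩
    | add v w _ _ hv hw =>
      obtain ⟨c, rfl⟩ := hv
      obtain ⟨d, rfl⟩ := hw
      exact ⟨c + d, by simp [add_smul, Finset.sum_add_distrib]⟩
    | smul r v _ hv =>
      obtain ⟨c, rfl⟩ := hv
      exact ⟨r • c, by simp [Finset.smul_sum, mul_smul]⟩
  · rintro ⟨c, rfl⟩
    exact Submodule.sum_mem _ fun i _ => Submodule.smul_mem _ _ (Submodule.subset_span ⟨ξ i, rfl⟩)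

/-- The derivative of `h` along the infinitesimal action. -/
theorem IsSymplecticToric.mfderiv_smul_infAction (hM : IsSymplecticToric Ω μ) (g : Fin m → Circle)
    (a : Fin m → ℝ) (x : M) :
    mfderiv (𝓡 (2 * m)) (𝓡 (2 * m)) (fun y : M => g • y) x (infAction M a x) =
      infAction M a (g • x) := by
  have h1 := (hM.isVelocity a).smooth_orbit x
  have h3 := mfderiv_comp_of_eq (I := 𝓘(ℝ, ℝ)) (I' := 𝓡 (2 * m)) (I'' := 𝓡 (2 * m))
    (g := fun y : M => g • y) (f := fun s : ℝ => torusExp (s • a) • x) (x := (0 : ℝ))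
    (y := x) ((hM.smooth_smul g).mdifferentiable (by simp) x) (h1.mdifferentiable (by simp) 0)
    (by simp [torusExp_zero])
  have h4 := congrArg (fun L : ℝ →L[ℝ] EuclideanSpace ℝ (Fin (2 * m)) => L 1) h3
  have h5 : ∀ z : M, z = x → (mfderiv (𝓡 (2 * m)) (𝓡 (2 * m)) (fun y : M => g • y) z :
      EuclideanSpace ℝ (Fin (2 * m)) →L[ℝ] EuclideanSpace ℝ (Fin (2 * m))) (infAction M a x) =
      mfderiv (𝓡 (2 * m)) (𝓡 (2 * m)) (fun y : M => g • y) x (infAction M a x) := by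
    rintro z rfl; rfl
  have h6 : infAction M a (g • x) = (mfderiv 𝓘(ℝ, ℝ) (𝓡 (2 * m))
    ((fun y : M => g • y) ∘ fun s : ℝ => torusExp (s • a) • x) 0 :
      ℝ →L[ℝ] EuclideanSpace ℝ (Fin (2 * m))) 1 := by
    have : ((fun y : M => g • y) ∘ fun s : ℝ => torusExp (s • a) • x) =
        fun s : ℝ => torusExp (s • a) • (g • x) := by
      funext s; simp only [Function.comp_apply, smul_smul, mul_comm]
    rw [this]; rfl
  rw [h6, ← h5 (torusExp ((0 : ℝ) • a) • x) (by simp [torusExp_zero])]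
  exact h4.symm

theorem IsSymplecticToric.contMDiff_momentComp (hM : IsSymplecticToric Ω μ) (a : Fin m → ℝ) :
    ContMDiff (𝓡 (2 * m)) 𝓘(ℝ, ℝ) ∞ (momentComp μ a) := by
  have h : ContDiff ℝ ∞ (fun p : Fin m → ℝ => ∑ j, p j * a j) := by fun_prop
  exact h.contMDiff.comp hM.smooth_moment

theorem IsSymplecticToric.momentComp_smul (hM : IsSymplecticToric Ω μ) (a : Fin m → ℝ)
    (g : Fin m → Circle) (x : M) : momentComp μ a (g • x) = momentComp μ a x := by
  simp [momentComp, hM.invariant]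

/-- The moment map is constant on orbits. Together with ω(K_a, ·) = -dμ^a this makes orbits
isotropic, and it is the source of B² = 0. -/
theorem IsSymplecticToric.mvfderiv_momentComp_infAction (hM : IsSymplecticToric Ω μ)
    (a b : Fin m → ℝ) (x : M) :
    mvfderiv (𝓡 (2 * m)) (momentComp μ a) x (infAction M b x) = 0 := by
  have h := (hM.isVelocity b).hasDerivAt ((hM.contMDiff_momentComp a).mdifferentiable (by simp) x)
  simp only [hM.momentComp_smul] at h
  exact h.unique (hasDerivAt_const _ _)

theorem IsSymplecticToric.mvfderiv_momentComp_smul (hM : IsSymplecticToric Ω μ) (a : Fin m → ℝ)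
    (g : Fin m → Circle) (x : M) (v : TangentSpace (𝓡 (2 * m)) x) :
    mvfderiv (𝓡 (2 * m)) (momentComp μ a) (g • x)
      (mfderiv (𝓡 (2 * m)) (𝓡 (2 * m)) (fun y : M => g • y) x v) =
      mvfderiv (𝓡 (2 * m)) (momentComp μ a) x v := by
  have h := mfderiv_comp_apply (I := 𝓡 (2 * m)) (I' := 𝓡 (2 * m)) (I'' := 𝓘(ℝ, ℝ)) x
    ((hM.contMDiff_momentComp a).mdifferentiable (by simp) (g • x))
    ((hM.smooth_smul g).mdifferentiable (by simp) x) v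
  have e : momentComp μ a ∘ (fun y : M => g • y) = momentComp μ a := by
    funext y; exact hM.momentComp_smul a g y
  rw [e] at h
  exact h.symm

/-- A point whose isotropy algebra contains `a` is fixed by `exp (s a)`. -/
theorem IsSymplecticToric.torusExp_smul_eq (hM : IsSymplecticToric Ω μ) {a : Fin m → ℝ}
    {x : M} (h : infAction M a x = 0) (s : ℝ) : torusExp (s • a) • x = x := by
  have hv := hM.isVelocity a
  have hc : Continuous (fun s : ℝ => torusExp (s • a) • x) := (hv.smooth_orbit x).continuous
  -- The field is invariant, so it vanishes along the whole curve; the curve then has zero velocity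
  -- in the chart as long as it stays in the chart domain.
  have hK : ∀ s : ℝ, infAction M a (torusExp (s • a) • x) = 0 := fun s => by
    rw [← hM.mfderiv_smul_infAction, h, map_zero]
  have hsrc : ∀ᶠ s in 𝓝 (0 : ℝ), torusExp (s • a) • x ∈ (extChartAt (𝓡 (2 * m)) x).source := by
    apply hc.continuousAt.eventually_mem
    rw [hv.zero]
    exact extChartAt_source_mem_nhds x
  obtain ⟨δ, hδ, hball⟩ := Metric.eventually_nhds_iff_ball.1 hsrc
  have hd : ∀ s ∈ Metric.ball (0 : ℝ) δ, HasDerivAt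
      (fun s : ℝ => extChartAt (𝓡 (2 * m)) x (torusExp (s • a) • x)) 0 s := by
    intro s hs
    have hsm : MDifferentiableAt (𝓡 (2 * m)) 𝓘(ℝ, EuclideanSpace ℝ (Fin (2 * m)))
        (extChartAt (𝓡 (2 * m)) x) (torusExp (s • a) • x) :=
      mdifferentiableAt_extChartAt (by simpa using hball s hs)
    have h1 := hv.hasDerivAt hsm
    rw [hK, map_zero] at h1
    have h2 : HasDerivAt (fun u : ℝ => u - s) 1 s := by simpa using (hasDerivAt_id s).sub_const s
    have h3 := HasDerivAt.scomp_of_eq s h1 h2 (sub_self s).symm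
    rw [smul_zero] at h3
    refine h3.congr_of_eventuallyEq (Eventually.of_forall fun u => ?_)
    simp only [Function.comp_apply, smul_smul, ← torusExp_add, ← add_smul, sub_add_cancel]
  have hconst : ∀ s ∈ Metric.ball (0 : ℝ) δ, torusExp (s • a) • x = x := by
    intro s hs
    have h1 := (convex_ball (0 : ℝ) δ).is_const_of_fderivWithin_eq_zero (𝕜 := ℝ)
      (f := fun s : ℝ => extChartAt (𝓡 (2 * m)) x (torusExp (s • a) • x))
      (fun u hu => (hd u hu).differentiableAt.differentiableWithinAt)
      (fun u hu => by
        rw [fderivWithin_of_isOpen Metric.isOpen_ball hu, (hd u hu).hasFDerivAt.fderiv]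
        ext; simp) hs (Metric.mem_ball_self hδ)
    have h0 : torusExp ((0 : ℝ) • a) • x = x := hv.zero x
    rw [h0] at h1
    exact (extChartAt (𝓡 (2 * m)) x).injOn (hball s hs) (mem_extChartAt_source x) h1
  -- Constancy is known only for parameters below δ, so s is divided into N equal steps, each of
  -- which fixes x.
  obtain ⟨N, hN⟩ := exists_nat_gt (|s| / δ)
  have hN0 : (0 : ℝ) < N := lt_of_le_of_lt (by positivity) hN
  have hfix : torusExp ((s / N) • a) • x = x := by
    apply hconst
    rw [mem_ball_zero_iff, Real.norm_eq_abs, abs_div, abs_of_pos hN0, div_lt_iff₀ hN0]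
    rw [div_lt_iff₀ hδ] at hN
    linarith
  have hpow : ∀ k : ℕ, torusExp ((k * (s / N) : ℝ) • a) • x = x := by
    intro k
    induction k with
    | zero => simp [torusExp_zero]
    | succ k ih =>
      rw [Nat.cast_succ, add_mul, one_mul, add_smul, torusExp_add, mul_smul, hfix, ih]
  have := hpow N
  rwa [mul_div_cancel₀ _ hN0.ne'] at this

/-- If the field of a vanishes at x, the subgroup exp(s a) fixes x and is trivial by freeness.
Differentiating each coordinate exp(i s a_j) = 1 at s = 0 gives a_j = 0. -/
theorem IsSymplecticToric.infAction_injective (hM : IsSymplecticToric Ω μ) {x : M}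
    (hx : x ∈ freeLocus m M) {a : Fin m → ℝ} (h : infAction M a x = 0) : a = 0 := by
  have h1 : ∀ s : ℝ, torusExp (s • a) = 1 := fun s => hx _ (hM.torusExp_smul_eq h s)
  funext j
  have h2 : HasDerivAt (fun s : ℝ => (Circle.exp (s * a j) : ℂ)) (a j * Complex.I) 0 := by
    have h3 : HasDerivAt (fun s : ℝ => Complex.exp (((s * a j : ℝ) : ℂ) * Complex.I))
        (Complex.exp (((0 * a j : ℝ) : ℂ) * Complex.I) * (((1 * a j : ℝ) : ℂ) * Complex.I)) 0 :=
      ((((hasDerivAt_id (0 : ℝ)).mul_const (a j)).ofReal_comp).mul_const Complex.I).cexp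
    simpa using h3
  have h4 : (fun s : ℝ => (Circle.exp (s * a j) : ℂ)) = fun _ => 1 := by
    funext s
    have := congrFun (h1 s) j
    simp only [torusExp, Pi.smul_apply, smul_eq_mul, Pi.one_apply] at this
    rw [this]; simp
  rw [h4] at h2
  have h5 := h2.unique (hasDerivAt_const _ _)
  simpa using h5

end TorusAction

/-! ### Finite-order elements in closed subgroups of the torus -/

section TorusSubgroups

/-- A closed subgroup of the circle is everything or consists of elements of finite order. -/
theorem circle_subgroup_eq_top_or_isOfFinOrder (P : Subgroup Circle)
    (hP : IsClosed (P : Set Circle)) : P = ⊤ ∨ ∀ z ∈ P, IsOfFinOrder z := by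
  -- The lift to ℝ is a closed subgroup, hence all of ℝ or cyclic. In the cyclic case it contains
  -- 2π, so a nonzero multiple of the generator is 2π and every angle in it is a rational multiple
  -- of 2π.
  let S : AddSubgroup ℝ :=
    { carrier := {θ | Circle.exp θ ∈ P}
      zero_mem' := by simp
      add_mem' := fun {a b} ha hb => by
        simp only [mem_ofPred_eq, Circle.exp_add] at *; exact P.mul_mem ha hb
      neg_mem' := fun {a} ha => by
        simp only [mem_ofPred_eq, Circle.exp_neg] at *; exact P.inv_mem ha }
  have hS : IsClosed (S : Set ℝ) := hP.preimage Circle.exp.continuous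
  rcases S.dense_or_cyclic with h | ⟨a, ha⟩
  · left
    rw [eq_top_iff]
    intro z _
    have hz : z.val.arg ∈ (S : Set ℝ) := by
      rw [← hS.closure_eq, h.closure_eq]; trivial
    have hz' : Circle.exp z.val.arg ∈ P := hz
    rwa [Circle.exp_arg] at hz'
  · right
    intro z hz
    have h1 : z.val.arg ∈ S := by
      change Circle.exp z.val.arg ∈ P; rwa [Circle.exp_arg]
    have h2 : 2 * Real.pi ∈ S := by
      change Circle.exp (2 * Real.pi) ∈ P; rw [Circle.exp_two_pi]; exact P.one_mem
    rw [ha, AddSubgroup.mem_closure_singleton] at h1 h2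
    obtain ⟨k, hk⟩ := h1
    obtain ⟨l, hl⟩ := h2
    have hl0 : l ≠ 0 := by
      rintro rfl
      rw [zero_smul] at hl
      exact Real.two_pi_pos.ne hl
    rw [isOfFinOrder_iff_zpow_eq_one]
    refine ⟨l, hl0, ?_⟩
    rw [← Circle.exp_arg z, ← Circle.exp_zsmul, ← hk, smul_comm, hl]
    rw [zsmul_eq_mul]
    exact Circle.exp_int_mul_two_pi k

/-- A nontrivial closed subgroup of the torus contains a nontrivial element of finite order. -/
theorem exists_isOfFinOrder_of_isClosed {m : ℕ} (H : Subgroup (Fin m → Circle))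
    (hH : IsClosed {b : Fin m → ℝ | torusExp b ∈ H}) (hne : H ≠ ⊥) :
    ∃ g ∈ H, g ≠ 1 ∧ IsOfFinOrder g := by
  induction m with
  | zero => exact absurd (Subsingleton.elim H ⊥) hne
  | succ m ih =>
    let ι : (Fin m → Circle) →* (Fin (m + 1) → Circle) :=
      { toFun := fun h => Fin.cons 1 h
        map_one' := by
          funext j; refine Fin.cases ?_ (fun j => ?_) j <;> simp
        map_mul' := fun a b => by
          funext j; refine Fin.cases ?_ (fun j => ?_) j <;> simp }
    have hιexp : ∀ b : Fin m → ℝ, ι (torusExp b) = torusExp (Fin.cons 0 b : Fin (m + 1) → ℝ) :=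
      fun b => by
        funext j
        change (Fin.cons 1 (torusExp b) : Fin (m + 1) → Circle) j = _
        refine Fin.cases ?_ (fun j => ?_) j <;> simp [torusExp]
    have hιinj : ∀ h, ι h = 1 → h = 1 := fun h hh => by
      funext j
      have := congrFun hh j.succ
      simpa [ι] using this
    -- The dichotomy is whether H meets the subtorus with first coordinate 1 trivially. If it does,
    -- H projects injectively to the circle; otherwise induction applies to the intersection.
    by_cases hK : H.comap ι = ⊥
    · let pr : (Fin (m + 1) → Circle) →* Circle := Pi.evalMonoidHom _ 0
      have hker : ∀ h ∈ H, pr h = 1 → h = 1 := by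
        intro h hh h0
        have e : ι (Fin.tail h) = h := by
          change (Fin.cons 1 (Fin.tail h) : Fin (m + 1) → Circle) = h
          have h0' : h 0 = 1 := h0
          rw [← h0']; exact Fin.cons_self_tail h
        have : Fin.tail h ∈ H.comap ι := by rw [Subgroup.mem_comap, e]; exact hh
        rw [hK, Subgroup.mem_bot] at this
        rw [← e, this, map_one]
      have hclosed : IsClosed ((H.map pr : Subgroup Circle) : Set Circle) := by
        -- Arguments can be chosen in [-π, π], so the projection of H is the image of a compact set
        -- and therefore closed.
        have hcomp : IsCompact ((fun b : Fin (m + 1) → ℝ => Circle.exp (b 0)) ''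
            (Icc (fun _ => -Real.pi) (fun _ => Real.pi) ∩ {b | torusExp b ∈ H})) := by
          refine IsCompact.image (isCompact_Icc.inter_right hH) ?_
          exact Circle.exp.continuous.comp (continuous_apply 0)
        have e : ((H.map pr : Subgroup Circle) : Set Circle) =
            (fun b : Fin (m + 1) → ℝ => Circle.exp (b 0)) ''
            (Icc (fun _ => -Real.pi) (fun _ => Real.pi) ∩ {b | torusExp b ∈ H}) := by
          ext z
          constructor
          · rintro ⟨h, hh, rfl⟩
            have hexp : torusExp (fun j => (h j : ℂ).arg) = h := funext fun j => Circle.exp_arg (h j)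
            refine ⟨fun j => (h j : ℂ).arg, ⟨⟨fun j => (Complex.neg_pi_lt_arg _).le,
              fun j => Complex.arg_le_pi _⟩, ?_⟩, Circle.exp_arg (h 0)⟩
            rw [mem_ofPred_eq, hexp]; exact hh
          · rintro ⟨b, ⟨_, hb⟩, rfl⟩
            exact ⟨torusExp b, hb, rfl⟩
        rw [e]
        exact hcomp.isClosed
      rcases circle_subgroup_eq_top_or_isOfFinOrder (H.map pr) hclosed with htop | hfin
      -- When the projection is the whole circle, the element over -1 has order two, by injectivity
      -- of the projection.
      · have : Circle.exp Real.pi ∈ H.map pr := by rw [htop]; trivial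
        obtain ⟨h, hh, hpi⟩ := this
        have h2 : h ^ 2 = 1 := by
          apply hker _ (H.pow_mem hh 2)
          rw [map_pow, hpi, ← Circle.exp_nsmul, nsmul_eq_mul, Nat.cast_ofNat, Circle.exp_two_pi]
        refine ⟨h, hh, ?_, isOfFinOrder_iff_pow_eq_one.2 ⟨2, by norm_num, h2⟩⟩
        rintro rfl
        rw [map_one] at hpi
        obtain ⟨k, hk⟩ := Circle.exp_eq_one.1 hpi.symm
        have h3 : (1 : ℝ) = k * 2 := by
          have := Real.pi_pos
          have h4 : Real.pi * 1 = Real.pi * (k * 2) := by linarith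
          exact mul_left_cancel₀ this.ne' h4
        have h4 : (1 : ℤ) = k * 2 := by exact_mod_cast h3
        omega
      · obtain ⟨h, hh, hne1⟩ := H.bot_or_exists_ne_one.resolve_left hne
        refine ⟨h, hh, hne1, ?_⟩
        obtain ⟨k, hk, hk1⟩ := isOfFinOrder_iff_pow_eq_one.1 (hfin _ (Subgroup.mem_map_of_mem pr hh))
        rw [isOfFinOrder_iff_pow_eq_one]
        exact ⟨k, hk, hker _ (H.pow_mem hh k) (by rw [map_pow, hk1])⟩
    · have hcl : IsClosed {b : Fin m → ℝ | torusExp b ∈ H.comap ι} := by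
        have hcont : Continuous (fun b : Fin m → ℝ => (Fin.cons 0 b : Fin (m + 1) → ℝ)) := by
          refine continuous_pi fun j => ?_
          refine Fin.cases ?_ (fun j => ?_) j
          · simpa using continuous_const
          · simpa using continuous_apply j
        simp only [Subgroup.mem_comap, hιexp]
        exact hH.preimage hcont
      obtain ⟨g, hg, hg1, hgf⟩ := ih (H.comap ι) hcl hK
      exact ⟨ι g, hg, fun h => hg1 (hιinj g h), MonoidHom.isOfFinOrder ι hgf⟩

/-- For each exponent n > 0 there are finitely many solutions of g^n = 1, since every coordinate is
an n-th root of unity. Countability is what makes the Baire argument available. -/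
theorem countable_setOf_isOfFinOrder_torus (m : ℕ) :
    {g : Fin m → Circle | IsOfFinOrder g}.Countable := by
  have hc : ∀ n : ℕ, 0 < n → {z : Circle | z ^ n = 1}.Finite := fun n hn => by
    have h1 : {z : ℂ | z ^ n = 1}.Finite := by
      refine ((Polynomial.nthRoots n (1 : ℂ)).toFinset.finite_toSet).subset fun z hz => ?_
      simpa [Polynomial.mem_nthRoots hn] using hz
    refine (h1.preimage (f := fun z : Circle => (z : ℂ)) Circle.coe_injective.injOn).subset
      fun z hz => ?_
    have hz' : z ^ n = 1 := hz
    simp only [mem_preimage, mem_ofPred_eq]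
    rw [← Circle.coe_pow, hz', Circle.coe_one]
  have h2 : {g : Fin m → Circle | IsOfFinOrder g} ⊆
      ⋃ n : ℕ, {g : Fin m → Circle | 0 < n ∧ g ^ n = 1} := fun g hg => by
    obtain ⟨n, hn, h⟩ := isOfFinOrder_iff_pow_eq_one.1 hg
    exact mem_iUnion.2 ⟨n, hn, h⟩
  refine (countable_iUnion fun n => ?_).mono h2
  by_cases hn : 0 < n
  · have h3 : (Set.pi univ fun _ : Fin m => {z : Circle | z ^ n = 1}).Finite :=
      Set.Finite.pi fun _ => hc n hn
    refine h3.countable.mono fun g hg => ?_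
    rw [mem_univ_pi]
    exact fun j => congrFun hg.2 j
  · simp [hn]

end TorusSubgroups

/-! ### Density of the free locus -/

section FixedPoints

variable {m : ℕ} {M : Type*} [TopologicalSpace M]
  [ChartedSpace (EuclideanSpace ℝ (Fin (2 * m))) M] [MulAction (Fin m → Circle) M]
  [IsManifold (𝓡 (2 * m)) ∞ M] {Ω : TwoTensor (2 * m) M} {μ : M → Fin m → ℝ}

/-- At a limit of interior fixed points, a smooth map has, in the chart, strict derivative `1`. -/
theorem hasStrictFDerivAt_one_of_mem_closure {n : ℕ} {M : Type*} [TopologicalSpace M]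
    [ChartedSpace (EuclideanSpace ℝ (Fin n)) M] {f : M → M}
    (hf : ContMDiff (𝓡 n) (𝓡 n) ∞ f) {x : M} (hfx : f x = x)
    (hx : x ∈ closure (interior {y | f y = y})) :
    HasStrictFDerivAt (fun z => extChartAt (𝓡 n) x (f ((extChartAt (𝓡 n) x).symm z)))
      (1 : EuclideanSpace ℝ (Fin n) →L[ℝ] EuclideanSpace ℝ (Fin n)) (extChartAt (𝓡 n) x x) := by
  set φ := extChartAt (𝓡 n) x with hφ
  set G := fun z => φ (f (φ.symm z)) with hG
  have hGc : ContDiffAt ℝ ∞ G (φ x) := by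
    have h := (contMDiffAt_iff.1 (hf x)).2
    rw [hfx] at h
    simpa [Function.comp_def] using! h
  have hst := hGc.hasStrictFDerivAt (by simp)
  have hcont : ContinuousAt (fderiv ℝ G) (φ x) :=
    (hGc.fderiv_right (m := 0) (by simp)).continuousAt
  -- Near an interior fixed point the map is the identity, so its derivative is 1 there; continuity
  -- of the derivative carries this to the limit point x.
  have hone : fderiv ℝ G (φ x) = 1 := by
    have hcl : φ x ∈ closure {z | fderiv ℝ G z = 1} := by
      rw [mem_closure_iff_frequently] at hx ⊢
      have h1 : ∃ᶠ y in 𝓝 x, y ∈ interior {y | f y = y} ∧ y ∈ φ.source :=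
        hx.and_eventually (extChartAt_source_mem_nhds x)
      have h2 : ∃ᶠ y in 𝓝 x, fderiv ℝ G (φ y) = 1 := by
        refine h1.mono fun y ⟨hy, hys⟩ => ?_
        have h3 : G =ᶠ[𝓝 (φ y)] id := by
          have hc : ContinuousAt φ.symm (φ y) :=
            continuousAt_extChartAt_symm' hys
          have h4 : ∀ᶠ z in 𝓝 (φ y), φ.symm z ∈ interior {y | f y = y} := by
            apply hc.eventually_mem
            rw [φ.left_inv hys]
            exact isOpen_interior.mem_nhds hy
          filter_upwards [h4, extChartAt_target_mem_nhds' (φ.map_source hys)] with z hz hzt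
          have h5 : f (φ.symm z) = φ.symm z := interior_subset (s := {y | f y = y}) hz
          simp only [hG, h5, id]
          exact φ.right_inv hzt
        rw [h3.fderiv_eq, fderiv_id]
        rfl
      have hc := continuousAt_extChartAt (I := 𝓡 n) x
      exact hc.tendsto.frequently (p := fun z => fderiv ℝ G z = 1) h2
    have h6 := hcont.continuousWithinAt (s := {z | fderiv ℝ G z = 1})
    have h7 := h6.mem_closure hcl (t := {1}) fun z hz => hz
    simpa using h7
  rwa [hone] at hst

/-- A torus element of finite order that fixes an open set pointwise acts trivially. -/
theorem IsSymplecticToric.smul_eq_of_interior_nonempty [T2Space M] [ConnectedSpace M]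
    (hM : IsSymplecticToric Ω μ) {g : Fin m → Circle} (hg : IsOfFinOrder g)
    (hne : (interior {y : M | g • y = y}).Nonempty) (x : M) : g • x = x := by
  -- An open and closed nonempty subset of connected M is everything. Closedness is the content: the
  -- action is linearized near a limit point by averaging the chart over the powers of g.
  have hclosed : IsClosed (interior {y : M | g • y = y}) := by
    refine isClosed_of_closure_subset fun x hx => ?_
    have hFix : ∀ k : ℕ, IsClosed {y : M | g ^ k • y = y} := fun k =>
      isClosed_eq (hM.smooth_smul (g ^ k)).continuous continuous_id
    have hsub : ∀ k : ℕ, {y : M | g • y = y} ⊆ {y : M | g ^ k • y = y} := by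
      intro k y hy
      induction k with
      | zero => simp
      | succ k ih =>
        have hy' : g • y = y := hy
        have ih' : g ^ k • y = y := ih
        change g ^ (k + 1) • y = y
        rw [pow_succ, mul_smul, hy', ih']
    have hxk : ∀ k : ℕ, x ∈ closure (interior {y : M | g ^ k • y = y}) := fun k =>
      closure_mono (interior_mono (hsub k)) hx
    have hfx : ∀ k : ℕ, g ^ k • x = x := fun k =>
      (closure_minimal interior_subset (hFix k)) (hxk k)
    set φ := extChartAt (𝓡 (2 * m)) x with hφ
    obtain ⟨N, hN, hgN⟩ := isOfFinOrder_iff_pow_eq_one.1 hg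
    let E := EuclideanSpace ℝ (Fin (2 * m))
    -- The sum over the cyclic group is g-invariant. Its strict derivative at x is N times the
    -- identity, so it is injective near x; invariance then forces g • y = y for all y near x.
    let A : M → E := fun y => ∑ k ∈ Finset.range N, φ (g ^ k • y)
    have hAinv : ∀ y, A (g • y) = A y := by
      intro y
      have h1 : A (g • y) = ∑ k ∈ Finset.range N, φ (g ^ (k + 1) • y) := by
        refine Finset.sum_congr rfl fun k _ => ?_
        rw [smul_smul, ← pow_succ]
      have h2 := Finset.sum_range_succ' (fun k => φ (g ^ k • y)) N
      rw [Finset.sum_range_succ, hgN, pow_zero] at h2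
      rw [h1]
      exact (add_right_cancel h2).symm
    have hst : HasStrictFDerivAt (fun z => A (φ.symm z))
        (∑ k ∈ Finset.range N, (1 : E →L[ℝ] E)) (φ x) :=
      HasStrictFDerivAt.fun_sum fun k _ => hasStrictFDerivAt_one_of_mem_closure
        (hM.smooth_smul (g ^ k)) (hfx k) (hxk k)
    have hN0 : (N : ℝ) ≠ 0 := by exact_mod_cast hN.ne'
    let e : E ≃L[ℝ] E := ContinuousLinearEquiv.smulLeft (Units.mk0 (N : ℝ) hN0)
    have he : (∑ k ∈ Finset.range N, (1 : E →L[ℝ] E)) = (e : E →L[ℝ] E) := by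
      ext v
      simp [e, Finset.sum_const, Finset.card_range, ← Nat.cast_smul_eq_nsmul ℝ, Units.smul_def]
    rw [he] at hst
    obtain ⟨U, hU, hUi⟩ : ∃ U ∈ 𝓝 (φ x), InjOn (fun z => A (φ.symm z)) U := by
      refine ⟨(hst.toOpenPartialHomeomorph _).source, ?_, ?_⟩
      · exact (hst.toOpenPartialHomeomorph _).open_source.mem_nhds
          hst.mem_toOpenPartialHomeomorph_source
      · exact (hst.toOpenPartialHomeomorph _).injOn
    rw [mem_interior_iff_mem_nhds]
    have hc : ContinuousAt φ x := continuousAt_extChartAt x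
    have hgc : ContinuousAt (fun y : M => g • y) x := (hM.smooth_smul g).continuous.continuousAt
    have hgx : g • x = x := by simpa using hfx 1
    have hsrc : φ.source ∈ 𝓝 x := extChartAt_source_mem_nhds x
    have h1 : ∀ᶠ y in 𝓝 x, y ∈ φ.source ∧ φ y ∈ U := Filter.Eventually.and hsrc (hc.eventually_mem hU)
    have h2 : ∀ᶠ y in 𝓝 x, g • y ∈ φ.source ∧ φ (g • y) ∈ U := by
      have : Tendsto (fun y : M => g • y) (𝓝 x) (𝓝 x) := by simpa [ContinuousAt, hgx] using hgc
      exact this.eventually h1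
    filter_upwards [h1, h2] with y ⟨hy1, hy2⟩ ⟨hy3, hy4⟩
    have h3 := hUi hy4 hy2 (by
      simp only [φ.left_inv hy1, φ.left_inv hy3]
      exact hAinv y)
    exact φ.injOn hy3 hy1 h3
  have huniv := IsClopen.eq_univ ⟨hclosed, isOpen_interior⟩ hne
  have : x ∈ interior {y : M | g • y = y} := by rw [huniv]; trivial
  exact interior_subset (s := {y : M | g • y = y}) this

/-- The torus acts freely on a dense set. -/
theorem IsSymplecticToric.dense_freeLocus [T2Space M] [CompactSpace M] [ConnectedSpace M]
    (hM : IsSymplecticToric Ω μ) : Dense (freeLocus m M) := by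
  have hcount : {g : Fin m → Circle | IsOfFinOrder g ∧ g ≠ 1}.Countable :=
    (countable_setOf_isOfFinOrder_torus m).mono fun g hg => hg.1
  -- Baire for a countable intersection of open sets, each dense because an element fixing an open
  -- set would act trivially, against effectiveness. A point outside the free locus is fixed by one
  -- of these elements.
  have hd : Dense (⋂ g ∈ {g : Fin m → Circle | IsOfFinOrder g ∧ g ≠ 1}, {y : M | g • y = y}ᶜ) := by
    refine dense_biInter_of_isOpen (fun g _ => ?_) hcount fun g hg => ?_
    · exact (isClosed_eq (hM.smooth_smul g).continuous continuous_id).isOpen_compl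
    · rw [← interior_eq_empty_iff_dense_compl]
      by_contra hne
      exact hg.2 (hM.effective g fun x =>
        hM.smul_eq_of_interior_nonempty hg.1 (nonempty_iff_ne_empty.2 hne) x)
  refine hd.mono fun x hx => ?_
  by_contra hfree
  have hne : MulAction.stabilizer (Fin m → Circle) x ≠ ⊥ := by
    intro hbot
    refine hfree fun g hg => ?_
    have : g ∈ MulAction.stabilizer (Fin m → Circle) x := hg
    rwa [hbot, Subgroup.mem_bot] at this
  obtain ⟨g, hg, hg1, hgf⟩ := exists_isOfFinOrder_of_isClosed
    (MulAction.stabilizer (Fin m → Circle) x)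
    (isClosed_eq (hM.continuous_orbit x) continuous_const) hne
  exact (mem_iInter₂.1 hx g ⟨hgf, hg1⟩) hg

end FixedPoints

/-! ### Smoothness of endomorphism fields in chart coordinates -/

section SmoothEnd

variable {n : ℕ} {M : Type*} [TopologicalSpace M] [ChartedSpace (EuclideanSpace ℝ (Fin n)) M]
  [IsManifold (𝓡 n) ∞ M]

/-- An endomorphism of `T_y M` in the coordinates of the chart at `x`. -/
def coordEnd (x y : M) (A : TangentSpace (𝓡 n) y →L[ℝ] TangentSpace (𝓡 n) y) :
    EuclideanSpace ℝ (Fin n) →L[ℝ] EuclideanSpace ℝ (Fin n) :=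
  ContinuousLinearMap.inCoordinates (EuclideanSpace ℝ (Fin n)) (TangentSpace (𝓡 n))
    (EuclideanSpace ℝ (Fin n)) (TangentSpace (𝓡 n)) x y x y A

theorem mvfderiv_extChartAt_surjective {x y : M} (hy : y ∈ (extChartAt (𝓡 n) x).source) :
    Function.Surjective (mvfderiv (𝓡 n) (extChartAt (𝓡 n) x) y) :=
  (isInvertible_mfderiv_extChartAt hy).surjective

/-- The coordinate matrix is conjugation by the derivative of the chart. Since that derivative is
bijective, this identity determines the matrix and replaces all work with trivializations. -/
theorem coordEnd_apply {x y : M} (hy : y ∈ (extChartAt (𝓡 n) x).source)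
    (A : TangentSpace (𝓡 n) y →L[ℝ] TangentSpace (𝓡 n) y) (v : TangentSpace (𝓡 n) y) :
    coordEnd x y A (mvfderiv (𝓡 n) (extChartAt (𝓡 n) x) y v) =
      mvfderiv (𝓡 n) (extChartAt (𝓡 n) x) y (A v) := by
  have hb : y ∈ (trivializationAt (EuclideanSpace ℝ (Fin n)) (TangentSpace (𝓡 n)) x).baseSet := by
    rw [extChartAt_source] at hy
    simpa using hy
  have h : ∀ w : TangentSpace (𝓡 n) y, mvfderiv (𝓡 n) (extChartAt (𝓡 n) x) y w =
      (trivializationAt (EuclideanSpace ℝ (Fin n)) (TangentSpace (𝓡 n)) x).continuousLinearMapAt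
        ℝ y w := fun w => by
    rw [← trivializationAt_snd_eq_mvfderiv hy,
      Bundle.Trivialization.continuousLinearMapAt_apply_of_mem ℝ _ hb]
  rw [h, h]
  unfold coordEnd ContinuousLinearMap.inCoordinates
  rw [ContinuousLinearMap.comp_apply, ContinuousLinearMap.comp_apply,
    Bundle.Trivialization.symmL_continuousLinearMapAt _ hb]

theorem coordEnd_eq {x y : M} (hy : y ∈ (extChartAt (𝓡 n) x).source)
    {A : TangentSpace (𝓡 n) y →L[ℝ] TangentSpace (𝓡 n) y}
    {L : EuclideanSpace ℝ (Fin n) →L[ℝ] EuclideanSpace ℝ (Fin n)}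
    (h : ∀ v : TangentSpace (𝓡 n) y, L (mvfderiv (𝓡 n) (extChartAt (𝓡 n) x) y v) =
      mvfderiv (𝓡 n) (extChartAt (𝓡 n) x) y (A v)) : coordEnd x y A = L := by
  ext1 w
  obtain ⟨v, rfl⟩ := mvfderiv_extChartAt_surjective hy w
  rw [coordEnd_apply hy, h]

theorem SmoothEnd.contMDiffAt_coordEnd {A : EndField n M} (hA : SmoothEnd A) (x : M) :
    ContMDiffAt (𝓡 n) 𝓘(ℝ, EuclideanSpace ℝ (Fin n) →L[ℝ] EuclideanSpace ℝ (Fin n)) ∞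
      (fun y => coordEnd x y (A y)) x := by
  unfold SmoothEnd at hA
  exact ((contMDiffAt_hom_bundle _).1 (hA x)).2

theorem smoothEnd_of_coordEnd {A : EndField n M}
    (hA : ∀ x, ContMDiffAt (𝓡 n)
      𝓘(ℝ, EuclideanSpace ℝ (Fin n) →L[ℝ] EuclideanSpace ℝ (Fin n)) ∞
      (fun y => coordEnd x y (A y)) x) : SmoothEnd A := by
  unfold SmoothEnd
  exact fun x => (contMDiffAt_hom_bundle _).2 ⟨contMDiffAt_id, hA x⟩

theorem smoothEndFamilyOn_of_coordEnd {A : ℝ → EndField n M}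
    (hA : ∀ t x, ContMDiffAt (𝓘(ℝ, ℝ).prod (𝓡 n))
      𝓘(ℝ, EuclideanSpace ℝ (Fin n) →L[ℝ] EuclideanSpace ℝ (Fin n)) ∞
      (fun p : ℝ × M => coordEnd x p.2 (A p.1 p.2)) (t, x)) (T : Set ℝ) : SmoothEndFamilyOn A T := by
  unfold SmoothEndFamilyOn
  rintro ⟨t, x⟩ _
  refine ContMDiffAt.contMDiffWithinAt ?_
  exact (contMDiffAt_hom_bundle _).2 ⟨contMDiffAt_snd, hA t x⟩

theorem SmoothEndFamilyOn.smoothEnd {A : ℝ → EndField n M} (hA : SmoothEndFamilyOn A univ) (t : ℝ) :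
    SmoothEnd (A t) := by
  unfold SmoothEndFamilyOn at hA
  unfold SmoothEnd
  rw [univ_prod_univ, contMDiffOn_univ] at hA
  exact hA.comp (contMDiff_const.prodMk contMDiff_id)

/-- A function times a vector field is a smooth section of `T* ⊗ T`. -/
theorem smoothEnd_sum_smulRight {ι κ : Type*} [Fintype ι] [Fintype κ] {f : κ → M → ℝ}
    (hf : ∀ j, ContMDiff (𝓡 n) 𝓘(ℝ, ℝ) ∞ (f j)) {X : ι → RField n M} (hX : ∀ i, SmoothField (X i))
    (c : ι → κ → ℝ) :
    SmoothEnd (fun x => ∑ i, ∑ j, c i j • (mvfderiv (𝓡 n) (f j) x).smulRight (X i x)) := by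
  refine smoothEnd_of_coordEnd fun x => ?_
  have h1 : ∀ j, ContMDiffAt (𝓡 n) 𝓘(ℝ, EuclideanSpace ℝ (Fin n) →L[ℝ] ℝ) ∞
      (fun y => fderiv ℝ (f j ∘ (extChartAt (𝓡 n) x).symm) (extChartAt (𝓡 n) x y)) x := fun j =>
    ((contDiffAt_comp_extChartAt_symm_top (hf j x)).fderiv_right
      (m := ∞) (by simp)).contMDiffAt.comp x contMDiffAt_extChartAt
  have h2 : ∀ i, ContMDiffAt (𝓡 n) 𝓘(ℝ, EuclideanSpace ℝ (Fin n)) ∞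
      (fun y => mvfderiv (𝓡 n) (extChartAt (𝓡 n) x) y (X i y)) x := fun i =>
    smoothFieldAt_iff.1 ((hX i).smoothFieldAt x)
  have h3 : ContDiff ℝ ∞ (fun p : (κ → EuclideanSpace ℝ (Fin n) →L[ℝ] ℝ) ×
      (ι → EuclideanSpace ℝ (Fin n)) => ∑ i, ∑ j, c i j • (p.1 j).smulRight (p.2 i)) := by
    refine ContDiff.sum fun i _ => ContDiff.sum fun j _ => ContDiff.const_smul _ ?_
    exact ContDiff.smulRight (by fun_prop) (by fun_prop)
  have h4 : ContMDiffAt (𝓡 n) 𝓘(ℝ, (κ → EuclideanSpace ℝ (Fin n) →L[ℝ] ℝ) ×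
      (ι → EuclideanSpace ℝ (Fin n))) ∞ (fun y =>
        ((fun j => fderiv ℝ (f j ∘ (extChartAt (𝓡 n) x).symm) (extChartAt (𝓡 n) x y)),
        (fun i => mvfderiv (𝓡 n) (extChartAt (𝓡 n) x) y (X i y)))) x :=
    (contMDiffAt_pi_space.2 h1).prodMk_space (contMDiffAt_pi_space.2 h2)
  refine (h3.contMDiff.contMDiffAt.comp x h4).congr_of_eventuallyEq ?_
  filter_upwards [extChartAt_source_mem_nhds (I := 𝓡 n) x] with y hy
  refine coordEnd_eq hy fun v => ?_
  simp only [Function.comp_apply, sum_apply, smul_apply,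
    ContinuousLinearMap.smulRight_apply, map_sum, map_smul]
  refine Finset.sum_congr rfl fun i _ => Finset.sum_congr rfl fun j _ => ?_
  rw [mvfderiv_eq_fderiv_mvfderiv hy ((hf j).mdifferentiable (by simp) y) v]

/-- Smoothness in `(t, x)` of the conjugates of `J` by `1 - t J B`. -/
theorem smoothEndFamilyOn_of_conj {J B : EndField n M} (hJ : SmoothEnd J) (hB : SmoothEnd B)
    (hinj : ∀ (t : ℝ) x v, v - t • J x (B x v) = 0 → v = 0) {A : ℝ → EndField n M}
    (hA : ∀ t x v, A t x v - t • J x (B x (A t x v)) = J x (v - t • J x (B x v))) (T : Set ℝ) :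
    SmoothEndFamilyOn A T := by
  refine smoothEndFamilyOn_of_coordEnd (fun t x => ?_) T
  let E := EuclideanSpace ℝ (Fin n)
  have hsnd : ContMDiffAt (𝓘(ℝ, ℝ).prod (𝓡 n)) (𝓡 n) ∞ (Prod.snd : ℝ × M → M) (t, x) :=
    contMDiffAt_snd
  have hcJ : ContMDiffAt (𝓘(ℝ, ℝ).prod (𝓡 n)) 𝓘(ℝ, E →L[ℝ] E) ∞
      (fun p : ℝ × M => coordEnd x p.2 (J p.2)) (t, x) :=
    ContMDiffAt.comp (t, x) (hJ.contMDiffAt_coordEnd x) hsnd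
  have hcB : ContMDiffAt (𝓘(ℝ, ℝ).prod (𝓡 n)) 𝓘(ℝ, E →L[ℝ] E) ∞
      (fun p : ℝ × M => coordEnd x p.2 (B p.2)) (t, x) :=
    ContMDiffAt.comp (t, x) (hB.contMDiffAt_coordEnd x) hsnd
  let Φ : ℝ × M → E →L[ℝ] E := fun p =>
    1 - p.1 • (coordEnd x p.2 (J p.2)).comp (coordEnd x p.2 (B p.2))
  have hΦ : ContMDiffAt (𝓘(ℝ, ℝ).prod (𝓡 n)) 𝓘(ℝ, E →L[ℝ] E) ∞ Φ (t, x) :=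
    contMDiffAt_const.sub (contMDiffAt_fst.smul (hcJ.clm_comp hcB))
  have hΦv : ∀ p : ℝ × M, p.2 ∈ (extChartAt (𝓡 n) x).source → ∀ v,
      Φ p (mvfderiv (𝓡 n) (extChartAt (𝓡 n) x) p.2 v) =
        mvfderiv (𝓡 n) (extChartAt (𝓡 n) x) p.2 (v - p.1 • J p.2 (B p.2 v)) := by
    intro p hp v
    simp only [Φ, sub_apply, one_apply_eq_self,
      smul_apply, ContinuousLinearMap.comp_apply, coordEnd_apply hp, map_sub,
      map_smul]
  -- In finite dimension injectivity suffices; inversion is smooth at units, so the conjugate is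
  -- smooth in (t, x).
  have hunit : ∀ p : ℝ × M, p.2 ∈ (extChartAt (𝓡 n) x).source → IsUnit (Φ p) := by
    intro p hp
    rw [ContinuousLinearMap.isUnit_iff_bijective]
    have hi : Function.Injective (Φ p) := by
      rw [injective_iff_map_eq_zero]
      intro w hw
      obtain ⟨v, rfl⟩ := mvfderiv_extChartAt_surjective hp w
      rw [hΦv p hp] at hw
      have := mvfderiv_extChartAt_injective hp (hw.trans (map_zero _).symm)
      rw [hinj _ _ _ this, map_zero]
    exact ⟨hi, (LinearMap.injective_iff_surjective (f := (Φ p).toLinearMap)).1 hi⟩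
  have hx : x ∈ (extChartAt (𝓡 n) x).source := mem_extChartAt_source x
  have hinvΦ : ContMDiffAt (𝓘(ℝ, ℝ).prod (𝓡 n)) 𝓘(ℝ, E →L[ℝ] E) ∞
      (fun p => Ring.inverse (Φ p)) (t, x) := by
    obtain ⟨u, hu⟩ := hunit (t, x) hx
    have h := contDiffAt_ringInverse ℝ (n := ∞) u
    rw [hu] at h
    exact ContMDiffAt.comp (I' := 𝓘(ℝ, E →L[ℝ] E)) (t, x) h.contMDiffAt hΦ
  refine (hinvΦ.clm_comp (hcJ.clm_comp hΦ)).congr_of_eventuallyEq ?_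
  filter_upwards [continuousAt_snd.eventually_mem (x := (t, x)) (extChartAt_source_mem_nhds (I := 𝓡 n) x)] with p hp
  refine coordEnd_eq hp fun v => ?_
  rw [ContinuousLinearMap.comp_apply, ContinuousLinearMap.comp_apply, hΦv p hp,
    coordEnd_apply hp, ← hA, ← hΦv p hp]
  change (Ring.inverse (Φ p) * Φ p) _ = _
  rw [Ring.inverse_mul_cancel _ (hunit p hp)]
  rfl

end SmoothEnd

/-! ### Closed coframes and the Nijenhuis tensor -/

section Frames

variable {n : ℕ} {M : Type*} [TopologicalSpace M] [ChartedSpace (EuclideanSpace ℝ (Fin n)) M]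
  [IsManifold (𝓡 n) ∞ M]
  {F : Type*} [NormedAddCommGroup F] [NormedSpace ℝ F]

theorem mvfderiv_congr {f g : M → F} {x : M} (h : f =ᶠ[𝓝 x] g) :
    mvfderiv (𝓡 n) f x = mvfderiv (𝓡 n) g x := by
  ext1 v
  have h' := h.mfderiv_eq (I := 𝓡 n) (I' := 𝓘(ℝ, F))
  exact congrArg (fun L : EuclideanSpace ℝ (Fin n) →L[ℝ] F => L v) h'

theorem mvfderiv_neg_apply (f : M → F) (x : M) (v : TangentSpace (𝓡 n) x) :
    mvfderiv (𝓡 n) (fun y => -f y) x v = -mvfderiv (𝓡 n) f x v := by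
  rw [mvfderiv_fun_neg]; rfl

/-- Leibniz rule for the bracket with a linear combination of vector fields. -/
theorem bracket_sum_smul_right {ι : Type*} [Fintype ι] {X : RField n M} {e : ι → RField n M}
    {f : ι → M → ℝ} {x : M} (hf : ∀ i, MDifferentiableAt (𝓡 n) 𝓘(ℝ, ℝ) (f i) x)
    (he : ∀ i, MDiffField (e i) x) :
    bracket X (fun y => ∑ i, f i y • e i y) x =
      ∑ i, (mvfderiv (𝓡 n) (f i) x (X x) • e i x + f i x • bracket X (e i) x) := by
  classical
  have : IsManifold (𝓡 n) 2 M := IsManifold.of_le (m := 2) (n := ∞) (by norm_cast)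
  have : IsManifold (𝓡 n) (minSmoothness ℝ 2) M := by
    rw [minSmoothness_of_isRCLikeNormedField]; infer_instance
  have hfe : ∀ i, MDiffField (f i • e i) x := fun i =>
    MDifferentiableAt.smul_section (hf i) (he i)
  have key : ∀ s : Finset ι, MDiffField (fun y => ∑ i ∈ s, f i y • e i y) x ∧
      bracket X (fun y => ∑ i ∈ s, f i y • e i y) x =
      ∑ i ∈ s, (mvfderiv (𝓡 n) (f i) x (X x) • e i x + f i x • bracket X (e i) x) := by
    intro s
    induction s using Finset.induction_on with
    | empty =>
      simp only [Finset.sum_empty]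
      refine ⟨?_, ?_⟩
      · exact (SmoothField.zero.smoothFieldAt x).mdiffField
      · have := VectorField.mlieBracket_zero_right (I := 𝓡 n) (W := X)
        exact congrFun this x
    | insert a s ha ih =>
      have e1 : (fun y => ∑ i ∈ insert a s, f i y • e i y) =
          f a • e a + fun y => ∑ i ∈ s, f i y • e i y := by
        funext y
        rw [Finset.sum_insert ha]; rfl
      rw [e1]
      refine ⟨mdifferentiableAt_add_section (hfe a) ih.1, ?_⟩
      rw [Finset.sum_insert ha, ← ih.2]
      unfold bracket
      rw [VectorField.mlieBracket_add_right (hfe a) ih.1,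
        VectorField.mlieBracket_smul_right (hf a) (he a)]
  exact (key Finset.univ).2

theorem bracket_swap (X Y : RField n M) (x : M) : bracket X Y x = -bracket Y X x :=
  VectorField.mlieBracket_swap_apply

theorem bracket_congr_right {X Y Y' : RField n M} {x : M} (h : ∀ᶠ y in 𝓝 x, Y y = Y' y) :
    bracket X Y x = bracket X Y' x :=
  Filter.EventuallyEq.mlieBracket_vectorField_eq (EventuallyEq.refl _ _) h

/-- Fields of 1-forms. -/
abbrev FormField (n : ℕ) (M : Type*) [TopologicalSpace M]
    [ChartedSpace (EuclideanSpace ℝ (Fin n)) M] := (y : M) → (TangentSpace (𝓡 n) y →ₗ[ℝ] ℝ)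

/-- A 1-form that is differentiable and closed at `x`, in terms of its values on vector fields. -/
structure IsClosedAt (α : FormField n M) (x : M) : Prop where
  mdiff : ∀ X : RField n M, SmoothField X →
    MDifferentiableAt (𝓡 n) 𝓘(ℝ, ℝ) (fun y => α y (X y)) x
  closed : ∀ X Y : RField n M, SmoothField X → SmoothField Y → α x (bracket X Y x) =
    mvfderiv (𝓡 n) (fun y => α y (Y y)) x (X x) - mvfderiv (𝓡 n) (fun y => α y (X y)) x (Y x)

theorem IsClosedAt.smul {α : FormField n M} {x : M} (hα : IsClosedAt α x) (c : ℝ) :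
    IsClosedAt (fun y => c • α y) x where
  mdiff X hX := (hα.mdiff X hX).const_smul c
  closed X Y hX hY := by
    have h : ∀ Z : RField n M, SmoothField Z → mvfderiv (𝓡 n) (fun y => (c • α y) (Z y)) x =
        c • mvfderiv (𝓡 n) (fun y => α y (Z y)) x := fun Z hZ => by
      have h1 := mvfderiv_smul (𝕜 := ℝ) (I := 𝓡 n) (x := x) (a := fun _ : M => c)
        mdifferentiableAt_const (hα.mdiff Z hZ)
      rw [mvfderiv_const] at h1
      ext1 v
      have h2 := congrArg (fun L : TangentSpace (𝓡 n) x →L[ℝ] ℝ => L v) h1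
      simpa using! h2
    rw [h Y hY, h X hX, LinearMap.smul_apply, hα.closed X Y hX hY]
    simp [mul_sub]

theorem IsClosedAt.add {α β : FormField n M} {x : M} (hα : IsClosedAt α x) (hβ : IsClosedAt β x) :
    IsClosedAt (fun y => α y + β y) x where
  mdiff X hX := (hα.mdiff X hX).add (hβ.mdiff X hX)
  closed X Y hX hY := by
    have h : ∀ Z : RField n M, SmoothField Z → mvfderiv (𝓡 n) (fun y => (α y + β y) (Z y)) x =
        mvfderiv (𝓡 n) (fun y => α y (Z y)) x + mvfderiv (𝓡 n) (fun y => β y (Z y)) x :=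
      fun Z hZ => mvfderiv_fun_add (hα.mdiff Z hZ) (hβ.mdiff Z hZ)
    rw [h Y hY, h X hX, LinearMap.add_apply, hα.closed X Y hX hY, hβ.closed X Y hX hY]
    simp only [add_apply]
    ring

theorem IsClosedAt.zero (x : M) : IsClosedAt (fun y => (0 : TangentSpace (𝓡 n) y →ₗ[ℝ] ℝ)) x where
  mdiff _ _ := mdifferentiableAt_const
  closed X Y _ _ := by
    simp only [LinearMap.zero_apply]
    rw [mvfderiv_const]
    simp

theorem IsClosedAt.sum {ι : Type*} (s : Finset ι) {α : ι → FormField n M} {x : M}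
    (hα : ∀ i, IsClosedAt (α i) x) : IsClosedAt (fun y => ∑ i ∈ s, α i y) x := by
  classical
  induction s using Finset.induction_on with
  | empty => simpa using IsClosedAt.zero x
  | insert a s ha ih =>
    have : (fun y => ∑ i ∈ insert a s, α i y) = fun y => α a y + ∑ i ∈ s, α i y := by
      funext y; rw [Finset.sum_insert ha]
    rw [this]
    exact (hα a).add ih

theorem isClosedAt_mvfderiv {f : M → ℝ} {x : M} (hf : ContMDiff (𝓡 n) 𝓘(ℝ, ℝ) ∞ f) :
    IsClosedAt (fun y => (mvfderiv (𝓡 n) f y).toLinearMap) x where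
  mdiff X hX := (hX.contMDiff_mvfderiv hf).mdifferentiable (by simp) x
  closed X Y hX hY := mvfderiv_bracket ((hf x).of_le (by norm_cast))
    (hX.smoothFieldAt x).mdiffField (hY.smoothFieldAt x).mdiffField

/-- The dual coframe of a commuting frame is closed. -/
theorem exists_closed_coframe {ι : Type*} [Fintype ι] [DecidableEq ι] {e : ι → RField n M}
    (he : ∀ i, SmoothField (e i)) (hcomm : ∀ i j x, bracket (e i) (e j) x = 0) {x : M}
    (hli : LinearIndependent ℝ (fun i => e i x)) (hcard : Fintype.card ι = n) :
    ∃ θ : ι → FormField n M, (∀ i, IsClosedAt (θ i) x) ∧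
      (∀ᶠ y in 𝓝 x, (∀ v : TangentSpace (𝓡 n) y, v = ∑ i, θ i y v • e i y) ∧
        ∀ i j, θ i y (e j y) = if i = j then 1 else 0) := by
  let E := EuclideanSpace ℝ (Fin n)
  let φ := extChartAt (𝓡 n) x
  let w : ι → M → E := fun i y => mvfderiv (𝓡 n) φ y (e i y)
  let P : (ι → E) → ((ι → ℝ) →L[ℝ] E) := fun u =>
    ∑ i, (ContinuousLinearMap.proj i : (ι → ℝ) →L[ℝ] ℝ).smulRight (u i)
  let L : M → ((ι → ℝ) →L[ℝ] E) := fun y => P (fun i => w i y)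
  have hLapp : ∀ y c, L y c = mvfderiv (𝓡 n) φ y (∑ i, c i • e i y) := fun y c => by
    simp only [L, P, w, sum_apply, ContinuousLinearMap.smulRight_apply,
      ContinuousLinearMap.proj_apply, map_sum, map_smul]
  have hw : ∀ i, ContMDiffAt (𝓡 n) 𝓘(ℝ, E) ∞ (w i) x := fun i =>
    smoothFieldAt_iff.1 ((he i).smoothFieldAt x)
  have hP : ContDiff ℝ ∞ P := by
    refine ContDiff.sum fun i _ => ?_
    exact ContDiff.smulRight contDiff_const (contDiff_apply ℝ E i)
  have hL : ContMDiffAt (𝓡 n) 𝓘(ℝ, (ι → ℝ) →L[ℝ] E) ∞ L x :=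
    hP.contMDiff.contMDiffAt.comp x (contMDiffAt_pi_space.2 hw)
  have hinj : Function.Injective (L x) := by
    rw [injective_iff_map_eq_zero]
    intro c hc
    rw [hLapp, mvfderiv_extChartAt] at hc
    funext i
    exact Fintype.linearIndependent_iff.1 hli c hc i
  -- Linear independence at x and the dimension count make the frame matrix invertible at x, hence
  -- nearby. The coframe is the inverse matrix, smooth because inversion is.
  let e₀ : (ι → ℝ) ≃L[ℝ] E := LinearEquiv.toContinuousLinearEquiv
    (LinearEquiv.ofInjectiveOfFinrankEq (L x).toLinearMap hinj (by simp [E, hcard]))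
  have he₀ : (e₀ : (ι → ℝ) →L[ℝ] E) = L x := by ext; rfl
  have hinv : ContMDiffAt (𝓡 n) 𝓘(ℝ, E →L[ℝ] (ι → ℝ)) ∞
      (fun y => ContinuousLinearMap.inverse (L y)) x := by
    have h := contDiffAt_map_inverse (𝕜 := ℝ) (n := ∞) e₀
    rw [he₀] at h
    exact ContMDiffAt.comp (I' := 𝓘(ℝ, (ι → ℝ) →L[ℝ] E)) x h.contMDiffAt hL
  have hLinv : ∀ᶠ y in 𝓝 x, (L y).IsInvertible := by
    have h := ContinuousLinearEquiv.nhds e₀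
    rw [he₀] at h
    exact hL.continuousAt.eventually_mem h
  let θ : ι → FormField n M := fun i y =>
    (LinearMap.proj i : (ι → ℝ) →ₗ[ℝ] ℝ) ∘ₗ (L y).inverse.toLinearMap ∘ₗ
      (mvfderiv (𝓡 n) φ y).toLinearMap
  have hfr : ∀ᶠ y in 𝓝 x, (∀ v : TangentSpace (𝓡 n) y, v = ∑ i, θ i y v • e i y) ∧
        ∀ i j, θ i y (e j y) = if i = j then 1 else 0 := by
    filter_upwards [hLinv, extChartAt_source_mem_nhds (I := 𝓡 n) x] with y hy hys
    have h1 : ∀ v : TangentSpace (𝓡 n) y, v = ∑ i, θ i y v • e i y := by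
      intro v
      apply mvfderiv_extChartAt_injective hys
      have h2 := hLapp y (fun i => θ i y v)
      rw [← h2]
      exact (hy.self_apply_inverse _).symm
    refine ⟨h1, fun i j => ?_⟩
    have h3 : (L y).inverse (mvfderiv (𝓡 n) φ y (e j y)) = Pi.single j 1 := by
      rw [hy.inverse_apply_eq, hLapp]
      congr 1
      simp [Pi.single_apply, ite_smul]
    change (L y).inverse (mvfderiv (𝓡 n) φ y (e j y)) i = _
    rw [h3, Pi.single_apply]
  have hdiff : ∀ i, ∀ X : RField n M, SmoothField X →
      MDifferentiableAt (𝓡 n) 𝓘(ℝ, ℝ) (fun y => θ i y (X y)) x := by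
    intro i X hX
    have h1 := hinv.clm_apply (smoothFieldAt_iff.1 (hX.smoothFieldAt x))
    have h2 := contMDiffAt_pi_space.1 h1 i
    exact h2.mdifferentiableAt (by simp)
  have hemd : ∀ i, MDiffField (e i) x := fun i => ((he i).smoothFieldAt x).mdiffField
  have hleft : ∀ X : RField n M, SmoothField X → ∀ j, bracket X (e j) x =
      -∑ i, mvfderiv (𝓡 n) (fun y => θ i y (X y)) x (e j x) • e i x := by
    intro X hX j
    rw [bracket_swap, bracket_congr_right (Y' := fun y => ∑ i, θ i y (X y) • e i y)
      (hfr.mono fun y hy => hy.1 _), bracket_sum_smul_right (fun i => hdiff i X hX) hemd]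
    simp [hcomm]
  refine ⟨θ, fun k => ⟨hdiff k, fun X Y hX hY => ?_⟩, hfr⟩
  -- Brackets of frame fields vanish, so the Leibniz rule leaves only derivatives of coefficients;
  -- the i-th coefficient is exactly the closedness formula for θ i.
  have hb : bracket X Y x = ∑ i, (mvfderiv (𝓡 n) (fun y => θ i y (Y y)) x (X x)
      - mvfderiv (𝓡 n) (fun y => θ i y (X y)) x (Y x)) • e i x := by
    rw [bracket_congr_right (Y' := fun y => ∑ i, θ i y (Y y) • e i y)
      (hfr.mono fun y hy => hy.1 _), bracket_sum_smul_right (fun i => hdiff i Y hY) hemd]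
    simp only [hleft X hX]
    have hY' := hfr.self_of_nhds.1 (Y x)
    have h4 : ∀ i, mvfderiv (𝓡 n) (fun y => θ i y (X y)) x (Y x) =
        ∑ j, θ j x (Y x) * mvfderiv (𝓡 n) (fun y => θ i y (X y)) x (e j x) := fun i => by
      conv_lhs => rw [hY']
      simp only [map_sum, map_smul, smul_eq_mul]
    simp only [h4, sub_smul, Finset.sum_add_distrib, Finset.sum_sub_distrib, Finset.smul_sum,
      smul_neg, Finset.sum_neg_distrib, Finset.sum_smul, mul_smul, ← sub_eq_add_neg]
    congr 1
    exact Finset.sum_comm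
  rw [hb, map_sum]
  simp only [map_smul, hfr.self_of_nhds.2, smul_eq_mul, mul_ite, mul_one, mul_zero,
    Finset.sum_ite_eq, Finset.mem_univ, if_true]

/-- If closed 1-forms `α i`, `β i` separate tangent vectors and `α i ∘ A = -β i`,
`β i ∘ A = α i`, then the Nijenhuis tensor of `A` vanishes. -/
theorem nijenhuis_eq_zero_of_closed {ι : Type*} {A : EndField n M} (hA : SmoothEnd A) {x : M}
    {α β : ι → FormField n M} (hα : ∀ i, IsClosedAt (α i) x) (hβ : ∀ i, IsClosedAt (β i) x)
    (hαβ : ∀ᶠ y in 𝓝 x, ∀ i v, α i y (A y v) = -β i y v ∧ β i y (A y v) = α i y v)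
    (hsep : ∀ v, (∀ i, α i x v = 0 ∧ β i x v = 0) → v = 0) {X Y : RField n M}
    (hX : SmoothField X) (hY : SmoothField Y) :
    bracket (A.app X) (A.app Y) x - A x (bracket (A.app X) Y x) - A x (bracket X (A.app Y) x)
      - bracket X Y x = 0 := by
  have hAX := hX.app hA
  have hAY := hY.app hA
  have d1 : ∀ i (Z : RField n M), mvfderiv (𝓡 n) (fun y => α i y (A.app Z y)) x =
      mvfderiv (𝓡 n) (fun y => -β i y (Z y)) x := fun i Z =>
    mvfderiv_congr (hαβ.mono fun y hy => (hy i (Z y)).1)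
  have d2 : ∀ i (Z : RField n M), mvfderiv (𝓡 n) (fun y => β i y (A.app Z y)) x =
      mvfderiv (𝓡 n) (fun y => α i y (Z y)) x := fun i Z =>
    mvfderiv_congr (hαβ.mono fun y hy => (hy i (Z y)).2)
  have h0 := hαβ.self_of_nhds
  -- It suffices to test with the α i and β i. Closedness turns each bracket into derivatives of
  -- functions, and α ∘ A = -β, β ∘ A = α make these cancel.
  refine hsep _ fun i => ⟨?_, ?_⟩
  · simp only [map_sub, (h0 i _).1, (hα i).closed _ _ hAX hAY, (hβ i).closed _ _ hAX hY,
      (hβ i).closed _ _ hX hAY, (hα i).closed _ _ hX hY, d1, d2, mvfderiv_neg_apply]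
    ring
  · simp only [map_sub, (h0 i _).2, (hβ i).closed _ _ hAX hAY, (hα i).closed _ _ hAX hY,
      (hα i).closed _ _ hX hAY, (hβ i).closed _ _ hX hY, d1, d2, mvfderiv_neg_apply]
    ring

end Frames

/-! ### Linear algebra of the conjugation by 1 - tJB -/

section LinearAlgebra

variable {V : Type*} [AddCommGroup V] [Module ℝ V] [TopologicalSpace V] [IsTopologicalAddGroup V]
  [ContinuousSMul ℝ V] [T2Space V] [FiniteDimensional ℝ V]

/-- A Kähler structure `(q, J)` on a vector space together with an endomorphism `B` of square zero
that is symmetric with respect to `q`. -/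
structure IsTwistData (q : V →L[ℝ] V →L[ℝ] ℝ) (J B : V →L[ℝ] V) : Prop where
  alt : ∀ v, q v v = 0
  sq : ∀ v, J (J v) = -v
  pos : ∀ v, v ≠ 0 → 0 < q v (J v)
  compatible : ∀ v w, q (J v) (J w) = q v w
  nilpotent : ∀ v, B (B v) = 0
  symm : ∀ v, q (B v) v = 0

/-- The endomorphism `(1 - tJB)⁻¹ J (1 - tJB)`. -/
def twist (J B : V →L[ℝ] V) (t : ℝ) : V →L[ℝ] V :=
  (ContinuousLinearMap.id ℝ V - t • J ∘L B).inverse ∘L J ∘L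
    (ContinuousLinearMap.id ℝ V - t • J ∘L B)

namespace IsTwistData

variable {q : V →L[ℝ] V →L[ℝ] ℝ} {J B : V →L[ℝ] V}

theorem swap (h : IsTwistData q J B) (v w : V) : q v w = -q w v := by
  have h1 := h.alt (v + w)
  simp only [map_add, add_apply, h.alt] at h1
  linarith

theorem adj (h : IsTwistData q J B) (v w : V) : q (B v) w = q v (B w) := by
  have h1 := h.symm (v + w)
  simp only [map_add, add_apply, h.symm] at h1
  rw [h.swap v (B w)]
  linarith

theorem J_adj (h : IsTwistData q J B) (v w : V) : q (J v) w = -q v (J w) := by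
  rw [← h.compatible v (J w), h.sq]; simp

/-- If v = tJBv then Jv = -tBv, so q(v, Jv) = -t q(v, Bv) = 0, and positivity forces v = 0. No
smallness of t is involved, so the twist is defined for every real t. -/
theorem zero_of_eq (h : IsTwistData q J B) {t : ℝ} {v : V} (hv : v - t • J (B v) = 0) :
    v = 0 := by
  by_contra hne
  have h1 := h.pos v hne
  have h2 : J v = -(t • B v) := by
    rw [sub_eq_zero] at hv
    conv_lhs => rw [hv]
    rw [map_smul, h.sq, smul_neg]
  rw [h2, map_neg, map_smul, ← h.adj, h.symm] at h1
  simp at h1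

theorem zero_of_eq' (h : IsTwistData q J B) {t : ℝ} {v : V} (hv : v + t • B (J v) = 0) :
    v = 0 := by
  have h1 : J v - (-t) • J (B (J v)) = 0 := by
    rw [← map_smul, ← map_sub]
    rw [neg_smul, sub_neg_eq_add, hv, map_zero]
  have h2 := h.zero_of_eq h1
  have h3 := h.sq v
  rw [h2, map_zero] at h3
  exact neg_eq_zero.1 h3.symm

/-- The map 1 + tBJ is the q-adjoint of 1 - tJB. Writing vectors in its range is the substitution
behind the adjoint and positivity computations. -/
theorem exists_adj_eq (h : IsTwistData q J B) (t : ℝ) (w : V) :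
    ∃ u, u + t • B (J u) = w := by
  let f : V →ₗ[ℝ] V := LinearMap.id + t • (B.toLinearMap ∘ₗ J.toLinearMap)
  have hf : Function.Injective f := by
    rw [injective_iff_map_eq_zero]
    exact fun v hv => h.zero_of_eq' hv
  exact (LinearMap.injective_iff_surjective.1 hf) w

/-- `ContinuousLinearMap.inverse` is zero on non-invertible maps, so only this fact makes `twist` a
genuine conjugation. -/
theorem isInvertible (h : IsTwistData q J B) (t : ℝ) :
    (ContinuousLinearMap.id ℝ V - t • J ∘L B).IsInvertible := by
  set f := ContinuousLinearMap.id ℝ V - t • J ∘L B with hfdef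
  have hf : Function.Injective f.toLinearMap := by
    rw [injective_iff_map_eq_zero]
    exact fun v hv => h.zero_of_eq hv
  refine ⟨LinearEquiv.toContinuousLinearEquiv (LinearEquiv.ofInjectiveEndo f.toLinearMap hf), ?_⟩
  ext; rfl

theorem twist_spec (h : IsTwistData q J B) (t : ℝ) (v : V) :
    twist J B t v - t • J (B (twist J B t v)) = J (v - t • J (B v)) :=
  (h.isInvertible t).self_apply_inverse _

theorem inj (h : IsTwistData q J B) (t : ℝ) {v w : V}
    (hvw : v - t • J (B v) = w - t • J (B w)) : v = w := by
  rw [← sub_eq_zero]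
  apply h.zero_of_eq (t := t)
  rw [map_sub, map_sub, smul_sub, ← sub_eq_zero.2 hvw]
  abel

theorem twist_eq (h : IsTwistData q J B) {t : ℝ} {v w : V}
    (hw : w - t • J (B w) = J (v - t • J (B v))) : twist J B t v = w :=
  h.inj t ((h.twist_spec t v).trans hw.symm)

theorem twist_sq (h : IsTwistData q J B) (t : ℝ) (v : V) :
    twist J B t (twist J B t v) = -v := by
  apply h.twist_eq
  rw [h.twist_spec, h.sq, map_neg, map_neg, smul_neg, sub_neg_eq_add, neg_sub, neg_add_eq_sub]

theorem twist_zero (h : IsTwistData q J B) : twist J B 0 = J := by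
  ext v
  apply h.twist_eq
  simp

/-- The twist on the image of the symplectic adjoint of `1 - tJB`. -/
theorem twist_adj (h : IsTwistData q J B) (t : ℝ) (u : V) :
    twist J B (-t) (u + t • B (J u)) = J u - t • B u := by
  apply h.twist_eq
  simp only [map_add, map_smul, map_sub, h.sq, h.nilpotent, smul_neg, neg_smul, smul_zero,
    map_zero, sub_neg_eq_add, add_zero, sub_zero]
  abel

/-- The adjoint of the twist is -(1 + tBJ) J (1 + tBJ)⁻¹. Because B² = 0, `twist_adj` identifies
this with minus the twist of parameter -t. -/
theorem twist_adjoint (h : IsTwistData q J B) (t : ℝ) (v w : V) :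
    q (twist J B t v) w = -q v (twist J B (-t) w) := by
  obtain ⟨u, rfl⟩ := h.exists_adj_eq t w
  rw [h.twist_adj]
  have key : ∀ a b : V, q (a - t • J (B a)) b = q a (b + t • B (J b)) := fun a b => by
    simp only [map_sub, map_add, map_smul, sub_apply, smul_apply, h.J_adj, h.adj]
    simp
  rw [← key, h.twist_spec, h.J_adj, key]
  simp [h.sq, sub_eq_add_neg]

/-- With v = u + tBJu, moving the adjoint across gives q(u, J(1 - tJB)v) = q(u, Ju); the terms with
Bu and JBJu vanish by symmetry of B and the quadratic term by B² = 0. -/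
theorem twist_pos (h : IsTwistData q J B) (t : ℝ) {v : V} (hv : v ≠ 0) :
    0 < q v (twist J B t v) := by
  obtain ⟨u, rfl⟩ := h.exists_adj_eq t v
  have hu : u ≠ 0 := by rintro rfl; simp at hv
  have key : ∀ a b : V, q (a + t • B (J a)) b = q a (b - t • J (B b)) := fun a b => by
    simp only [map_sub, map_add, map_smul, add_apply, smul_apply, h.J_adj, h.adj]
    simp [sub_eq_add_neg]
  rw [key, h.twist_spec]
  have e1 : q u (J (B (J u))) = 0 := by
    have := h.J_adj u (B (J u))
    rw [← h.adj, h.symm] at this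
    linarith
  have e2 : q u (B u) = 0 := by rw [← h.adj, h.symm]
  have := h.pos u hu
  simp only [map_add, map_sub, map_smul, h.sq, h.nilpotent, map_neg, smul_zero, map_zero, e1, e2]
  simpa [e1, e2] using this

end IsTwistData

end LinearAlgebra

instance {n : ℕ} {M : Type*} [TopologicalSpace M] [ChartedSpace (EuclideanSpace ℝ (Fin n)) M]
    (x : M) : T2Space (TangentSpace (𝓡 n) x) :=
  inferInstanceAs (T2Space (EuclideanSpace ℝ (Fin n)))

instance {n : ℕ} {M : Type*} [TopologicalSpace M] [ChartedSpace (EuclideanSpace ℝ (Fin n)) M]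
    (x : M) : FiniteDimensional ℝ (TangentSpace (𝓡 n) x) :=
  inferInstanceAs (FiniteDimensional ℝ (EuclideanSpace ℝ (Fin n)))

/-! ### Propagation of identities from a dense set -/

section Density

variable {n : ℕ} {M : Type*} [TopologicalSpace M] [ChartedSpace (EuclideanSpace ℝ (Fin n)) M]
  [IsManifold (𝓡 n) ∞ M]

theorem eq_zero_of_dense_of_continuousAt {F : Type*} [TopologicalSpace F] [T2Space F] [Zero F]
    {s : Set M} (hs : Dense s) {f : M → F} {x : M} (hf : ContinuousAt f x) (h : ∀ y ∈ s, f y = 0) :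
    f x = 0 := by
  have : (𝓝[s] x).NeBot := mem_closure_iff_nhdsWithin_neBot.1 (hs x)
  have h1 : Tendsto f (𝓝[s] x) (𝓝 (f x)) := hf.tendsto.mono_left nhdsWithin_le_nhds
  refine tendsto_nhds_unique h1 (tendsto_const_nhds.congr' ?_)
  filter_upwards [self_mem_nhdsWithin] with y hy using (h y hy).symm

theorem SmoothField.eq_zero_of_dense {s : Set M} (hs : Dense s) {X : RField n M}
    (hX : SmoothField X) (h : ∀ y ∈ s, X y = 0) (x : M) : X x = 0 := by
  have h1 := eq_zero_of_dense_of_continuousAt hs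
    (smoothFieldAt_iff.1 (hX.smoothFieldAt x)).continuousAt fun y hy => by rw [h y hy, map_zero]
  rwa [mvfderiv_extChartAt] at h1

theorem SmoothEnd.eq_of_dense {s : Set M} (hs : Dense s) {A B : EndField n M}
    (hA : SmoothEnd A) (hB : SmoothEnd B) (h : ∀ y ∈ s, A y = B y) (x : M) : A x = B x := by
  have h1 := eq_zero_of_dense_of_continuousAt hs
    ((hA.contMDiffAt_coordEnd x).continuousAt.sub (hB.contMDiffAt_coordEnd x).continuousAt)
    fun y hy => by
      change coordEnd x y (A y) - coordEnd x y (B y) = 0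
      rw [h y hy, sub_self]
  have h2 : coordEnd x x (A x) = coordEnd x x (B x) := sub_eq_zero.1 h1
  ext1 v
  have h3 := coordEnd_apply (mem_extChartAt_source (I := 𝓡 n) x) (A x) v
  rw [h2, coordEnd_apply (mem_extChartAt_source (I := 𝓡 n) x), mvfderiv_extChartAt,
    mvfderiv_extChartAt] at h3
  exact h3.symm

end Density

/-! ### The global deformation and its integrability -/

section Twist

variable {m : ℕ} {M : Type*} [TopologicalSpace M]
  [ChartedSpace (EuclideanSpace ℝ (Fin (2 * m))) M] [MulAction (Fin m → Circle) M]

/-- The endomorphism `∑ C_ij K_i ⊗ dμ^j`. -/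
def momentEnd (μ : M → Fin m → ℝ) (ξ : Module.Basis (Fin m) ℝ (Fin m → ℝ))
    (C : Matrix (Fin m) (Fin m) ℝ) : EndField (2 * m) M := fun x =>
  ∑ i, ∑ j, C i j • (mvfderiv (𝓡 (2 * m)) (momentComp μ (ξ j)) x).smulRight (infAction M (ξ i) x)

/-- The coefficients `∑ C_ij dμ^j` of `momentEnd`. -/
def momentCoeff (μ : M → Fin m → ℝ) (ξ : Module.Basis (Fin m) ℝ (Fin m → ℝ))
    (C : Matrix (Fin m) (Fin m) ℝ) (i : Fin m) : FormField (2 * m) M := fun x =>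
  ∑ j, C i j • (mvfderiv (𝓡 (2 * m)) (momentComp μ (ξ j)) x).toLinearMap

theorem momentCoeff_apply (μ : M → Fin m → ℝ) (ξ : Module.Basis (Fin m) ℝ (Fin m → ℝ))
    (C : Matrix (Fin m) (Fin m) ℝ) (i : Fin m) (x : M) (v : TangentSpace (𝓡 (2 * m)) x) :
    momentCoeff μ ξ C i x v = ∑ j, C i j * mvfderiv (𝓡 (2 * m)) (momentComp μ (ξ j)) x v := by
  simp [momentCoeff]

theorem momentEnd_apply (μ : M → Fin m → ℝ) (ξ : Module.Basis (Fin m) ℝ (Fin m → ℝ))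
    (C : Matrix (Fin m) (Fin m) ℝ) (x : M) (v : TangentSpace (𝓡 (2 * m)) x) :
    momentEnd μ ξ C x v = ∑ i, momentCoeff μ ξ C i x v • infAction M (ξ i) x := by
  simp only [momentEnd, momentCoeff_apply, Finset.sum_smul, sum_apply, smul_apply,
    ContinuousLinearMap.smulRight_apply, mul_smul]

variable [IsManifold (𝓡 (2 * m)) ∞ M] {Ω : TwoTensor (2 * m) M} {μ : M → Fin m → ℝ}
  {ξ : Module.Basis (Fin m) ℝ (Fin m → ℝ)} {C : Matrix (Fin m) (Fin m) ℝ} {J : EndField (2 * m) M}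

theorem IsSymplecticToric.momentCoeff_infAction (hM : IsSymplecticToric Ω μ) (i : Fin m)
    (a : Fin m → ℝ) (x : M) : momentCoeff μ ξ C i x (infAction M a x) = 0 := by
  simp [momentCoeff_apply, hM.mvfderiv_momentComp_infAction]

theorem IsSymplecticToric.momentEnd_infAction (hM : IsSymplecticToric Ω μ)
    (a : Fin m → ℝ) (x : M) : momentEnd μ ξ C x (infAction M a x) = 0 := by
  simp [momentEnd_apply, hM.momentCoeff_infAction]

theorem IsSymplecticToric.momentEnd_momentEnd (hM : IsSymplecticToric Ω μ)
    (x : M) (v : TangentSpace (𝓡 (2 * m)) x) :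
    momentEnd μ ξ C x (momentEnd μ ξ C x v) = 0 := by
  rw [momentEnd_apply μ ξ C x v]
  simp [hM.momentEnd_infAction]

theorem IsSymplecticToric.smoothEnd_momentEnd (hM : IsSymplecticToric Ω μ) :
    SmoothEnd (momentEnd (M := M) μ ξ C) :=
  smoothEnd_sum_smulRight (fun j => hM.contMDiff_momentComp (ξ j)) (fun i => hM.smoothField (ξ i))
    fun i j => C i j

/-- By the moment map equation the left side is -∑ C_ij dμ^i(v) dμ^j(v), an antisymmetric matrix
contracted with a symmetric one. -/
theorem IsSymplecticToric.symm_momentEnd (hM : IsSymplecticToric Ω μ) (hC : C.transpose = -C)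
    (x : M) (v : TangentSpace (𝓡 (2 * m)) x) : Ω x (momentEnd μ ξ C x v) v = 0 := by
  have h : Ω x (momentEnd μ ξ C x v) v = -∑ i, ∑ j,
      C i j * (mvfderiv (𝓡 (2 * m)) (momentComp μ (ξ j)) x v *
        mvfderiv (𝓡 (2 * m)) (momentComp μ (ξ i)) x v) := by
    simp only [momentEnd_apply, map_sum, map_smul, sum_apply, smul_apply, hM.hamiltonian,
      momentCoeff_apply, smul_eq_mul, Finset.sum_mul, mul_neg, Finset.sum_neg_distrib, mul_assoc]
  have hs : ∀ i j, C j i = -C i j := fun i j => congrFun (congrFun hC i) j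
  have h2 : ∑ i, ∑ j, C i j * (mvfderiv (𝓡 (2 * m)) (momentComp μ (ξ j)) x v *
        mvfderiv (𝓡 (2 * m)) (momentComp μ (ξ i)) x v) =
      -∑ i, ∑ j, C i j * (mvfderiv (𝓡 (2 * m)) (momentComp μ (ξ j)) x v *
        mvfderiv (𝓡 (2 * m)) (momentComp μ (ξ i)) x v) := by
    conv_lhs => rw [Finset.sum_comm]
    simp only [← Finset.sum_neg_distrib]
    refine Finset.sum_congr rfl fun i _ => Finset.sum_congr rfl fun j _ => ?_
    rw [hs i j]; ring
  rw [h]; linarith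

theorem IsSymplecticToric.isTwistData (hM : IsSymplecticToric Ω μ) (hJ : IsToricKahler Ω J)
    (hC : C.transpose = -C) (x : M) : IsTwistData (Ω x) (J x) (momentEnd μ ξ C x) where
  alt := hM.symplectic.alt x
  sq := hJ.complex.sq x
  pos := hJ.tamed x
  compatible := hJ.compatible x
  nilpotent := hM.momentEnd_momentEnd x
  symm := hM.symm_momentEnd hC x

variable (μ ξ C J) in
/-- The deformation `(1 - tJB)⁻¹ J (1 - tJB)` of `J` with `B = momentEnd μ ξ C`. -/
def toricTwist (t : ℝ) : EndField (2 * m) M := fun x => twist (J x) (momentEnd μ ξ C x) t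

theorem smoothEndFamilyOn_toricTwist (hM : IsSymplecticToric Ω μ) (hJ : IsToricKahler Ω J)
    (hC : C.transpose = -C) (T : Set ℝ) : SmoothEndFamilyOn (toricTwist μ ξ C J) T :=
  smoothEndFamilyOn_of_conj hJ.complex.smooth (hM.smoothEnd_momentEnd (ξ := ξ) (C := C))
    (fun t x _ hv => (hM.isTwistData hJ hC x).zero_of_eq hv)
    (fun t x v => (hM.isTwistData hJ hC x).twist_spec t v) T

theorem smoothEnd_toricTwist (hM : IsSymplecticToric Ω μ) (hJ : IsToricKahler Ω J)
    (hC : C.transpose = -C) (t : ℝ) : SmoothEnd (toricTwist μ ξ C J t) :=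
  (smoothEndFamilyOn_toricTwist hM hJ hC univ).smoothEnd t

/-! ### Brackets with the infinitesimal action -/

theorem IsSymplecticToric.bracket_infAction_app (hM : IsSymplecticToric Ω μ)
    (hJ : IsToricKahler Ω J) (a : Fin m → ℝ) {X : RField (2 * m) M} (hX : SmoothField X) (x : M) :
    bracket (infAction M a) (J.app X) x = J x (bracket (infAction M a) X x) :=
  (hM.isVelocity a).bracket_app (fun _ v => hJ.invariant _ x v)
    ((hM.smoothField a).smoothFieldAt x).mdiffField (hX.smoothFieldAt x).mdiffField
    ((hX.app hJ.complex.smooth).smoothFieldAt x).mdiffField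

theorem IsSymplecticToric.bracket_infAction_infAction (hM : IsSymplecticToric Ω μ)
    (a b : Fin m → ℝ) (x : M) : bracket (infAction M a) (infAction M b) x = 0 :=
  (hM.isVelocity a).bracket_eq_zero (fun _ => hM.mfderiv_smul_infAction _ b x)
    ((hM.smoothField a).smoothFieldAt x).mdiffField ((hM.smoothField b).smoothFieldAt x).mdiffField

/-- The Lie derivative along K preserves J; vanishing of the Nijenhuis tensor on (K, X) transfers
this to JK. This makes the complexified action holomorphic. -/
theorem IsSymplecticToric.bracket_app_infAction (hM : IsSymplecticToric Ω μ)
    (hJ : IsToricKahler Ω J) (a : Fin m → ℝ) {X : RField (2 * m) M} (hX : SmoothField X) (x : M) :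
    bracket (J.app (infAction M a)) (J.app X) x = J x (bracket (J.app (infAction M a)) X x) := by
  have h := hJ.complex.nijenhuis _ _ (hM.smoothField a) hX x
  rw [hM.bracket_infAction_app hJ a hX, hJ.complex.sq] at h
  rw [← sub_eq_zero, ← h]
  abel

variable (J) in
/-- The frame `K_i`, `J K_i`. -/
def toricFrame (ξ : Module.Basis (Fin m) ℝ (Fin m → ℝ)) : Fin m ⊕ Fin m → RField (2 * m) M :=
  Sum.elim (fun i => infAction M (ξ i)) fun i => J.app (infAction M (ξ i))

theorem smoothField_toricFrame (hM : IsSymplecticToric Ω μ) (hJ : IsToricKahler Ω J)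
    (i : Fin m ⊕ Fin m) : SmoothField (toricFrame J ξ i) := by
  rcases i with i | i
  · exact hM.smoothField (ξ i)
  · exact (hM.smoothField (ξ i)).app hJ.complex.smooth

theorem bracket_toricFrame (hM : IsSymplecticToric Ω μ) (hJ : IsToricKahler Ω J)
    (i j : Fin m ⊕ Fin m) (x : M) : bracket (toricFrame J ξ i) (toricFrame J ξ j) x = 0 := by
  have h1 : ∀ i j : Fin m, bracket (infAction M (ξ i)) (J.app (infAction M (ξ j))) x = 0 :=
    fun i j => by
      rw [hM.bracket_infAction_app hJ _ (hM.smoothField _), hM.bracket_infAction_infAction, map_zero]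
  rcases i with i | i <;> rcases j with j | j
  · exact hM.bracket_infAction_infAction _ _ x
  · exact h1 i j
  · exact (bracket_swap _ _ x).trans (by rw [toricFrame, Sum.elim_inl, Sum.elim_inr, h1 j i, neg_zero])
  · refine (hM.bracket_app_infAction hJ (ξ i) (hM.smoothField (ξ j)) x).trans ?_
    rw [bracket_swap, h1 j i, neg_zero, map_zero]

/-- Orbits are isotropic: if JK_b = -K_a then ω(K_b, JK_b) = -ω(K_b, K_a) = 0, and taming gives K_b
= 0. So 𝒦 and J𝒦 are transverse. -/
theorem IsSymplecticToric.infAction_eq_zero_of_add (hM : IsSymplecticToric Ω μ)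
    (hJ : IsToricKahler Ω J) {a b : Fin m → ℝ} {x : M}
    (h : infAction M a x + J x (infAction M b x) = 0) :
    infAction M a x = 0 ∧ infAction M b x = 0 := by
  have hb : infAction M b x = 0 := by
    by_contra hne
    have h1 := hJ.tamed x _ hne
    rw [← neg_eq_of_add_eq_zero_right h, map_neg, hM.hamiltonian,
      hM.mvfderiv_momentComp_infAction] at h1
    simp at h1
  rw [hb, map_zero, add_zero] at h
  exact ⟨h, hb⟩

theorem linearIndependent_toricFrame (hM : IsSymplecticToric Ω μ) (hJ : IsToricKahler Ω J)
    {x : M} (hx : x ∈ freeLocus m M) :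
    LinearIndependent ℝ (fun i => toricFrame J ξ i x) := by
  rw [Fintype.linearIndependent_iff]
  intro c hc
  rw [Fintype.sum_sum_type] at hc
  simp only [toricFrame, Sum.elim_inl, Sum.elim_inr, EndField.app, ← map_smul, ← map_sum,
    ← hM.infAction_sum] at hc
  obtain ⟨h1, h2⟩ := hM.infAction_eq_zero_of_add hJ hc
  have h3 := Fintype.linearIndependent_iff.1 ξ.linearIndependent _ (hM.infAction_injective hx h1)
  have h4 := Fintype.linearIndependent_iff.1 ξ.linearIndependent _ (hM.infAction_injective hx h2)
  rintro (i | i)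
  exacts [h3 i, h4 i]

/-! ### Integrability -/

/-- Let θ be the closed coframe dual to K_i, JK_i. Precomposing with 1 - tJB fixes the forms dual to
K_i, since JB takes values in the span of the JK_i, and subtracts t ∑ C_ij dμ^j from those dual to
JK_i. The resulting forms are closed, and the conjugation turns their relations with J into the same
relations with the twist. -/
theorem toricTwist_nijenhuis (hM : IsSymplecticToric Ω μ) (hJ : IsToricKahler Ω J)
    (hC : C.transpose = -C) (t : ℝ) {x : M} (hx : x ∈ freeLocus m M) {X Y : RField (2 * m) M}
    (hX : SmoothField X) (hY : SmoothField Y) :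
    bracket ((toricTwist μ ξ C J t).app X) ((toricTwist μ ξ C J t).app Y) x
      - toricTwist μ ξ C J t x (bracket ((toricTwist μ ξ C J t).app X) Y x)
      - toricTwist μ ξ C J t x (bracket X ((toricTwist μ ξ C J t).app Y) x)
      - bracket X Y x = 0 := by
  obtain ⟨θ, hθ, hev⟩ := exists_closed_coframe (smoothField_toricFrame hM hJ (ξ := ξ))
    (bracket_toricFrame hM hJ) (linearIndependent_toricFrame hM hJ hx) (by simp [two_mul])
  let α : Fin m → FormField (2 * m) M := fun i => θ (Sum.inl i)
  let β : Fin m → FormField (2 * m) M := fun i y =>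
    θ (Sum.inr i) y + (-t) • momentCoeff μ ξ C i y
  have hcoeff : ∀ i, IsClosedAt (momentCoeff (M := M) μ ξ C i) x := fun i =>
    IsClosedAt.sum _ fun j => (isClosedAt_mvfderiv (hM.contMDiff_momentComp (ξ j))).smul _
  -- the coframe in terms of `J` and of `1 - tJB`
  have hfr : ∀ᶠ y in 𝓝 x, ∀ i v, (α i y (J y v) = -θ (Sum.inr i) y v ∧
      θ (Sum.inr i) y (J y v) = α i y v) ∧
      α i y (v - t • J y (momentEnd μ ξ C y v)) = α i y v ∧
      θ (Sum.inr i) y (v - t • J y (momentEnd μ ξ C y v)) = β i y v := by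
    filter_upwards [hev] with y hy i v
    obtain ⟨hy1, hy2⟩ := hy
    have hK : ∀ k j, θ k y (infAction M (ξ j) y) = if k = Sum.inl j then 1 else 0 :=
      fun k j => hy2 k (Sum.inl j)
    have hE : ∀ k j, θ k y (J y (infAction M (ξ j) y)) = if k = Sum.inr j then 1 else 0 :=
      fun k j => hy2 k (Sum.inr j)
    have hJv : J y v = ∑ j, θ (Sum.inl j) y v • J y (infAction M (ξ j) y) -
        ∑ j, θ (Sum.inr j) y v • infAction M (ξ j) y := by
      conv_lhs => rw [hy1 v]
      rw [Fintype.sum_sum_type]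
      simp only [toricFrame, Sum.elim_inl, Sum.elim_inr, EndField.app, map_add, map_sum, map_smul,
        hJ.complex.sq, smul_neg, Finset.sum_neg_distrib, sub_eq_add_neg]
    refine ⟨⟨?_, ?_⟩, ?_, ?_⟩
    · simp [α, hJv, hK, hE]
    · simp [α, hJv, hK, hE]
    · simp [α, momentEnd_apply, hE]
    · simp [β, momentEnd_apply, hE, sub_eq_add_neg]
  refine nijenhuis_eq_zero_of_closed (α := α) (β := β) (smoothEnd_toricTwist hM hJ hC t)
    (fun i => hθ _) (fun i => (hθ _).add ((hcoeff i).smul _)) ?_ ?_ hX hY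
  · filter_upwards [hfr] with y hy i v
    have hs := (hM.isTwistData hJ hC (ξ := ξ) y).twist_spec t v
    obtain ⟨_, h1, h2⟩ := hy i (toricTwist μ ξ C J t y v)
    obtain ⟨_, h3, h4⟩ := hy i v
    constructor
    · rw [← h1, ← h4, ← (hy i _).1.1]
      exact congrArg _ hs
    · rw [← h2, ← h3, ← (hy i _).1.2]
      exact congrArg _ hs
  · intro v hv
    apply (hM.isTwistData hJ hC (ξ := ξ) x).zero_of_eq (t := t)
    rw [hev.self_of_nhds.1 (v - t • J x (momentEnd μ ξ C x v)), Fintype.sum_sum_type]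
    have h0 := fun i => hfr.self_of_nhds i v
    simp [α, (h0 _).2.2, (hv _).1, (hv _).2, show ∀ i, θ (Sum.inl i) x
      (v - t • J x (momentEnd μ ξ C x v)) = θ (Sum.inl i) x v from fun i => (h0 i).2.1]

theorem isComplexStructure_toricTwist [T2Space M] [CompactSpace M] [ConnectedSpace M]
    (hM : IsSymplecticToric Ω μ) (hJ : IsToricKahler Ω J) (hC : C.transpose = -C) (t : ℝ) :
    IsComplexStructure (toricTwist μ ξ C J t) where
  smooth := smoothEnd_toricTwist hM hJ hC t
  sq x v := (hM.isTwistData hJ hC x).twist_sq t v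
  nijenhuis X Y hX hY x := by
    have hs := smoothEnd_toricTwist hM hJ hC t (ξ := ξ)
    have hsm := ((((hX.app hs).bracket (hY.app hs)).sub (((hX.app hs).bracket hY).app hs)).sub
      ((hX.bracket (hY.app hs)).app hs)).sub (hX.bracket hY)
    exact hsm.eq_zero_of_dense hM.dense_freeLocus
      (fun y hy => toricTwist_nijenhuis hM hJ hC t hy hX hY) x

end Twist

/-! ### Positive definite plus antisymmetric matrices -/

section Matrices

variable {m : ℕ}

theorem dotProduct_skew_mulVec {C : Matrix (Fin m) (Fin m) ℝ} (hC : C.transpose = -C)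
    (u : Fin m → ℝ) : u ⬝ᵥ (C.mulVec u) = 0 := by
  have h : u ⬝ᵥ (C.mulVec u) = -(u ⬝ᵥ (C.mulVec u)) := by
    conv_lhs => rw [Matrix.dotProduct_mulVec, ← Matrix.mulVec_transpose, hC, Matrix.neg_mulVec,
      neg_dotProduct, dotProduct_comm]
  linarith

/-- The quadratic form of S + tC is that of S, so a kernel vector would contradict positivity. -/
theorem isUnit_det_add_skew {S C : Matrix (Fin m) (Fin m) ℝ} (hS : S.PosDef)
    (hC : C.transpose = -C) (t : ℝ) : IsUnit (S + t • C).det := by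
  rw [isUnit_iff_ne_zero]
  intro h
  obtain ⟨u, hu, h0⟩ := Matrix.exists_mulVec_eq_zero_iff.2 h
  have h1 := hS.dotProduct_mulVec_pos hu
  have h2 := congrArg (fun w => u ⬝ᵥ w) h0
  simp only [Matrix.add_mulVec, Matrix.smul_mulVec, dotProduct_add, dotProduct_smul,
    dotProduct_skew_mulVec hC, dotProduct_zero, smul_zero, add_zero] at h2
  simp [h2] at h1

end Matrices

/-! ### Membership in the deformation class, and uniqueness -/

section Deformation

variable {m : ℕ} {M : Type*} [TopologicalSpace M]
  [ChartedSpace (EuclideanSpace ℝ (Fin (2 * m))) M] [MulAction (Fin m → Circle) M]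

/-- Only the values on ∂/∂μ need checking: inverting Ψ writes each K_j through the A(D_l), and
applying A with A² = -1 gives the other half. -/
theorem isAntiDiagonal_of_left {ξ : Module.Basis (Fin m) ℝ (Fin m → ℝ)} {x : M}
    {D : Fin m → TangentSpace (𝓡 (2 * m)) x} {Ψ : Matrix (Fin m) (Fin m) ℝ} (hΨ : IsUnit Ψ.det)
    {A : TangentSpace (𝓡 (2 * m)) x →L[ℝ] TangentSpace (𝓡 (2 * m)) x} (hA : ∀ v, A (A v) = -v)
    (hD : ∀ j, A (D j) = ∑ i, Ψ i j • infAction M (ξ i) x) : IsAntiDiagonal ξ x D Ψ A := by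
  refine ⟨hD, fun j => ?_⟩
  have h1 : ∀ i, ∑ l, Ψ i l * Ψ⁻¹ l j = (1 : Matrix (Fin m) (Fin m) ℝ) i j := fun i => by
    rw [← Matrix.mul_nonsing_inv Ψ hΨ, Matrix.mul_apply]
  have h2 : infAction M (ξ j) x = ∑ l, Ψ⁻¹ l j • A (D l) := by
    simp only [hD, Finset.smul_sum, smul_smul]
    rw [Finset.sum_comm]
    simp only [← Finset.sum_smul, mul_comm (Ψ⁻¹ _ j), h1, Matrix.one_apply, ite_smul, one_smul,
      zero_smul, Finset.sum_ite_eq', Finset.mem_univ, if_true]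
  rw [h2]
  simp [hA]

variable [IsManifold (𝓡 (2 * m)) ∞ M] {Ω : TwoTensor (2 * m) M} {μ : M → Fin m → ℝ}
  {ξ : Module.Basis (Fin m) ℝ (Fin m → ℝ)} {C : Matrix (Fin m) (Fin m) ℝ} {J : EndField (2 * m) M}

theorem IsSymplecticToric.momentEnd_smul (hM : IsSymplecticToric Ω μ) :
    IsInvariant (momentEnd (M := M) μ ξ C) := by
  intro g x v
  simp [momentEnd_apply, momentCoeff_apply, hM.mvfderiv_momentComp_smul, hM.mfderiv_smul_infAction]

theorem isInvariant_toricTwist (hM : IsSymplecticToric Ω μ) (hJ : IsToricKahler Ω J)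
    (hC : C.transpose = -C) (t : ℝ) : IsInvariant (toricTwist μ ξ C J t) := by
  intro g x v
  symm
  refine (hM.isTwistData hJ hC (g • x)).twist_eq ?_
  have h := congrArg (mfderiv (𝓡 (2 * m)) (𝓡 (2 * m)) (fun y : M => g • y) x)
    ((hM.isTwistData hJ hC (ξ := ξ) x).twist_spec t v)
  simp only [map_sub, map_smul, hJ.invariant g x, hM.momentEnd_smul g x] at h
  simp only [map_sub, map_smul]
  exact h

theorem IsSymplecticToric.momentEnd_mem (hM : IsSymplecticToric Ω μ) (x : M)
    (v : TangentSpace (𝓡 (2 * m)) x) : momentEnd μ ξ C x v ∈ orbitSpan x :=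
  (mem_orbitSpan_iff hM ξ).2 ⟨_, momentEnd_apply μ ξ C x v⟩

theorem IsSymplecticToric.momentEnd_orbitSpan (hM : IsSymplecticToric Ω μ) {x : M}
    {v : TangentSpace (𝓡 (2 * m)) x} (hv : v ∈ orbitSpan x) : momentEnd μ ξ C x v = 0 := by
  obtain ⟨c, rfl⟩ := (mem_orbitSpan_iff hM ξ).1 hv
  simp [hM.momentEnd_infAction]

/-- The twisted structure on `J 𝒦`. -/
theorem toricTwist_app (hM : IsSymplecticToric Ω μ) (hJ : IsToricKahler Ω J)
    (hC : C.transpose = -C) (t : ℝ) {x : M} {k : TangentSpace (𝓡 (2 * m)) x}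
    (hk : k ∈ orbitSpan x) :
    toricTwist μ ξ C J t x (J x k) = -k + t • momentEnd μ ξ C x (J x k) := by
  refine (hM.isTwistData hJ hC x).twist_eq ?_
  simp only [map_add, map_neg, map_sub, map_smul, hM.momentEnd_orbitSpan hk, hJ.complex.sq,
    hM.momentEnd_momentEnd, map_zero, smul_zero, smul_neg]
  simp

theorem map_orbitSpan_toricTwist (hM : IsSymplecticToric Ω μ) (hJ : IsToricKahler Ω J)
    (hC : C.transpose = -C) (t : ℝ) (x : M) :
    (orbitSpan x).map (toricTwist μ ξ C J t x).toLinearMap =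
      (orbitSpan x).map (J x).toLinearMap := by
  have hd := hM.isTwistData hJ hC (ξ := ξ) x
  apply le_antisymm
  · rintro _ ⟨k, hk, rfl⟩
    have h := hd.twist_spec t k
    rw [hM.momentEnd_orbitSpan hk, map_zero, smul_zero, sub_zero, sub_eq_iff_eq_add] at h
    -- Since Bk = 0, the conjugation identity reads J_t k = J(k + tBJ_t k), and B takes values in 𝒦.
    refine ⟨k + t • momentEnd μ ξ C x (toricTwist μ ξ C J t x k),
      add_mem hk (Submodule.smul_mem _ _ (hM.momentEnd_mem x _)), ?_⟩
    refine Eq.trans ?_ h.symm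
    change J x (k + t • momentEnd μ ξ C x (toricTwist μ ξ C J t x k)) = _
    rw [map_add, map_smul]
    rfl
  · rintro _ ⟨k, hk, rfl⟩
    -- The witness is -J_t(Jk), a preimage of Jk under J_t because J_t² = -1.
    refine ⟨-(-k + t • momentEnd μ ξ C x (J x k)),
      neg_mem (add_mem (neg_mem hk) (Submodule.smul_mem _ _ (hM.momentEnd_mem x _))), ?_⟩
    rw [← toricTwist_app hM hJ hC t hk]
    change toricTwist μ ξ C J t x (-toricTwist μ ξ C J t x (J x k)) = J x k
    rw [map_neg]
    exact neg_eq_iff_eq_neg.2 (hd.twist_sq t _)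

theorem isSymplecticAdjoint_toricTwist (hM : IsSymplecticToric Ω μ) (hJ : IsToricKahler Ω J)
    (hC : C.transpose = -C) (t : ℝ) :
    IsSymplecticAdjoint Ω (toricTwist μ ξ C J t) (-toricTwist μ ξ C J (-t)) := fun x v w =>
  ((hM.isTwistData hJ hC x).twist_adjoint t v w).trans (map_neg _ _).symm

theorem IsComplexStructure.neg {n : ℕ} {N : Type*} [TopologicalSpace N]
    [ChartedSpace (EuclideanSpace ℝ (Fin n)) N] [IsManifold (𝓡 n) ∞ N] {J : EndField n N}
    (hJ : IsComplexStructure J) : IsComplexStructure (-J) where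
  smooth := by
    have h := hJ.smooth
    unfold SmoothEnd at *
    exact h.neg_section
  sq x v := by
    change -J x (-J x v) = -v
    rw [map_neg, hJ.sq, neg_neg]
  nijenhuis X Y hX hY x := by
    have e : ∀ X : RField n N, (-J).app X = (-1 : ℝ) • J.app X := fun X => by
      funext y
      change -J y (X y) = (-1 : ℝ) • J y (X y)
      rw [neg_one_smul]
    have h1 : ∀ X Y : RField n N, SmoothField Y → bracket X ((-J).app Y) x =
        -bracket X (J.app Y) x := fun X Y hY => by
      rw [e, bracket_smul_right _ (hY.app hJ.smooth), neg_one_smul]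
    have h2 : ∀ X Y : RField n N, SmoothField X → bracket ((-J).app X) Y x =
        -bracket (J.app X) Y x := fun X Y hX => by
      rw [bracket_swap, h1 _ _ hX, bracket_swap Y, neg_neg]
    rw [h1 _ _ hY, h2 _ _ hX, h2 _ _ hX, h1 _ _ hY]
    rw [← hJ.nijenhuis X Y hX hY x]
    simp only [Pi.neg_apply, neg_apply, map_neg, neg_neg]

theorem isToricDGK_toricTwist [T2Space M] [CompactSpace M] [ConnectedSpace M]
    (hM : IsSymplecticToric Ω μ) (hJ : IsToricKahler Ω J) (hC : C.transpose = -C) (t : ℝ) :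
    IsToricDGK Ω (toricTwist μ ξ C J t) where
  complex := isComplexStructure_toricTwist hM hJ hC t
  invariant := isInvariant_toricTwist hM hJ hC t
  tamed x _ hv := (hM.isTwistData hJ hC x).twist_pos t hv
  adjoint := ⟨_, isSymplecticAdjoint_toricTwist hM hJ hC t,
    (isComplexStructure_toricTwist hM hJ hC (-t)).neg, fun x _ => by
      rw [map_orbitSpan_toricTwist hM hJ hC t x, ← map_orbitSpan_toricTwist hM hJ hC (-t) x (ξ := ξ)]
      exact Submodule.map_neg _ _⟩

/-! ### The coordinate expression -/

/-- In momentum-angle coordinates the twist adds `t C` to the matrix of `J`. -/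
theorem isAntiDiagonal_toricTwist (hM : IsSymplecticToric Ω μ) (hJ : IsToricKahler Ω J)
    (hC : C.transpose = -C) {x : M} {D : Fin m → TangentSpace (𝓡 (2 * m)) x}
    (hD : IsMomentFrame μ ξ J x D) {S : Matrix (Fin m) (Fin m) ℝ} (hS : S.PosDef)
    (hJD : IsAntiDiagonal ξ x D S (J x)) (t : ℝ) :
    IsAntiDiagonal ξ x D (S + t • C) (toricTwist μ ξ C J t x) := by
  refine isAntiDiagonal_of_left (isUnit_det_add_skew hS hC t)
    (fun v => (hM.isTwistData hJ hC x).twist_sq t v) fun j => ?_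
  obtain ⟨k, hk, hkD⟩ := hD.1 j
  have hkD' : J x k = D j := hkD
  -- With D_j = Jk, the value J_t D_j is J D_j + tB D_j, and dμ^i(D_j) = δ_ij turns the second term
  -- into t ∑ C_ij K_i.
  rw [← hkD', toricTwist_app hM hJ hC t hk, hkD', ← hJ.complex.sq, hkD', hJD.1, momentEnd_apply]
  simp [momentCoeff_apply, hD.2, add_smul, Finset.sum_add_distrib, Finset.smul_sum, smul_smul]

theorem IsSymplecticToric.mvfderiv_momentComp_app (hM : IsSymplecticToric Ω μ)
    (a b : Fin m → ℝ) (x : M) :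
    mvfderiv (𝓡 (2 * m)) (momentComp μ a) x (J x (infAction M b x)) =
      -Ω x (infAction M a x) (J x (infAction M b x)) := by
  rw [hM.hamiltonian, neg_neg]

variable (Ω J ξ) in
/-- The matrix `Ω(K_i, J K_j)`. -/
def orbitGram (x : M) : Matrix (Fin m) (Fin m) ℝ :=
  Matrix.of fun i j => Ω x (infAction M (ξ i) x) (J x (infAction M (ξ j) x))

theorem posDef_orbitGram (hM : IsSymplecticToric Ω μ) (hJ : IsToricKahler Ω J) {x : M}
    (hx : x ∈ freeLocus m M) : (orbitGram Ω ξ J x).PosDef := by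
  have hd := hM.isTwistData hJ (C := 0) (by simp) (ξ := ξ) x
  refine Matrix.PosDef.of_dotProduct_mulVec_pos ?_ fun u hu => ?_
  · ext i j
    change Ω x (infAction M (ξ j) x) (J x (infAction M (ξ i) x)) =
      Ω x (infAction M (ξ i) x) (J x (infAction M (ξ j) x))
    rw [hd.swap, hd.J_adj, neg_neg]
  · have hne : infAction M (∑ i, u i • ξ i) x ≠ 0 := fun h0 => hu (funext fun i =>
      Fintype.linearIndependent_iff.1 ξ.linearIndependent _ (hM.infAction_injective hx h0) i)
    have h := hJ.tamed x _ hne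
    refine h.trans_eq ?_
    rw [hM.infAction_sum]
    simp only [map_sum, map_smul, sum_apply, smul_apply, smul_eq_mul, Matrix.mulVec, dotProduct,
      orbitGram, Matrix.of_apply, Finset.mul_sum, star_trivial]
    rw [Finset.sum_comm]
    exact Finset.sum_congr rfl fun i _ => Finset.sum_congr rfl fun j _ => by ring

/-- Let G_ij = ω(K_i, JK_j) = -dμ^i(JK_j). The normalization dμ^i(D_j) = δ_ij forces D_j = -∑
(G⁻¹)_ij JK_i, so J D_j = ∑ (G⁻¹)_ij K_i and S = G⁻¹. -/
theorem exists_momentFrame (hM : IsSymplecticToric Ω μ) (hJ : IsToricKahler Ω J) {x : M}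
    (hx : x ∈ freeLocus m M) : ∃ (D : Fin m → TangentSpace (𝓡 (2 * m)) x)
      (S : Matrix (Fin m) (Fin m) ℝ), IsMomentFrame μ ξ J x D ∧ S.PosDef ∧
      IsAntiDiagonal ξ x D S (J x) := by
  have hG := posDef_orbitGram hM hJ hx (ξ := ξ)
  set G := orbitGram Ω ξ J x with hGdef
  have hGdet : IsUnit G.det := isUnit_iff_ne_zero.2 hG.det_pos.ne'
  have hS := hG.inv
  refine ⟨fun j => -∑ i, G⁻¹ i j • J x (infAction M (ξ i) x), G⁻¹, ⟨fun j => ?_, fun i j => ?_⟩, hS,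
    isAntiDiagonal_of_left (isUnit_iff_ne_zero.2 hS.det_pos.ne') (hJ.complex.sq x) fun j => ?_⟩
  · refine ⟨-∑ i, G⁻¹ i j • infAction M (ξ i) x, neg_mem ((mem_orbitSpan_iff hM ξ).2 ⟨_, rfl⟩), ?_⟩
    change J x (-∑ i, G⁻¹ i j • infAction M (ξ i) x) = _
    simp
  · have h1 := congrFun (congrFun (Matrix.mul_nonsing_inv G hGdet) i) j
    rw [Matrix.mul_apply, Matrix.one_apply] at h1
    rw [← h1]
    change mvfderiv (𝓡 (2 * m)) (momentComp μ (ξ i)) x (-∑ l, G⁻¹ l j • J x (infAction M (ξ l) x)) = _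
    simp only [map_neg, map_sum, map_smul, hM.mvfderiv_momentComp_app, smul_eq_mul, mul_neg,
      Finset.sum_neg_distrib, neg_neg]
    refine Finset.sum_congr rfl fun l _ => ?_
    rw [mul_comm]; rfl
  · simp [hJ.complex.sq]

theorem isToricDeformation_toricTwist [T2Space M] [CompactSpace M] [ConnectedSpace M]
    (hM : IsSymplecticToric Ω μ) (hJ : IsToricKahler Ω J) (hC : C.transpose = -C) (ε : ℝ) :
    IsToricDeformation Ω μ ξ J C ε (toricTwist μ ξ C J) where
  smooth := smoothEndFamilyOn_toricTwist hM hJ hC _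
  zero := funext fun x => (hM.isTwistData hJ hC x).twist_zero
  mem t _ := isToricDGK_toricTwist hM hJ hC t
  form x hx := by
    obtain ⟨D, S, hD, hS, hA⟩ := exists_momentFrame hM hJ hx (ξ := ξ)
    exact ⟨D, S, hD, hS, hA, fun t _ => isAntiDiagonal_toricTwist hM hJ hC hD hS hA t⟩

theorem eq_of_toricFrame (hM : IsSymplecticToric Ω μ) (hJ : IsToricKahler Ω J) {x : M}
    (hx : x ∈ freeLocus m M) {A A' : TangentSpace (𝓡 (2 * m)) x →L[ℝ] TangentSpace (𝓡 (2 * m)) x}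
    (h1 : ∀ i, A (infAction M (ξ i) x) = A' (infAction M (ξ i) x))
    (h2 : ∀ i, A (J x (infAction M (ξ i) x)) = A' (J x (infAction M (ξ i) x))) : A = A' := by
  have hspan : Submodule.span ℝ (Set.range fun i => toricFrame J ξ i x) = ⊤ :=
    (linearIndependent_toricFrame hM hJ hx).span_eq_top_of_card_eq_finrank' (by
      have : Module.finrank ℝ (TangentSpace (𝓡 (2 * m)) x) = 2 * m :=
        finrank_euclideanSpace_fin (𝕜 := ℝ) (n := 2 * m)
      rw [this]
      simp [two_mul])
  apply ContinuousLinearMap.coe_injective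
  apply LinearMap.ext_on hspan
  rintro _ ⟨i | i, rfl⟩
  exacts [h1 i, h2 i]

/-- The coordinate expression determines the family. -/
theorem IsToricDeformation.eq_toricTwist [T2Space M] [CompactSpace M] [ConnectedSpace M]
    (hM : IsSymplecticToric Ω μ) (hJ : IsToricKahler Ω J) (hC : C.transpose = -C) {ε : ℝ}
    {F : ℝ → EndField (2 * m) M} (hF : IsToricDeformation Ω μ ξ J C ε F) {t : ℝ}
    (ht : t ∈ Set.Ioo (-ε) ε) : F t = toricTwist μ ξ C J t := by
  funext x
  refine SmoothEnd.eq_of_dense hM.dense_freeLocus (hF.mem t ht).complex.smooth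
    (smoothEnd_toricTwist hM hJ hC t) (fun y hy => ?_) x
  -- At a free point both structures have the same matrix in the same frame. Agreement on the K_i
  -- and on the JK_i, which are combinations of the D_j, is agreement on a basis.
  obtain ⟨D, S, hD, hS, hA, hFA⟩ := hF.form y hy
  have h1 := hFA t ht
  have h2 := isAntiDiagonal_toricTwist hM hJ hC hD hS hA t
  refine eq_of_toricFrame hM hJ hy (fun i => (h1.2 i).trans (h2.2 i).symm) fun i => ?_
  rw [hA.2 i]
  simp only [map_neg, map_sum, map_smul, h1.1, h2.1]

end Deformation

/-! ### First variation of the conjugation -/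

section Derivative

variable {V : Type*} [NormedAddCommGroup V] [NormedSpace ℝ V] [FiniteDimensional ℝ V]

theorem IsTwistData.hasDerivAt {q : V →L[ℝ] V →L[ℝ] ℝ} {J B : V →L[ℝ] V}
    (h : IsTwistData q J B) :
    HasDerivAt (fun t => twist J B t) (B + J ∘L B ∘L J) 0 := by
  -- This rearranges (1 - tJB)J_t = J(1 - tJB) = J + tB. The difference quotient at 0 is then
  -- exactly B + JBJ_t, so only continuity of the twist is needed.
  have hcomm : ∀ t, twist J B t = J + t • (B + J ∘L B ∘L twist J B t) := fun t => by
    ext v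
    have h1 := h.twist_spec t v
    rw [map_sub, map_smul, h.sq, sub_eq_iff_eq_add] at h1
    refine h1.trans ?_
    simp only [add_apply, smul_apply, ContinuousLinearMap.comp_apply, smul_add, smul_neg]
    abel
  have hcont : ContinuousAt (fun t => twist J B t) 0 := by
    have h0 : ContinuousLinearMap.id ℝ V - (0 : ℝ) • J ∘L B =
        (ContinuousLinearEquiv.refl ℝ V : V →L[ℝ] V) := by ext; simp
    have hl : Continuous (fun t : ℝ => ContinuousLinearMap.id ℝ V - t • J ∘L B) := by fun_prop
    have hi := (contDiffAt_map_inverse (𝕜 := ℝ) (n := 0) (ContinuousLinearEquiv.refl ℝ V)).continuousAt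
    rw [← h0] at hi
    have hi' : ContinuousAt (fun t : ℝ => (ContinuousLinearMap.id ℝ V - t • J ∘L B).inverse) 0 :=
      ContinuousAt.comp (f := fun t : ℝ => ContinuousLinearMap.id ℝ V - t • J ∘L B) hi
        hl.continuousAt
    exact hi'.clm_comp (continuousAt_const.clm_comp hl.continuousAt)
  rw [hasDerivAt_iff_tendsto_slope]
  have hlim : Tendsto (fun t => B + J ∘L B ∘L twist J B t) (𝓝[≠] 0) (𝓝 (B + J ∘L B ∘L J)) := by
    have h1 : ContinuousAt (fun t => B + J ∘L B ∘L twist J B t) 0 :=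
      continuousAt_const.add (continuousAt_const.clm_comp (continuousAt_const.clm_comp hcont))
    have h2 := h1.tendsto
    rw [h.twist_zero] at h2
    exact h2.mono_left nhdsWithin_le_nhds
  refine hlim.congr' ?_
  filter_upwards [self_mem_nhdsWithin] with t ht
  have ht' : t ≠ 0 := ht
  rw [slope_def_module, h.twist_zero, hcomm t, add_sub_cancel_left, sub_zero, smul_smul,
    inv_mul_cancel₀ ht', one_smul, ← hcomm t]

end Derivative

/-! ### Real form of T^{1,0}-valued (0,1)-forms and of ∂̄-closedness -/

section Complexification

variable {n : ℕ} {M : Type*} [TopologicalSpace M] [ChartedSpace (EuclideanSpace ℝ (Fin n)) M]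

theorem rePart_tmul {V : Type*} [AddCommGroup V] [Module ℝ V] (c : ℂ) (v : V) :
    rePart (c ⊗ₜ[ℝ] v) = c.re • v := by simp [rePart]

theorem imPart_tmul {V : Type*} [AddCommGroup V] [Module ℝ V] (c : ℂ) (v : V) :
    imPart (c ⊗ₜ[ℝ] v) = c.im • v := by simp [imPart]

theorem eq_rePart_add_imPart {V : Type*} [AddCommGroup V] [Module ℝ V] (z : ℂ ⊗[ℝ] V) :
    z = (1 : ℂ) ⊗ₜ[ℝ] rePart z + Complex.I ⊗ₜ[ℝ] imPart z := by
  induction z using TensorProduct.induction_on with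
  | zero => simp
  | tmul c v =>
    rw [rePart_tmul, imPart_tmul, ← TensorProduct.smul_tmul, ← TensorProduct.smul_tmul,
      ← TensorProduct.add_tmul]
    congr 1
    apply Complex.ext <;> simp
  | add a b ha hb =>
    conv_lhs => rw [ha, hb]
    simp only [map_add, TensorProduct.tmul_add]
    abel

theorem complexify_tmul (A : EndField n M) (x : M) (c : ℂ) (v : TangentSpace (𝓡 n) x) :
    A.complexify x (c ⊗ₜ[ℝ] v) = c ⊗ₜ[ℝ] A x v := rfl

theorem rePart_complexify (A : EndField n M) (x : M) (z : CT n x) :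
    rePart (A.complexify x z) = A x (rePart z) := by
  conv_lhs => rw [eq_rePart_add_imPart z]
  simp [complexify_tmul, rePart_tmul]

theorem imPart_complexify (A : EndField n M) (x : M) (z : CT n x) :
    imPart (A.complexify x z) = A x (imPart z) := by
  conv_lhs => rw [eq_rePart_add_imPart z]
  simp [complexify_tmul, imPart_tmul]

/-- The real linear map `v ↦ ½ (v - iJv)`. -/
def part10 (J : EndField n M) (x : M) : TangentSpace (𝓡 n) x →ₗ[ℝ] CT n x :=
  (proj10 J x).restrictScalars ℝ ∘ₗ TensorProduct.mk ℝ ℂ (TangentSpace (𝓡 n) x) 1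

theorem part10_apply (J : EndField n M) (x : M) (v : TangentSpace (𝓡 n) x) :
    part10 J x v = proj10 J x ((1 : ℂ) ⊗ₜ[ℝ] v) := rfl

theorem part10_eq (J : EndField n M) (x : M) (v : TangentSpace (𝓡 n) x) :
    part10 J x v = (1 / 2 : ℂ) • ((1 : ℂ) ⊗ₜ[ℝ] v - Complex.I ⊗ₜ[ℝ] J x v) := by
  simp [part10_apply, proj10, complexify_tmul, TensorProduct.smul_tmul']

theorem rePart_part10 (J : EndField n M) (x : M) (v : TangentSpace (𝓡 n) x) :
    rePart (part10 J x v) = (1 / 2 : ℝ) • v := by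
  rw [part10_eq, rePart_smul]
  simp [rePart_tmul, imPart_tmul]

theorem imPart_part10 (J : EndField n M) (x : M) (v : TangentSpace (𝓡 n) x) :
    imPart (part10 J x v) = -(1 / 2 : ℝ) • J x v := by
  rw [part10_eq, imPart_smul]
  simp [rePart_tmul, imPart_tmul]

theorem eq_of_rePart_imPart {V : Type*} [AddCommGroup V] [Module ℝ V] {z w : ℂ ⊗[ℝ] V}
    (h1 : rePart z = rePart w) (h2 : imPart z = imPart w) : z = w := by
  rw [eq_rePart_add_imPart z, eq_rePart_add_imPart w, h1, h2]

theorem I_smul_part10 {J : EndField n M} (hJ : ∀ x v, J x (J x v) = -v)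
    (x : M) (v : TangentSpace (𝓡 n) x) :
    Complex.I • part10 J x v = part10 J x (J x v) := by
  apply eq_of_rePart_imPart
  · simp [rePart_smul, rePart_part10, imPart_part10]
  · simp [imPart_smul, rePart_part10, imPart_part10, hJ]

theorem complexify_part10 {J : EndField n M} (hJ : ∀ x v, J x (J x v) = -v)
    (x : M) (v : TangentSpace (𝓡 n) x) :
    J.complexify x (part10 J x v) = Complex.I • part10 J x v := by
  rw [I_smul_part10 hJ]
  apply eq_of_rePart_imPart
  · simp [rePart_complexify, rePart_part10]
  · simp [imPart_complexify, imPart_part10]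

theorem proj10_eq {J : EndField n M} (hJ : ∀ x v, J x (J x v) = -v)
    (x : M) (z : CT n x) :
    proj10 J x z = part10 J x (rePart z + J x (imPart z)) := by
  rw [map_add, ← I_smul_part10 hJ]
  conv_lhs => rw [eq_rePart_add_imPart z]
  rw [map_add, part10_apply, part10_apply, ← map_smul, TensorProduct.smul_tmul', smul_eq_mul,
    mul_one]

/-- The `T^{1,0}`-valued `(0,1)`-form defined by an endomorphism. -/
def endForm (J A : EndField n M) : CEndField n M := fun x =>
  proj10 J x ∘ₗ A.complexify x ∘ₗ proj01 J x

theorem endForm_neg (J A : EndField n M) : endForm J (-A) = -endForm J A := by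
  funext x
  ext v
  simp [endForm, EndField.complexify]

/-- An endomorphism anticommuting with J exchanges T^{1,0} and T^{0,1}, so on a real vector v the
form is just (Av)^{1,0}. -/
theorem endForm_apply {J A : EndField n M} (hJ : ∀ x v, J x (J x v) = -v)
    (hA : ∀ x v, A x (J x v) = -J x (A x v)) (x : M) (z : CT n x) :
    endForm J A x z = part10 J x (A x (rePart z) + J x (A x (imPart z))) := by
  change proj10 J x (A.complexify x (proj01 J x z)) = _
  rw [proj10_eq hJ, rePart_complexify, imPart_complexify]
  have h1 : rePart (proj01 J x z) = (1 / 2 : ℝ) • (rePart z - J x (imPart z)) := by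
    simp [proj01, rePart_smul, rePart_complexify, imPart_complexify, sub_eq_add_neg]
  have h2 : imPart (proj01 J x z) = (1 / 2 : ℝ) • (imPart z + J x (rePart z)) := by
    simp [proj01, imPart_smul, rePart_complexify, imPart_complexify]
  rw [h1, h2]
  congr 1
  simp only [map_smul, map_add, map_sub, hA, map_neg, hJ, ← smul_add]
  rw [show ∀ a b : TangentSpace (𝓡 n) x, a - -b + (b + - -a) = (2 : ℝ) • (a + b) from fun a b => by
    rw [two_smul]; abel, smul_smul]
  simp

theorem re_endForm [IsManifold (𝓡 n) ∞ M] {J A : EndField n M} (hJ : ∀ x v, J x (J x v) = -v)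
    (hA : ∀ x v, A x (J x v) = -J x (A x v)) (Z : CField n M) :
    CField.re (fun x => endForm J A x (Z x)) = (1 / 2 : ℝ) • (A.app Z.re + J.app (A.app Z.im)) := by
  funext x
  change rePart (endForm J A x (Z x)) = _
  rw [endForm_apply hJ hA, rePart_part10]
  rfl

theorem im_endForm [IsManifold (𝓡 n) ∞ M] {J A : EndField n M} (hJ : ∀ x v, J x (J x v) = -v)
    (hA : ∀ x v, A x (J x v) = -J x (A x v)) (Z : CField n M) :
    CField.im (fun x => endForm J A x (Z x)) =
      -(1 / 2 : ℝ) • J.app (A.app Z.re + J.app (A.app Z.im)) := by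
  funext x
  change imPart (endForm J A x (Z x)) = _
  rw [endForm_apply hJ hA, imPart_part10]
  rfl

theorem endForm_mem_forms01 [IsManifold (𝓡 n) ∞ M] {J A : EndField n M} (hJ : ∀ x v, J x (J x v) = -v)
    (hA : ∀ x v, A x (J x v) = -J x (A x v)) (hJs : SmoothEnd J) (hAs : SmoothEnd A) :
    endForm J A ∈ forms01 J := by
  refine ⟨fun x z => ?_, fun x z => ?_, fun Z hZ => ⟨?_, ?_⟩⟩
  · rw [endForm_apply hJ hA, endForm_apply hJ hA, I_smul_part10 hJ, rePart_complexify,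
      imPart_complexify, ← map_neg]
    congr 1
    simp only [hA, map_add, map_neg, hJ]
    abel
  · rw [endForm_apply hJ hA, complexify_part10 hJ]
  · rw [re_endForm hJ hA]
    exact ((hZ.1.app hAs).add ((hZ.2.app hAs).app hJs)).smul _
  · rw [im_endForm hJ hA]
    exact (((hZ.1.app hAs).add ((hZ.2.app hAs).app hJs)).app hJs).smul _

/-- A real form of the `∂̄`-closedness of an endomorphism. -/
theorem endForm_mem_closed01 [IsManifold (𝓡 n) ∞ M] {J A : EndField n M} (hJ : IsComplexStructure J)
    (hAs : SmoothEnd A) (hA : ∀ x v, A x (J x v) = -J x (A x v))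
    (h : ∀ X Y : RField n M, SmoothField X → SmoothField Y → ∀ x,
      (bracket X (A.app Y) x + J x (bracket (J.app X) (A.app Y) x))
        - (bracket Y (A.app X) x + J x (bracket (J.app Y) (A.app X) x)) =
      A x (bracket X Y x - bracket (J.app X) (J.app Y) x)) : endForm J A ∈ closed01 J := by
  -- Sections of T^{0,1} are X + iJX with X real, and the form sends them to AX - iJAX; closedness
  -- thus becomes a statement about real fields.
  have him : ∀ Y : CField n M, IsSection01 J Y → Y.im = J.app Y.re := fun Y hY => by
    funext x
    have h1 := congrArg rePart (hY.2 x)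
    rw [rePart_complexify, map_neg, rePart_smul] at h1
    simpa using! h1.symm
  have hre : ∀ Y : CField n M, IsSection01 J Y →
      CField.re (fun x => endForm J A x (Y x)) = A.app Y.re := fun Y hY => by
    rw [re_endForm hJ.sq hA, him Y hY]
    funext x
    change (1 / 2 : ℝ) • (A x (Y.re x) + J x (A x (J x (Y.re x)))) = A x (Y.re x)
    rw [hA, map_neg, hJ.sq, neg_neg, ← two_smul ℝ, smul_smul]
    simp
  have him' : ∀ Y : CField n M, IsSection01 J Y →
      CField.im (fun x => endForm J A x (Y x)) = (-1 : ℝ) • J.app (A.app Y.re) := fun Y hY => by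
    rw [im_endForm hJ.sq hA, him Y hY]
    funext x
    change -(1 / 2 : ℝ) • J x (A x (Y.re x) + J x (A x (J x (Y.re x)))) = (-1 : ℝ) • J x (A x (Y.re x))
    rw [hA, map_neg, hJ.sq, neg_neg, ← two_smul ℝ, map_smul, smul_smul]
    simp
  have hbr : ∀ Y Z : CField n M, IsSection01 J Y → IsSection01 J Z → ∀ x,
      proj10 J x (cbracket Y (fun y => endForm J A y (Z y)) x) = (2 : ℝ) • part10 J x
        (bracket Y.re (A.app Z.re) x + J x (bracket (J.app Y.re) (A.app Z.re) x)) := by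
    intro Y Z hY hZ x
    have hW := hZ.1.1.app hAs
    -- Integrability eliminates the bracket of JX with JAX', leaving the two brackets in the real
    -- criterion.
    have hN := hJ.nijenhuis _ _ hY.1.1 hW x
    rw [proj10_eq hJ.sq, ← map_smul]
    congr 1
    simp only [cbracket, map_add, rePart_tmul, imPart_tmul, hre Z hZ, him' Z hZ, him Y hY,
      Complex.one_re, Complex.one_im, Complex.I_re, Complex.I_im, one_smul, zero_smul, add_zero,
      zero_add, bracket_smul_right _ (hW.app hJ.smooth)]
    simp only [neg_smul, one_smul, sub_neg_eq_add, map_neg, map_add]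
    have hN' : bracket (J.app Y.re) (J.app (A.app Z.re)) x =
        J x (bracket (J.app Y.re) (A.app Z.re) x) + J x (bracket Y.re (J.app (A.app Z.re)) x)
          + bracket Y.re (A.app Z.re) x := by
      rw [← sub_eq_zero, ← hN]; abel
    rw [hN', two_smul]
    abel
  refine ⟨endForm_mem_forms01 hJ.sq hA hJ.smooth hAs, fun Y Z hY hZ x => ?_⟩
  rw [hbr Y Z hY hZ, hbr Z Y hZ hY, ← smul_sub, ← map_sub, h _ _ hY.1.1 hZ.1.1, sub_eq_zero,
    endForm_apply hJ.sq hA, ← map_smul]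
  congr 1
  have hN := hJ.nijenhuis _ _ hY.1.1 hZ.1.1 x
  simp only [cbracket, map_add, rePart_tmul, imPart_tmul, him Y hY, him Z hZ,
      Complex.one_re, Complex.one_im, Complex.I_re, Complex.I_im, one_smul, zero_smul, add_zero,
      zero_add]
  have hs : bracket Y.re (J.app Z.re) x + bracket (J.app Y.re) Z.re x =
      J x (bracket Y.re Z.re x - bracket (J.app Y.re) (J.app Z.re) x) := by
    have h1 : bracket Y.re Z.re x - bracket (J.app Y.re) (J.app Z.re) x =
        -J x (bracket Y.re (J.app Z.re) x + bracket (J.app Y.re) Z.re x) := by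
      rw [← sub_eq_zero, ← neg_eq_zero, ← hN, map_add]; abel
    rw [h1, map_neg, hJ.sq, neg_neg]
  rw [← map_add (J x), ← map_add (A x), hs, hA, map_neg, hJ.sq, neg_neg, two_smul]

end Complexification

/-! ### The Kodaira–Spencer form and its identification with σω -/

section KodairaSpencer

theorem SmoothEnd.add_comp {n : ℕ} {M : Type*} [TopologicalSpace M]
    [ChartedSpace (EuclideanSpace ℝ (Fin n)) M] [IsManifold (𝓡 n) ∞ M] {A J B : EndField n M}
    (hA : SmoothEnd A) (hJ : SmoothEnd J) (hB : SmoothEnd B) :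
    SmoothEnd (fun x => A x + J x ∘L B x ∘L J x) := by
  refine smoothEnd_of_coordEnd fun x => ?_
  have hA' := hA.contMDiffAt_coordEnd x
  have hJ' := hJ.contMDiffAt_coordEnd x
  have hB' := hB.contMDiffAt_coordEnd x
  refine (hA'.add (hJ'.clm_comp (hB'.clm_comp hJ'))).congr_of_eventuallyEq ?_
  filter_upwards [extChartAt_source_mem_nhds (I := 𝓡 n) x] with y hy
  refine coordEnd_eq hy fun v => ?_
  change coordEnd x y (A y) _ + coordEnd x y (J y) (coordEnd x y (B y) (coordEnd x y (J y) _)) = _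
  rw [coordEnd_apply hy, coordEnd_apply hy, coordEnd_apply hy, coordEnd_apply hy, ← map_add]
  rfl

variable {m : ℕ} {M : Type*} [TopologicalSpace M]
  [ChartedSpace (EuclideanSpace ℝ (Fin (2 * m))) M] [MulAction (Fin m → Circle) M]

/-- The derivative `B + JBJ` at `t = 0` of `toricTwist μ ξ C J t`. -/
def kodairaEnd (μ : M → Fin m → ℝ) (ξ : Module.Basis (Fin m) ℝ (Fin m → ℝ))
    (C : Matrix (Fin m) (Fin m) ℝ) (J : EndField (2 * m) M) : EndField (2 * m) M := fun x =>
  momentEnd μ ξ C x + J x ∘L momentEnd μ ξ C x ∘L J x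

variable [IsManifold (𝓡 (2 * m)) ∞ M] {Ω : TwoTensor (2 * m) M} {μ : M → Fin m → ℝ}
  {ξ : Module.Basis (Fin m) ℝ (Fin m → ℝ)} {C : Matrix (Fin m) (Fin m) ℝ} {J : EndField (2 * m) M}

theorem smoothEnd_kodairaEnd (hM : IsSymplecticToric Ω μ) (hJ : IsToricKahler Ω J) :
    SmoothEnd (kodairaEnd μ ξ C J) :=
  hM.smoothEnd_momentEnd.add_comp hJ.complex.smooth hM.smoothEnd_momentEnd

theorem kodairaEnd_apply (x : M) (v : TangentSpace (𝓡 (2 * m)) x) :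
    kodairaEnd μ ξ C J x v = momentEnd μ ξ C x v + J x (momentEnd μ ξ C x (J x v)) := rfl

theorem kodairaEnd_comp (hJ : ∀ x v, J x (J x v) = -v) (x : M)
    (v : TangentSpace (𝓡 (2 * m)) x) :
    kodairaEnd μ ξ C J x (J x v) = -J x (kodairaEnd μ ξ C J x v) := by
  simp [kodairaEnd_apply, hJ]

theorem hasDerivAt_toricTwist (hM : IsSymplecticToric Ω μ) (hJ : IsToricKahler Ω J)
    (hC : C.transpose = -C) (x : M) :
    HasDerivAt (fun t => toricTwist μ ξ C J t x) (kodairaEnd μ ξ C J x) 0 := by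
  have h := hM.isTwistData hJ hC (ξ := ξ) x
  exact IsTwistData.hasDerivAt (V := EuclideanSpace ℝ (Fin (2 * m))) (J := J x)
    (B := momentEnd μ ξ C x) (q := Ω x) ⟨h.alt, h.sq, h.pos, h.compatible, h.nilpotent, h.symm⟩

theorem isClosedAt_momentCoeff (hM : IsSymplecticToric Ω μ) (i : Fin m) (x : M) :
    IsClosedAt (momentCoeff (M := M) μ ξ C i) x :=
  IsClosedAt.sum _ fun j => (isClosedAt_mvfderiv (hM.contMDiff_momentComp (ξ j))).smul _

theorem bracket_app_toricFrame (hM : IsSymplecticToric Ω μ) (hJ : IsToricKahler Ω J)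
    {X : RField (2 * m) M} (hX : SmoothField X) (k : Fin m ⊕ Fin m) (x : M) :
    bracket (J.app X) (toricFrame J ξ k) x = J x (bracket X (toricFrame J ξ k) x) := by
  rw [bracket_swap, bracket_swap X, map_neg]
  rcases k with i | i
  · exact congrArg _ (hM.bracket_infAction_app hJ (ξ i) hX x)
  · exact congrArg _ (hM.bracket_app_infAction hJ (ξ i) hX x)

/-- With c_i = ∑ C_ij dμ^j, the field (B + JBJ)X is ∑ c_i(X) K_i + c_i(JX) JK_i. For a frame field e
one has [JY, e] = J[Y, e], so [Y, e] + J[JY, e] = 0 and only derivatives of the coefficients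
survive. This holds at every point, free or not. -/
theorem bracket_kodairaEnd (hM : IsSymplecticToric Ω μ) (hJ : IsToricKahler Ω J)
    {X Y : RField (2 * m) M} (hX : SmoothField X) (hY : SmoothField Y) (x : M) :
    bracket Y ((kodairaEnd μ ξ C J).app X) x + J x (bracket (J.app Y) ((kodairaEnd μ ξ C J).app X) x) =
      ∑ i, ((mvfderiv (𝓡 (2 * m)) (fun y => momentCoeff μ ξ C i y (X y)) x (Y x)
          - mvfderiv (𝓡 (2 * m)) (fun y => momentCoeff μ ξ C i y (J.app X y)) x (J.app Y x)) •
            infAction M (ξ i) x +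
        (mvfderiv (𝓡 (2 * m)) (fun y => momentCoeff μ ξ C i y (J.app X y)) x (Y x)
          + mvfderiv (𝓡 (2 * m)) (fun y => momentCoeff μ ξ C i y (X y)) x (J.app Y x)) •
            J x (infAction M (ξ i) x)) := by
  have hJX := hX.app hJ.complex.smooth
  let f : Fin m ⊕ Fin m → M → ℝ := Sum.elim (fun i y => momentCoeff μ ξ C i y (X y))
    fun i y => momentCoeff μ ξ C i y (J.app X y)
  have hf : ∀ k, MDifferentiableAt (𝓡 (2 * m)) 𝓘(ℝ, ℝ) (f k) x := by
    rintro (i | i)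
    · exact (isClosedAt_momentCoeff hM i x).mdiff X hX
    · exact (isClosedAt_momentCoeff hM i x).mdiff _ hJX
  have happ : (kodairaEnd μ ξ C J).app X = fun y => ∑ k, f k y • toricFrame J ξ k y := by
    funext y
    rw [Fintype.sum_sum_type]
    change kodairaEnd μ ξ C J y (X y) = _
    rw [kodairaEnd_apply, momentEnd_apply, momentEnd_apply, map_sum]
    simp only [map_smul]
    rfl
  have hb : ∀ Z : RField (2 * m) M, bracket Z ((kodairaEnd μ ξ C J).app X) x =
      ∑ k, (mvfderiv (𝓡 (2 * m)) (f k) x (Z x) • toricFrame J ξ k x +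
        f k x • bracket Z (toricFrame J ξ k) x) := fun Z => by
    rw [happ]
    exact bracket_sum_smul_right hf
      fun k => ((smoothField_toricFrame hM hJ k).smoothFieldAt x).mdiffField
  rw [hb, hb]
  simp only [bracket_app_toricFrame hM hJ hY, map_sum, map_add, map_smul, hJ.complex.sq,
    ← Finset.sum_add_distrib]
  rw [Fintype.sum_sum_type, ← Finset.sum_add_distrib]
  refine Finset.sum_congr rfl fun i _ => ?_
  have e2 : J x (toricFrame J ξ (Sum.inr i) x) = -infAction M (ξ i) x := hJ.complex.sq x _
  have e1 : J x (toricFrame J ξ (Sum.inl i) x) = J x (infAction M (ξ i) x) := rfl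
  have e3 : toricFrame J ξ (Sum.inl i) x = infAction M (ξ i) x := rfl
  have e4 : toricFrame J ξ (Sum.inr i) x = J x (infAction M (ξ i) x) := rfl
  rw [e1, e2, e3, e4]
  simp only [f, Sum.elim_inl, Sum.elim_inr, smul_neg, sub_smul, add_smul]
  abel

/-- Antisymmetrizing the coefficient derivatives produces exactly the closedness formulas of the
forms ∑ C_ij dμ^j. Integrability of J matches the mixed brackets. -/
theorem endForm_kodairaEnd_mem (hM : IsSymplecticToric Ω μ) (hJ : IsToricKahler Ω J) :
    endForm J (kodairaEnd μ ξ C J) ∈ closed01 J := by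
  refine endForm_mem_closed01 hJ.complex (smoothEnd_kodairaEnd hM hJ)
    (kodairaEnd_comp hJ.complex.sq) fun X Y hX hY x => ?_
  have hJX := hX.app hJ.complex.smooth
  have hJY := hY.app hJ.complex.smooth
  rw [bracket_kodairaEnd hM hJ hY hX, bracket_kodairaEnd hM hJ hX hY, ← Finset.sum_sub_distrib,
    kodairaEnd_apply, momentEnd_apply, momentEnd_apply, map_sum, ← Finset.sum_add_distrib]
  refine Finset.sum_congr rfl fun i _ => ?_
  have hN := hJ.complex.nijenhuis X Y hX hY x
  have hs : J x (bracket X Y x - bracket (J.app X) (J.app Y) x) =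
      bracket X (J.app Y) x + bracket (J.app X) Y x := by
    have h1 : bracket X Y x - bracket (J.app X) (J.app Y) x =
        -J x (bracket X (J.app Y) x + bracket (J.app X) Y x) := by
      rw [← sub_eq_zero, ← neg_eq_zero, ← hN, map_add]; abel
    rw [h1, map_neg, hJ.complex.sq, neg_neg]
  have hcl := isClosedAt_momentCoeff hM (ξ := ξ) (C := C) i x
  rw [hs, map_smul, map_sub, map_add, hcl.closed X Y hX hY, hcl.closed _ _ hJX hJY,
    hcl.closed _ _ hX hJY, hcl.closed _ _ hJX hY]
  simp only [sub_smul, add_smul]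
  abel

theorem kodairaSpencerForm_of_hasDerivAt {J₀ : EndField (2 * m) M} {F : ℝ → EndField (2 * m) M}
    {A : EndField (2 * m) M} (h : ∀ x, HasDerivAt (fun t => F t x) (A x) 0) :
    kodairaSpencerForm J₀ F = endForm J₀ A := by
  have : (fun y => deriv (fun t => F t y) 0) = A := funext fun x =>
    HasDerivAt.deriv (F := EuclideanSpace ℝ (Fin (2 * m)) →L[ℝ] EuclideanSpace ℝ (Fin (2 * m))) (h x)
  rw [← this]
  rfl

theorem sharp_toricBivector (ξ : Module.Basis (Fin m) ℝ (Fin m → ℝ)) (J : EndField (2 * m) M)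
    (C : Matrix (Fin m) (Fin m) ℝ) (x : M) (η : Module.Dual ℂ (CT (2 * m) x)) :
    sharp (toricBivector ξ J C x) η = ∑ k, (∑ j, 2 * (C j k : ℂ) *
      η (part10 J x (infAction M (ξ j) x))) • part10 J x (infAction M (ξ k) x) := by
  simp only [Finset.sum_smul]
  rw [Finset.sum_comm]
  simp only [toricBivector, sharp, LinearMap.coe_mk, AddHom.coe_mk, map_smul, map_sum,
    LinearMap.rTensor_tmul, TensorProduct.lid_tmul, Finset.smul_sum, smul_smul, part10_apply]

/-- The composition of the bivector with `Ω` in terms of the first variation of the complex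
structure. -/
theorem compForm_toricBivector (hM : IsSymplecticToric Ω μ) (hJ : IsToricKahler Ω J)
    (hC : C.transpose = -C) :
    compForm (toricBivector ξ J C) Ω = endForm J (kodairaEnd μ ξ C J) := by
  have hs : ∀ i j, C j i = -C i j := fun i j => congrFun (congrFun hC i) j
  have hJJ := hJ.complex.sq
  funext x
  -- The moment map equation on K_i^{1,0} gives -½(dμ^i(v) + i dμ^i(Jv)). The ½ cancels the 2 in σ,
  -- and the minus sign is absorbed by the antisymmetry of C.
  have hΩ : ∀ (i : Fin m) (v : TangentSpace (𝓡 (2 * m)) x),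
      LinearMap.BilinForm.baseChange ℂ ((ContinuousLinearMap.coeLM ℝ).comp (Ω x).toLinearMap :
        LinearMap.BilinForm ℝ (TangentSpace (𝓡 (2 * m)) x)) (part10 J x (infAction M (ξ i) x))
        ((1 : ℂ) ⊗ₜ[ℝ] v) = -(1 / 2 : ℂ) *
          ((mvfderiv (𝓡 (2 * m)) (momentComp μ (ξ i)) x v : ℂ) + Complex.I *
            (mvfderiv (𝓡 (2 * m)) (momentComp μ (ξ i)) x (J x v) : ℂ)) := fun i v => by
    have hd := hM.isTwistData hJ hC (ξ := ξ) x
    rw [part10_eq]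
    simp only [map_smul, map_sub, LinearMap.sub_apply, LinearMap.smul_apply,
      LinearMap.BilinForm.baseChange_tmul]
    have h1 : Ω x (infAction M (ξ i) x) v = -mvfderiv (𝓡 (2 * m)) (momentComp μ (ξ i)) x v :=
      hM.hamiltonian _ _ _
    have h2 : Ω x (J x (infAction M (ξ i) x)) v =
        mvfderiv (𝓡 (2 * m)) (momentComp μ (ξ i)) x (J x v) := by
      rw [hd.J_adj, hM.hamiltonian, neg_neg]
    change (1 / 2 : ℂ) • ((Ω x (infAction M (ξ i) x) v) • ((1 : ℂ) * 1) -
      (Ω x (J x (infAction M (ξ i) x)) v) • (Complex.I * 1)) = _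
    rw [h1, h2]
    simp only [Complex.real_smul, smul_eq_mul, Complex.ofReal_neg]
    ring
  -- By complex linearity real vectors suffice; there both sides are (Bv)^{1,0} + i(BJv)^{1,0} = ((B
  -- + JBJ)v)^{1,0}.
  have hone : ∀ v : TangentSpace (𝓡 (2 * m)) x, compForm (toricBivector ξ J C) Ω x ((1 : ℂ) ⊗ₜ[ℝ] v) =
      endForm J (kodairaEnd μ ξ C J) x ((1 : ℂ) ⊗ₜ[ℝ] v) := fun v => by
    rw [endForm_apply hJJ (kodairaEnd_comp hJJ), rePart_tmul, imPart_tmul, kodairaEnd_apply]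
    simp only [Complex.one_re, Complex.one_im, one_smul, zero_smul, map_zero, add_zero]
    rw [map_add, ← I_smul_part10 hJJ, momentEnd_apply, momentEnd_apply, map_sum, map_sum,
      Finset.smul_sum, ← Finset.sum_add_distrib]
    refine (sharp_toricBivector ξ J C x _).trans ?_
    refine Finset.sum_congr rfl fun k _ => ?_
    have hc : ∀ c : ℝ, part10 J x (c • infAction M (ξ k) x) =
        (c : ℂ) • part10 J x (infAction M (ξ k) x) := fun c => by
      rw [map_smul, ← algebraMap_smul ℂ c]; rfl
    rw [hc, hc, smul_smul, ← add_smul]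
    congr 1
    rw [momentCoeff_apply, momentCoeff_apply, Complex.ofReal_sum, Complex.ofReal_sum,
      Finset.mul_sum, ← Finset.sum_add_distrib]
    refine Finset.sum_congr rfl fun l _ => ?_
    have h3 : ∀ η : CT (2 * m) x, (LinearMap.BilinForm.baseChange ℂ
        ((ContinuousLinearMap.coeLM ℝ).comp (Ω x).toLinearMap :
        LinearMap.BilinForm ℝ (TangentSpace (𝓡 (2 * m)) x))).flip ((1 : ℂ) ⊗ₜ[ℝ] v) η =
      LinearMap.BilinForm.baseChange ℂ ((ContinuousLinearMap.coeLM ℝ).comp (Ω x).toLinearMap :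
        LinearMap.BilinForm ℝ (TangentSpace (𝓡 (2 * m)) x)) η ((1 : ℂ) ⊗ₜ[ℝ] v) := fun η => rfl
    rw [h3, hΩ, hs]
    push_cast
    ring
  apply TensorProduct.AlgebraTensorModule.curry_injective
  ext v
  simpa using hone v

theorem IsToricDeformation.kodairaSpencerForm_eq [T2Space M] [CompactSpace M] [ConnectedSpace M]
    (hM : IsSymplecticToric Ω μ) (hJ : IsToricKahler Ω J) (hC : C.transpose = -C) {ε : ℝ}
    (hε : 0 < ε) {F : ℝ → EndField (2 * m) M} (hF : IsToricDeformation Ω μ ξ J C ε F) :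
    kodairaSpencerForm J F = endForm J (kodairaEnd μ ξ C J) := by
  refine kodairaSpencerForm_of_hasDerivAt fun x => HasDerivAt.congr_of_eventuallyEq
    (F := EuclideanSpace ℝ (Fin (2 * m)) →L[ℝ] EuclideanSpace ℝ (Fin (2 * m)))
    (hasDerivAt_toricTwist hM hJ hC x) ?_
  filter_upwards [Ioo_mem_nhds (neg_lt_zero.2 hε) hε] with t ht
  rw [hF.eq_toricTwist hM hJ hC ht]

theorem IsToricDeformation.kodairaSpencerForm_neg_adjoint [T2Space M] [CompactSpace M] [ConnectedSpace M]
    (hM : IsSymplecticToric Ω μ) (hJ : IsToricKahler Ω J) (hC : C.transpose = -C) {ε : ℝ}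
    (hε : 0 < ε) {F F' : ℝ → EndField (2 * m) M} (hF : IsToricDeformation Ω μ ξ J C ε F)
    (hF' : ∀ t ∈ Set.Ioo (-ε) ε, IsSymplecticAdjoint Ω (F t) (F' t)) :
    kodairaSpencerForm J (fun t => -F' t) = -endForm J (kodairaEnd μ ξ C J) := by
  rw [← endForm_neg]
  refine kodairaSpencerForm_of_hasDerivAt fun x => ?_
  have h1 : HasDerivAt (fun t : ℝ => toricTwist μ ξ C J (-t) x) ((-1 : ℝ) • kodairaEnd μ ξ C J x) 0 := by
    have h0 := hasDerivAt_toricTwist hM hJ hC (ξ := ξ) x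
    rw [← neg_zero] at h0
    exact HasDerivAt.scomp (F := EuclideanSpace ℝ (Fin (2 * m)) →L[ℝ] EuclideanSpace ℝ (Fin (2 * m)))
      (0 : ℝ) h0 (hasDerivAt_neg (0 : ℝ))
  rw [neg_one_smul] at h1
  refine HasDerivAt.congr_of_eventuallyEq
    (F := EuclideanSpace ℝ (Fin (2 * m)) →L[ℝ] EuclideanSpace ℝ (Fin (2 * m))) h1 ?_
  filter_upwards [Ioo_mem_nhds (neg_lt_zero.2 hε) hε] with t ht
  ext1 w
  have h2 := hF' t ht
  rw [hF.eq_toricTwist hM hJ hC ht] at h2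
  -- Nondegeneracy makes the symplectic adjoint unique, so the given adjoint family must be -J_{-t}.
  refine neg_eq_iff_eq_neg.2 (sub_eq_zero.1 (hM.symplectic.nondegenerate x _ fun v => ?_))
  have hd := hM.isTwistData hJ hC (ξ := ξ) x
  have e : Ω x v (F' t x w) = Ω x v (-toricTwist μ ξ C J (-t) x w) :=
    (h2 x v w).symm.trans (isSymplecticAdjoint_toricTwist hM hJ hC t x v w)
  rw [hd.swap, map_sub]
  exact neg_eq_zero.2 (sub_eq_zero.2 e)

end KodairaSpencer

/-! ### Holomorphic functions and their derivatives along the action -/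

section Holomorphic

variable {n : ℕ} {M : Type*} [TopologicalSpace M] [ChartedSpace (EuclideanSpace ℝ (Fin n)) M]
  {J : EndField n M} {U : Set M}

theorem mvfderiv_mul_apply {f g : M → ℂ} {x : M} (hf : MDifferentiableAt (𝓡 n) 𝓘(ℝ, ℂ) f x)
    (hg : MDifferentiableAt (𝓡 n) 𝓘(ℝ, ℂ) g x) (v : TangentSpace (𝓡 n) x) :
    mvfderiv (𝓡 n) (fun y => f y * g y) x v =
      f x * mvfderiv (𝓡 n) g x v + g x * mvfderiv (𝓡 n) f x v :=
  congrArg (fun L : EuclideanSpace ℝ (Fin n) →L[ℝ] ℂ => L v)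
    (hf.hasMFDerivAt.mul hg.hasMFDerivAt).mfderiv

theorem IsHolomorphicOn.contMDiffAt {f : M → ℂ} (hf : IsHolomorphicOn J f U) (hU : IsOpen U) {x : M}
    (hx : x ∈ U) : ContMDiffAt (𝓡 n) 𝓘(ℝ, ℂ) ∞ f x :=
  hf.1.contMDiffAt (hU.mem_nhds hx)

theorem IsHolomorphicOn.mdifferentiableAt {f : M → ℂ} (hf : IsHolomorphicOn J f U) (hU : IsOpen U)
    {x : M} (hx : x ∈ U) : MDifferentiableAt (𝓡 n) 𝓘(ℝ, ℂ) f x :=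
  (hf.contMDiffAt hU hx).mdifferentiableAt (by simp)

theorem isHolomorphicOn_const (c : ℂ) : IsHolomorphicOn J (fun _ => c) U :=
  ⟨contMDiffOn_const, fun x _ v => by simp [mvfderiv_const]⟩

theorem IsHolomorphicOn.add (hU : IsOpen U) {f g : M → ℂ} (hf : IsHolomorphicOn J f U)
    (hg : IsHolomorphicOn J g U) : IsHolomorphicOn J (fun x => f x + g x) U := by
  refine ⟨hf.1.add hg.1, fun x hx v => ?_⟩
  rw [mvfderiv_fun_add (hf.mdifferentiableAt hU hx) (hg.mdifferentiableAt hU hx)]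
  rw [add_apply, add_apply, hf.2 x hx, hg.2 x hx, mul_add]

theorem IsHolomorphicOn.mul (hU : IsOpen U) {f g : M → ℂ} (hf : IsHolomorphicOn J f U)
    (hg : IsHolomorphicOn J g U) : IsHolomorphicOn J (fun x => f x * g x) U := by
  have hmul : ContDiff ℝ ∞ fun p : ℂ × ℂ => p.1 * p.2 := contDiff_mul
  refine ⟨hmul.contMDiff.comp_contMDiffOn (hf.1.prodMk_space hg.1), fun x hx v => ?_⟩
  rw [mvfderiv_mul_apply (hf.mdifferentiableAt hU hx) (hg.mdifferentiableAt hU hx),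
    mvfderiv_mul_apply (hf.mdifferentiableAt hU hx) (hg.mdifferentiableAt hU hx), hf.2 x hx,
    hg.2 x hx]
  ring

theorem IsHolomorphicOn.sum (hU : IsOpen U) {ι : Type*} (s : Finset ι) {f : ι → M → ℂ}
    (hf : ∀ i, IsHolomorphicOn J (f i) U) : IsHolomorphicOn J (fun x => ∑ i ∈ s, f i x) U := by
  classical
  induction s using Finset.induction_on with
  | empty => simpa using isHolomorphicOn_const 0
  | insert a s ha ih => simpa only [Finset.sum_insert ha] using (hf a).add hU ih

theorem IsHolomorphicOn.congr [IsManifold (𝓡 n) ∞ M] (hU : IsOpen U) {f g : M → ℂ}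
    (hf : IsHolomorphicOn J f U) (h : ∀ x ∈ U, g x = f x) : IsHolomorphicOn J g U := by
  refine ⟨hf.1.congr h, fun x hx v => ?_⟩
  have e : g =ᶠ[𝓝 x] f := by filter_upwards [hU.mem_nhds hx] with y hy using h y hy
  rw [mvfderiv_congr e, hf.2 x hx]

/-- The derivative of a holomorphic function along a flow of holomorphic maps is holomorphic. -/
theorem IsHolomorphicOn.mvfderiv_flow [IsManifold (𝓡 n) ∞ M] (hU : IsOpen U) {f : M → ℂ}
    (hf : IsHolomorphicOn J f U) {g : ℝ → M → M} {K : RField n M} (hg : IsVelocity n g K)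
    (hJ : ∀ s x v, mfderiv (𝓡 n) (𝓡 n) (g s) x (J x v) = J (g s x) (mfderiv (𝓡 n) (𝓡 n) (g s) x v)) :
    IsHolomorphicOn J (fun x => mvfderiv (𝓡 n) f x (K x)) U := by
  refine ⟨fun x hx => ((hg.smoothField.smoothFieldAt x).contMDiffAt_mvfderiv
    (hf.contMDiffAt hU hx)).contMDiffWithinAt, fun x hx v => ?_⟩
  have h1 := hg.hasDerivAt_mvfderiv ((hf.contMDiffAt hU hx).of_le (by norm_cast))
  have h2 : ∀ w : TangentSpace (𝓡 n) x, HasDerivAt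
      (fun s => mvfderiv (𝓡 n) (fun y => f (g s y)) x w)
      (mvfderiv (𝓡 n) (fun y => mvfderiv (𝓡 n) f y (K y)) x w) 0 := fun w =>
    HasFDerivAt.comp_hasDerivAt (0 : ℝ)
      ((ContinuousLinearMap.apply ℝ ℂ (E := EuclideanSpace ℝ (Fin n)) w).hasFDerivAt) h1
  -- For small s the function f ∘ g_s satisfies the Cauchy–Riemann equation at x; differentiating it
  -- at s = 0 gives the equation for Kf.
  refine (h2 (J x v)).unique (((h2 v).const_mul Complex.I).congr_of_eventuallyEq ?_)
  have hc : ContinuousAt (fun s => g s x) 0 := (hg.smooth_orbit x).continuous.continuousAt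
  filter_upwards [hc.eventually_mem (hU.mem_nhds (by rw [hg.zero]; exact hx))] with s hs
  have h3 : ∀ w : TangentSpace (𝓡 n) x, mvfderiv (𝓡 n) (fun y => f (g s y)) x w =
      mvfderiv (𝓡 n) f (g s x) (mfderiv (𝓡 n) (𝓡 n) (g s) x w) := fun w =>
    mfderiv_comp_apply (I := 𝓡 n) (I' := 𝓡 n) (I'' := 𝓘(ℝ, ℂ)) (g := f) (f := g s) x (hf.mdifferentiableAt hU hs)
      ((hg.smooth_map s).mdifferentiable (by simp) x) w
  rw [h3, h3, hJ, hf.2 _ hs]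

/-- The differential of a holomorphic function kills T^{0,1}, so K^{1,0} may be replaced by the real
field K in the Poisson bracket. -/
theorem cdiff_part10 {f : M → ℂ} (hf : IsHolomorphicOn J f U) {x : M} (hx : x ∈ U)
    (v : TangentSpace (𝓡 n) x) : cdiff f x (part10 J x v) = mvfderiv (𝓡 n) f x v := by
  rw [part10_eq, map_smul, map_sub]
  simp only [cdiff, LinearMap.liftBaseChange_tmul]
  change (1 / 2 : ℂ) • ((1 : ℂ) • mvfderiv (𝓡 n) f x v - Complex.I • mvfderiv (𝓡 n) f x (J x v)) = _
  rw [hf.2 x hx]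
  simp only [smul_eq_mul]
  ring_nf
  rw [Complex.I_sq]
  ring

end Holomorphic

/-! ### The algebraic Jacobi identity -/

section Jacobi

variable {m : ℕ}

/-- The Jacobi identity for a constant bivector in commuting directions. -/
theorem jacobi_of_skew {C : Fin m → Fin m → ℂ} (hC : ∀ i j, C j i = -C i j) (f g h : Fin m → ℂ)
    {F G H : Fin m → Fin m → ℂ} (hF : ∀ i j, F i j = F j i) (hG : ∀ i j, G i j = G j i)
    (hH : ∀ i j, H i j = H j i) :
    ∑ k, (∑ j, C j k * f j) * ∑ b, ∑ a, C a b * (G a k * h b + g a * H b k) +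
    ∑ k, (∑ j, C j k * g j) * ∑ b, ∑ a, C a b * (H a k * f b + h a * F b k) +
    ∑ k, (∑ j, C j k * h j) * ∑ b, ∑ a, C a b * (F a k * g b + f a * G b k) = 0 := by
  -- Here u f is the Hamiltonian vector of f and Q is a Hessian evaluated on two such vectors. Each
  -- double bracket is a difference of two Hessian terms, and over the cyclic sum they cancel in
  -- pairs by symmetry.
  let u : (Fin m → ℂ) → Fin m → ℂ := fun f k => ∑ j, C j k * f j
  let Q : (Fin m → Fin m → ℂ) → (Fin m → ℂ) → (Fin m → ℂ) → ℂ := fun G p q =>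
    ∑ k, ∑ a, p k * G a k * q a
  have hQ : ∀ G : Fin m → Fin m → ℂ, (∀ i j, G i j = G j i) → ∀ p q, Q G p q = Q G q p := by
    intro G hG p q
    change ∑ k, ∑ a, p k * G a k * q a = ∑ k, ∑ a, q k * G a k * p a
    rw [Finset.sum_comm]
    refine Finset.sum_congr rfl fun i _ => Finset.sum_congr rfl fun j _ => ?_
    rw [hG]; ring
  have key : ∀ (f g h : Fin m → ℂ) (G H : Fin m → Fin m → ℂ),
      ∑ k, (∑ j, C j k * f j) * ∑ b, ∑ a, C a b * (G a k * h b + g a * H b k) =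
        -Q G (u f) (u h) + Q H (u f) (u g) := by
    intro f g h G H
    change ∑ k, u f k * ∑ b, ∑ a, C a b * (G a k * h b + g a * H b k) =
      -(∑ k, ∑ a, u f k * G a k * u h a) + ∑ k, ∑ b, u f k * H b k * u g b
    rw [← Finset.sum_neg_distrib, ← Finset.sum_add_distrib]
    refine Finset.sum_congr rfl fun k _ => ?_
    simp only [mul_add, Finset.sum_add_distrib]
    congr 1
    · rw [Finset.sum_comm, Finset.mul_sum, ← Finset.sum_neg_distrib]
      refine Finset.sum_congr rfl fun a _ => ?_
      change _ = -(u f k * G a k * ∑ j, C j a * h j)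
      rw [Finset.mul_sum, Finset.mul_sum, ← Finset.sum_neg_distrib]
      refine Finset.sum_congr rfl fun b _ => ?_
      rw [hC a b]; ring
    · rw [Finset.mul_sum]
      refine Finset.sum_congr rfl fun b _ => ?_
      change _ = u f k * H b k * ∑ j, C j b * g j
      rw [Finset.mul_sum, Finset.mul_sum]
      refine Finset.sum_congr rfl fun a _ => ?_
      ring
  rw [key, key, key, hQ G hG (u f), hQ H hH (u f), hQ F hF (u g)]
  ring

end Jacobi

/-! ### The holomorphic Poisson structure -/

section Poisson

variable {m : ℕ} {M : Type*} [TopologicalSpace M]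
  [ChartedSpace (EuclideanSpace ℝ (Fin (2 * m))) M] [MulAction (Fin m → Circle) M]
  [IsManifold (𝓡 (2 * m)) ∞ M] {Ω : TwoTensor (2 * m) M} {μ : M → Fin m → ℝ}
  {ξ : Module.Basis (Fin m) ℝ (Fin m → ℝ)} {C : Matrix (Fin m) (Fin m) ℝ} {J : EndField (2 * m) M}
  {U : Set M}

theorem poissonBracket_toricBivector {f g : M → ℂ} (hf : IsHolomorphicOn J f U)
    (hg : IsHolomorphicOn J g U) {x : M} (hx : x ∈ U) :
    poissonBracket (toricBivector ξ J C) f g x =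
      ∑ k, (∑ j, 2 * (C j k : ℂ) * mvfderiv (𝓡 (2 * m)) f x (infAction M (ξ j) x)) *
        mvfderiv (𝓡 (2 * m)) g x (infAction M (ξ k) x) := by
  rw [poissonBracket, sharp_toricBivector, map_sum]
  refine Finset.sum_congr rfl fun k _ => ?_
  rw [map_smul, cdiff_part10 hg hx, smul_eq_mul]
  congr 1
  refine Finset.sum_congr rfl fun j _ => ?_
  rw [cdiff_part10 hf hx]

theorem IsHolomorphicOn.mvfderiv_infAction (hM : IsSymplecticToric Ω μ) (hJ : IsToricKahler Ω J)
    (hU : IsOpen U) {f : M → ℂ} (hf : IsHolomorphicOn J f U) (a : Fin m → ℝ) :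
    IsHolomorphicOn J (fun x => mvfderiv (𝓡 (2 * m)) f x (infAction M a x)) U :=
  hf.mvfderiv_flow hU (hM.isVelocity a) fun _ _ _ => hJ.invariant _ _ _

theorem isHolomorphicOn_poissonBracket (hM : IsSymplecticToric Ω μ) (hJ : IsToricKahler Ω J)
    (hU : IsOpen U) {f g : M → ℂ} (hf : IsHolomorphicOn J f U) (hg : IsHolomorphicOn J g U) :
    IsHolomorphicOn J (poissonBracket (toricBivector ξ J C) f g) U := by
  refine IsHolomorphicOn.congr hU (IsHolomorphicOn.sum hU Finset.univ fun k =>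
    IsHolomorphicOn.mul hU (IsHolomorphicOn.sum hU Finset.univ fun j =>
      (isHolomorphicOn_const (2 * (C j k : ℂ))).mul hU (hf.mvfderiv_infAction hM hJ hU (ξ j)))
      (hg.mvfderiv_infAction hM hJ hU (ξ k)))
    fun x hx => poissonBracket_toricBivector hf hg hx

theorem mvfderiv_poissonBracket (hM : IsSymplecticToric Ω μ) (hJ : IsToricKahler Ω J)
    (hU : IsOpen U) {f g : M → ℂ} (hf : IsHolomorphicOn J f U) (hg : IsHolomorphicOn J g U) {x : M}
    (hx : x ∈ U) (v : TangentSpace (𝓡 (2 * m)) x) :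
    mvfderiv (𝓡 (2 * m)) (poissonBracket (toricBivector ξ J C) f g) x v =
      ∑ k, ∑ j, 2 * (C j k : ℂ) *
        (mvfderiv (𝓡 (2 * m)) (fun y => mvfderiv (𝓡 (2 * m)) f y (infAction M (ξ j) y)) x v *
          mvfderiv (𝓡 (2 * m)) g x (infAction M (ξ k) x) +
        mvfderiv (𝓡 (2 * m)) f x (infAction M (ξ j) x) *
          mvfderiv (𝓡 (2 * m)) (fun y => mvfderiv (𝓡 (2 * m)) g y (infAction M (ξ k) y)) x v) := by
  have hK : ∀ {h : M → ℂ}, IsHolomorphicOn J h U → ∀ a, MDifferentiableAt (𝓡 (2 * m)) 𝓘(ℝ, ℂ)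
      (fun y => mvfderiv (𝓡 (2 * m)) h y (infAction M a y)) x := fun hh a =>
    (hh.mvfderiv_infAction hM hJ hU a).mdifferentiableAt hU hx
  have hsum : ∀ {F : Fin m → M → ℂ}, (∀ i, MDifferentiableAt (𝓡 (2 * m)) 𝓘(ℝ, ℂ) (F i) x) →
      mvfderiv (𝓡 (2 * m)) (fun y => ∑ i, F i y) x v = ∑ i, mvfderiv (𝓡 (2 * m)) (F i) x v := by
    intro F hF
    have h := HasMFDerivAt.sum (t := Finset.univ) fun i _ => (hF i).hasMFDerivAt
    have e : (∑ i, F i) = fun y => ∑ i, F i y := by funext y; simp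
    rw [e] at h
    have h' := congrArg (fun L : EuclideanSpace ℝ (Fin (2 * m)) →L[ℝ] ℂ => L v) h.mfderiv
    refine Eq.trans h' ?_
    exact map_sum (ContinuousLinearMap.apply ℝ ℂ (E := EuclideanSpace ℝ (Fin (2 * m))) v) _ _
  have hterm : ∀ k j, MDifferentiableAt (𝓡 (2 * m)) 𝓘(ℝ, ℂ) (fun y => 2 * (C j k : ℂ) *
      mvfderiv (𝓡 (2 * m)) f y (infAction M (ξ j) y)) x := fun k j =>
    mdifferentiableAt_const.mul (hK hf _)
  have hin : ∀ k, MDifferentiableAt (𝓡 (2 * m)) 𝓘(ℝ, ℂ) (fun y => ∑ j, 2 * (C j k : ℂ) *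
      mvfderiv (𝓡 (2 * m)) f y (infAction M (ξ j) y)) x := fun k =>
    ((IsHolomorphicOn.sum hU Finset.univ fun j => (isHolomorphicOn_const (2 * (C j k : ℂ))).mul hU
      (hf.mvfderiv_infAction hM hJ hU (ξ j)))).mdifferentiableAt hU hx
  have e : poissonBracket (toricBivector ξ J C) f g =ᶠ[𝓝 x] fun x =>
      ∑ k, (∑ j, 2 * (C j k : ℂ) * mvfderiv (𝓡 (2 * m)) f x (infAction M (ξ j) x)) *
        mvfderiv (𝓡 (2 * m)) g x (infAction M (ξ k) x) := by
    filter_upwards [hU.mem_nhds hx] with y hy using poissonBracket_toricBivector hf hg hy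
  rw [mvfderiv_congr e, hsum (F := fun k x =>
    (∑ j, 2 * (C j k : ℂ) * mvfderiv (𝓡 (2 * m)) f x (infAction M (ξ j) x)) *
      mvfderiv (𝓡 (2 * m)) g x (infAction M (ξ k) x)) fun k => (hin k).mul (hK hg _)]
  refine Finset.sum_congr rfl fun k _ => ?_
  rw [mvfderiv_mul_apply (hin k) (hK hg _), hsum (hterm k), Finset.sum_mul, Finset.mul_sum,
    ← Finset.sum_add_distrib]
  refine Finset.sum_congr rfl fun j _ => ?_
  rw [mvfderiv_mul_apply mdifferentiableAt_const (hK hf _), mvfderiv_const, zero_apply]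
  ring

/-- The torus is abelian, so the fields commute as derivations; this is the symmetry of the Hessians
that the Jacobi identity needs. -/
theorem mvfderiv_infAction_comm (hM : IsSymplecticToric Ω μ) {f : M → ℂ} {x : M}
    (hf : ContMDiffAt (𝓡 (2 * m)) 𝓘(ℝ, ℂ) ∞ f x) (a b : Fin m → ℝ) :
    mvfderiv (𝓡 (2 * m)) (fun y => mvfderiv (𝓡 (2 * m)) f y (infAction M a y)) x (infAction M b x) =
      mvfderiv (𝓡 (2 * m)) (fun y => mvfderiv (𝓡 (2 * m)) f y (infAction M b y)) x
        (infAction M a x) := by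
  have h := mvfderiv_bracket (hf.of_le (by norm_cast))
    ((hM.smoothField b).smoothFieldAt x).mdiffField ((hM.smoothField a).smoothFieldAt x).mdiffField
  rw [hM.bracket_infAction_infAction, map_zero] at h
  exact sub_eq_zero.1 h.symm

theorem isHolomorphicPoisson_toricBivector (hM : IsSymplecticToric Ω μ) (hJ : IsToricKahler Ω J)
    (hC : C.transpose = -C) : IsHolomorphicPoisson J (toricBivector ξ J C) := by
  have hs : ∀ i j, C j i = -C i j := fun i j => congrFun (congrFun hC i) j
  have hP := complexify_part10 hJ.complex.sq
  simp only [part10_apply] at hP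
  refine ⟨fun x => ?_, fun x => ?_, fun x => ?_, fun U f g hU hf hg =>
    isHolomorphicOn_poissonBracket hM hJ hU hf hg, fun U f g h hU hf hg hh x hx => ?_⟩
  · simp only [toricBivector, map_smul, map_sum, TensorProduct.map_tmul, hP, LinearMap.id_apply,
      ← TensorProduct.smul_tmul', Finset.smul_sum]
    refine Finset.sum_congr rfl fun k _ => Finset.sum_congr rfl fun j _ => ?_
    simp only [smul_smul]
    congr 1
    ring
  · simp only [toricBivector, map_smul, map_sum, TensorProduct.map_tmul, hP, LinearMap.id_apply,
      TensorProduct.tmul_smul, Finset.smul_sum]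
    refine Finset.sum_congr rfl fun k _ => Finset.sum_congr rfl fun j _ => ?_
    simp only [smul_smul]
    congr 1
    ring
  · simp only [toricBivector, map_smul, map_sum, TensorProduct.comm_tmul]
    rw [Finset.sum_comm, eq_neg_iff_add_eq_zero, ← smul_add, ← Finset.sum_add_distrib]
    refine (congrArg _ (Finset.sum_eq_zero fun k _ => ?_)).trans (smul_zero _)
    rw [← Finset.sum_add_distrib]
    refine Finset.sum_eq_zero fun j _ => ?_
    rw [← add_smul, hs k j, Complex.ofReal_neg, neg_add_cancel, zero_smul]
  · have hfg := isHolomorphicOn_poissonBracket hM hJ hU hf hg (ξ := ξ) (C := C)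
    have hgh := isHolomorphicOn_poissonBracket hM hJ hU hg hh (ξ := ξ) (C := C)
    have hhf := isHolomorphicOn_poissonBracket hM hJ hU hh hf (ξ := ξ) (C := C)
    rw [poissonBracket_toricBivector hf hgh hx, poissonBracket_toricBivector hg hhf hx,
      poissonBracket_toricBivector hh hfg hx]
    simp only [mvfderiv_poissonBracket hM hJ hU hf hg hx, mvfderiv_poissonBracket hM hJ hU hg hh hx,
      mvfderiv_poissonBracket hM hJ hU hh hf hx]
    exact jacobi_of_skew (C := fun j k => 2 * (C j k : ℂ))
      (F := fun i j => mvfderiv (𝓡 (2 * m)) (fun y => mvfderiv (𝓡 (2 * m)) f y (infAction M (ξ i) y)) x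
        (infAction M (ξ j) x))
      (G := fun i j => mvfderiv (𝓡 (2 * m)) (fun y => mvfderiv (𝓡 (2 * m)) g y (infAction M (ξ i) y)) x
        (infAction M (ξ j) x))
      (H := fun i j => mvfderiv (𝓡 (2 * m)) (fun y => mvfderiv (𝓡 (2 * m)) h y (infAction M (ξ i) y)) x
        (infAction M (ξ j) x))
      (fun i j => by rw [hs i j, Complex.ofReal_neg, mul_neg])
      (fun i => mvfderiv (𝓡 (2 * m)) f x (infAction M (ξ i) x))
      (fun i => mvfderiv (𝓡 (2 * m)) g x (infAction M (ξ i) x))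
      (fun i => mvfderiv (𝓡 (2 * m)) h x (infAction M (ξ i) x))
      (fun i j => mvfderiv_infAction_comm hM (hf.contMDiffAt hU hx) (ξ i) (ξ j))
      (fun i j => mvfderiv_infAction_comm hM (hg.contMDiffAt hU hx) (ξ i) (ξ j))
      (fun i j => mvfderiv_infAction_comm hM (hh.contMDiffAt hU hx) (ξ i) (ξ j))

end Poisson

/-! ### Nontriviality for C ≠ 0 -/

section Nontrivial

variable {m : ℕ} {M : Type*} [TopologicalSpace M]
  [ChartedSpace (EuclideanSpace ℝ (Fin (2 * m))) M] [MulAction (Fin m → Circle) M]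
  [IsManifold (𝓡 (2 * m)) ∞ M] {Ω : TwoTensor (2 * m) M} {μ : M → Fin m → ℝ}
  {ξ : Module.Basis (Fin m) ℝ (Fin m → ℝ)} {C : Matrix (Fin m) (Fin m) ℝ} {J : EndField (2 * m) M}

theorem toricBivector_ne_zero [T2Space M] [CompactSpace M] [ConnectedSpace M]
    (hM : IsSymplecticToric Ω μ) (hJ : IsToricKahler Ω J) (hC : C.transpose = -C) (hne : C ≠ 0) :
    toricBivector ξ J C ≠ 0 := by
  intro h0
  obtain ⟨x, hx⟩ := hM.dense_freeLocus.nonempty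
  have hA : ∀ v, kodairaEnd μ ξ C J x v = 0 := fun v => by
    have h1 := congrFun (compForm_toricBivector hM hJ hC (ξ := ξ)) x
    have h2 : compForm (toricBivector ξ J C) Ω x ((1 : ℂ) ⊗ₜ[ℝ] v) = 0 := by
      rw [h0]
      simp [compForm, sharp]
    rw [h1, endForm_apply hJ.complex.sq (kodairaEnd_comp hJ.complex.sq)] at h2
    have h3 := congrArg rePart h2
    rw [rePart_part10, rePart_tmul, imPart_tmul] at h3
    simpa using h3
  obtain ⟨D, S, hD, -, -⟩ := exists_momentFrame hM hJ hx (ξ := ξ)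
  apply hne
  ext i j
  obtain ⟨k, hk, hkD⟩ := hD.1 j
  -- If σ = 0 then B + JBJ = 0. On D_j the second term drops because J D_j lies in 𝒦, so B D_j = ∑
  -- C_ij K_i = 0, and freeness gives C = 0.
  have hJD : momentEnd μ ξ C x (J x (D j)) = 0 := by
    have hkD' : J x k = D j := hkD
    rw [← hkD', hJ.complex.sq, map_neg, hM.momentEnd_orbitSpan hk, neg_zero]
  have h := hA (D j)
  rw [kodairaEnd_apply, hJD, map_zero, add_zero, momentEnd_apply] at h
  simp only [momentCoeff_apply, hD.2, mul_ite, mul_one, mul_zero, Finset.sum_ite_eq',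
    Finset.mem_univ, if_true] at h
  rw [← hM.infAction_sum] at h
  exact Fintype.linearIndependent_iff.1 ξ.linearIndependent _ (hM.infAction_injective hx h) i

theorem IsToricDeformation.not_isToricKahler [T2Space M] [CompactSpace M] [ConnectedSpace M]
    (hM : IsSymplecticToric Ω μ) (hC : C.transpose = -C) (hne : C ≠ 0) {ε : ℝ}
    {F : ℝ → EndField (2 * m) M} (hF : IsToricDeformation Ω μ ξ J C ε F) {t : ℝ}
    (ht : t ∈ Set.Ioo (-ε) ε) (ht0 : t ≠ 0) : ¬ IsToricKahler Ω (F t) := by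
  intro hK
  obtain ⟨x, hx⟩ := hM.dense_freeLocus.nonempty
  obtain ⟨D, S, hD, hS, -, hFA⟩ := hF.form x hx
  have hd := hM.isTwistData hK hC (ξ := ξ) x
  apply hne
  ext i j
  -- Compatibility would make ω(J_t ·, ·) symmetric, hence S + tC symmetric; as S is symmetric and C
  -- antisymmetric, tC = 0.
  have h1 : ∀ i j, Ω x (F t x (D i)) (D j) = -(S + t • C) j i := fun i j => by
    rw [(hFA t ht).1]
    simp [hM.hamiltonian, hD.2]
  have h2 : (S + t • C) i j = (S + t • C) j i := by
    have h := hd.J_adj (D i) (D j)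
    rw [hd.swap (D i), h1, h1] at h
    linarith
  have hSij : S j i = S i j := by simpa using hS.1.apply i j
  have hCij : C j i = -C i j := congrFun (congrFun hC i) j
  simp only [Matrix.add_apply, Matrix.smul_apply, smul_eq_mul, hSij, hCij] at h2
  have h3 : t * C i j = 0 := by linarith
  simpa [ht0] using h3

end Nontrivial

end ToricGK

end

theorem proposition3p13 {m : ℕ} {M : Type*} [TopologicalSpace M]
    [ChartedSpace (EuclideanSpace ℝ (Fin (2 * m))) M] [IsManifold (𝓡 (2 * m)) ∞ M]
    [T2Space M] [CompactSpace M] [ConnectedSpace M] [MulAction (Fin m → Circle) M]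
    (Ω : TwoTensor (2 * m) M) (μ : M → Fin m → ℝ) (hM : IsSymplecticToric Ω μ)
    (ξ : Module.Basis (Fin m) ℝ (Fin m → ℝ))
    (J₀ : EndField (2 * m) M) (hJ₀ : IsToricKahler Ω J₀)
    (C : Matrix (Fin m) (Fin m) ℝ) (hC : C.transpose = -C) :
    IsHolomorphicPoisson J₀ (toricBivector ξ J₀ C) ∧
    (∃ ε > 0, ∃ J : ℝ → EndField (2 * m) M, IsToricDeformation Ω μ ξ J₀ C ε J) ∧
    ∃ c : H01 J₀, HasClass J₀ (compForm (toricBivector ξ J₀ C) Ω) c ∧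
      ∀ ε > 0, ∀ J : ℝ → EndField (2 * m) M, IsToricDeformation Ω μ ξ J₀ C ε J →
        HasClass J₀ (kodairaSpencerForm J₀ J) c ∧
        (∀ J' : ℝ → EndField (2 * m) M,
          (∀ t ∈ Set.Ioo (-ε) ε, IsSymplecticAdjoint Ω (J t) (J' t)) →
          HasClass J₀ (kodairaSpencerForm J₀ (fun t => -J' t)) (-c)) ∧
        (C ≠ 0 → toricBivector ξ J₀ C ≠ 0 ∧
          ∀ t ∈ Set.Ioo (-ε) ε, t ≠ 0 → ¬ IsToricKahler Ω (J t)) := by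
  have hclosed := endForm_kodairaEnd_mem hM hJ₀ (ξ := ξ) (C := C)
  refine ⟨isHolomorphicPoisson_toricBivector hM hJ₀ hC,
    ⟨1, one_pos, toricTwist μ ξ C J₀, isToricDeformation_toricTwist hM hJ₀ hC 1⟩,
    -- The class is represented by the form of B + JBJ, to which σω and the Kodaira–Spencer form of
    -- every admissible family are equal, not merely cohomologous.
    Submodule.Quotient.mk ⟨_, hclosed⟩, ?_, fun ε hε J hJ => ⟨?_, fun J' hJ' => ?_, fun hne =>
      ⟨toricBivector_ne_zero hM hJ₀ hC hne, fun t ht ht0 => hJ.not_isToricKahler hM hC hne ht ht0⟩⟩⟩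
  · rw [compForm_toricBivector hM hJ₀ hC]
    exact ⟨hclosed, rfl⟩
  · rw [hJ.kodairaSpencerForm_eq hM hJ₀ hC hε]
    exact ⟨hclosed, rfl⟩
  · rw [hJ.kodairaSpencerForm_neg_adjoint hM hJ₀ hC hε hJ']
    exact ⟨neg_mem hclosed, rfl⟩
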